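/- **Double Hurwitz numbers.** Let $\mu=(\mu_1,\dots,\mu_m)$ and $\nu=(\nu_1,\dots,\nu_n)$ be sequences of positive integers with $\sum_i\mu_i=\sum_j\nu_j=d$. The genus-$g$ double Hurwitz number $h^g_{\mu;\nu}$ is the number of isomorphism classes of connected genus-$g$ branched covers of $\mathbb{CP}^1$ of degree $d$ whose preimages of $\infty$ are labelled and have multiplicities $\mu_1,\dots,\mu_m$, whose preimages of $0$ are labelled and have multiplicities $\nu_1,\dots,\nu_n$, and which have $r=m+n+2g-2$ further fixed simple branch points and no other branching. Each class is counted with weight $1/|\mathrm{Aut}|$. Covers are described, as usual, by their monodromy: permutations $\sigma_\infty,\tau_1,\dots,\tau_r,\sigma_0\in S_d$ with $\sigma_\infty\tau_1\cdots\tau_r\sigma_0=1$ that generate a transitive group, where the $\tau_k$ are transpositions, the cycles of $\sigma_\infty$ are labelled by $1,\dots,m$ and have lengths $\mu_i$, and the cycles of $\sigma_0$ are labelled by $1,\dots,n$ and have lengths $\nu_j$. Isomorphisms are the relabellings of the $d$ sheets that respect all these data. **Theorem.** Let $\mu_1,\mu_2,\mu_3$ and $\nu_1,\dots,\nu_n$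 be positive integers with $\mu_1+\mu_2+\mu_3=\nu_1+\dots+\nu_n=d$. For $J\subseteq\{1,\dots,n\}$ write $\nu_J=\sum_{j\in J}\nu_j$ and $\bar J=\{1,\dots,n\}\setminus J$. Then $$ \begin{aligned} \frac{h^0_{\mu_1,\mu_2,\mu_3;\nu}}{(n+1)!}={}&\sum_{J:\ \nu_J\le\mu_2}\mu_1^{n-|J|-1}\mu_2^{|J|-1}A_J\\ &+\sum_{J\ne\varnothing:\ \nu_J<\mu_3}(\mu_3-\nu_J)\,\mu_3^{|J|-1}\sum_{K\subseteq\bar J:\ \nu_K\le\mu_2}\mu_1^{n-|J|-|K|-1}\mu_2^{|K|-1}B_{JK}\\ &+\sum_{J:\ \mu_2<\nu_J<\mu_2+\mu_3}(\mu_2+\mu_3-\nu_J)\,\mu_1^{n-|J|-1}\sum_{K\subseteq J:\ \nu_K<\nu_J-\mu_2}\mu_2^{|J|-|K|-1}\mu_3^{|K|-1}C_{JK}, \end{aligned} $$ where $A_J=d\mu_2-\nu_J(\mu_1+\mu_2)$, $B_{JK}=(d-\nu_J)\mu_2-\nu_K(\mu_1+\mu_2)$ and $C_{JK}=\nu_J\mu_3-\nu_K(\mu_2+\mu_3)$.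 The empty set is allowed as $J$ in the first sum and as $K$ in the inner sums, but not as $J$ in the second sum. (If no $\nu_J$ equals $\mu_2$, the conditions $\nu_J\le\mu_2$ and $\nu_K\le\mu_2$ may be replaced by strict inequalities.) -/

import Mathlib

open scoped Nat

/-- A connected branched cover of degree `d` of the Riemann sphere, given by its monodromy data.

The branch points are `∞`, `0` and `r` further fixed points. The sheets over a base point are
numbered by `Fin d`. Standard generators of the fundamental group of the punctured sphere (loops
around `∞`, around the `r` simple branch points, and around `0`, whose product is trivial) act on
the sheets by the permutations `monoInfty`, `mono k`, `monoZero`; the cover is connected iff this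
action is transitive. A branch point is simple iff its monodromy is a transposition. The preimages
of `∞` (resp. `0`) are the cycles of `monoInfty` (resp. `monoZero`), fixed points included, and the
multiplicity of a preimage is the length of its cycle. The preimages of `∞` and `0` are labelled:
`pole x` (resp. `zero x`) is the label of the preimage of `∞` (resp. `0`) lying in the cycle of the
sheet `x`, and the preimage with label `i` has multiplicity `μ i` (resp. `ν i`). All parts `μ i`,
`ν i` are meant to be positive. -/
structure LabelledCover {m n : ℕ} (d r : ℕ) (μ : Fin m → ℕ) (ν : Fin n → ℕ) where
  /-- monodromy around `∞` -/
  monoInfty : Equiv.Perm (Fin d)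
  /-- monodromy around the simple branch points -/
  mono : Fin r → Equiv.Perm (Fin d)
  /-- monodromy around `0` -/
  monoZero : Equiv.Perm (Fin d)
  prod_eq_one : monoInfty * (List.ofFn mono).prod * monoZero = 1
  simple : ∀ k, (mono k).IsSwap
  connected : ∀ x y : Fin d,
    ∃ g ∈ Subgroup.closure (insert monoInfty (insert monoZero (Set.range mono))), g x = y
  /-- label of the preimage of `∞` to which a sheet belongs -/
  pole : Fin d → Fin m
  pole_eq_iff : ∀ x y, pole x = pole y ↔ monoInfty.SameCycle x y
  pole_mult : ∀ i, Nat.card {x // pole x = i} = μ i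
  /-- label of the preimage of `0` to which a sheet belongs -/
  zero : Fin d → Fin n
  zero_eq_iff : ∀ x y, zero x = zero y ↔ monoZero.SameCycle x y
  zero_mult : ∀ j, Nat.card {x // zero x = j} = ν j

namespace LabelledCover

variable {m n d r : ℕ} {μ : Fin m → ℕ} {ν : Fin n → ℕ}

/-- The bijection `π` of the sheets is an isomorphism of covers from `c` to `c'`: it intertwines
all the monodromies and preserves the labels. -/
structure IsIso (π : Equiv.Perm (Fin d)) (c c' : LabelledCover d r μ ν) : Prop where
  monoInfty : ∀ x, π (c.monoInfty x) = c'.monoInfty (π x)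
  mono : ∀ k x, π (c.mono k x) = c'.mono k (π x)
  monoZero : ∀ x, π (c.monoZero x) = c'.monoZero (π x)
  pole : ∀ x, c'.pole (π x) = c.pole x
  zero : ∀ x, c'.zero (π x) = c.zero x

/-- Isomorphism of covers as an equivalence relation. -/
instance setoid (d r : ℕ) (μ : Fin m → ℕ) (ν : Fin n → ℕ) : Setoid (LabelledCover d r μ ν) where
  r c c' := ∃ π, IsIso π c c'
  iseqv :=
    { refl := fun c => ⟨1, by constructor <;> simp⟩
      symm := by
        rintro c c' ⟨π, h⟩
        refine ⟨π⁻¹, ?_, ?_, ?_, ?_, ?_⟩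
        · intro x; apply π.injective; simp [h.monoInfty]
        · intro k x; apply π.injective; simp [h.mono]
        · intro x; apply π.injective; simp [h.monoZero]
        · intro x; rw [← h.pole]; simp
        · intro x; rw [← h.zero]; simp
      trans := by
        rintro c c' c'' ⟨π, h⟩ ⟨ρ, k⟩
        refine ⟨ρ * π, ?_, ?_, ?_, ?_, ?_⟩
        · intro x; simp [h.monoInfty, k.monoInfty]
        · intro i x; simp [h.mono, k.mono]
        · intro x; simp [h.monoZero, k.monoZero]
        · intro x; simp [h.pole, k.pole]
        · intro x; simp [h.zero, k.zero] }

/-- The number of automorphisms of a cover. -/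
noncomputable def autCard (c : LabelledCover d r μ ν) : ℕ :=
  Nat.card {π : Equiv.Perm (Fin d) // IsIso π c c}

/-- There are finitely many covers, so that the sum in `doubleHurwitz` is a finite sum. -/
instance : Finite (LabelledCover d r μ ν) :=
  Finite.of_injective
    (fun c => (c.monoInfty, c.mono, c.monoZero, c.pole, c.zero)) (by
      rintro ⟨⟩ ⟨⟩ h
      simp only [Prod.mk.injEq] at h
      obtain ⟨rfl, rfl, rfl, rfl, rfl⟩ := h
      rfl)

end LabelledCover

/-- The double Hurwitz number `h^g_{μ;ν}`: the number of isomorphism classes of genus `g` connected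
covers of degree `d = ∑ μ i` of the sphere with labelled preimages of `∞` and `0` of
multiplicities `μ` and `ν`, and with `m + n + 2 g - 2` further fixed simple branch points, each
counted with weight `1 / |Aut|`. By the Riemann--Hurwitz formula this number of simple branch
points says exactly that the genus is `g`. -/
noncomputable def doubleHurwitz (g : ℕ) {m n : ℕ} (μ : Fin m → ℕ) (ν : Fin n → ℕ) : ℚ :=
  ∑ᶠ q : Quotient (LabelledCover.setoid (∑ i, μ i) (m + n + 2 * g - 2) μ ν),
    (1 : ℚ) / (Quotient.out q).autCard

/-- `ν_J`, the sum of the parts `ν j` with `j ∈ J`. -/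
def partSum {n : ℕ} (ν : Fin n → ℕ) (J : Finset (Fin n)) : ℕ := ∑ j ∈ J, ν j

/-- `A_J = d μ₂ - ν_J (μ₁ + μ₂)`, where `d = μ₁ + μ₂ + μ₃`. -/
def coeffA {n : ℕ} (μ₁ μ₂ μ₃ : ℕ) (ν : Fin n → ℕ) (J : Finset (Fin n)) : ℚ :=
  ((μ₁ : ℚ) + μ₂ + μ₃) * μ₂ - partSum ν J * ((μ₁ : ℚ) + μ₂)

/-- `B_{JK} = (d - ν_J) μ₂ - ν_K (μ₁ + μ₂)`, where `d = μ₁ + μ₂ + μ₃`. -/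
def coeffB {n : ℕ} (μ₁ μ₂ μ₃ : ℕ) (ν : Fin n → ℕ) (J K : Finset (Fin n)) : ℚ :=
  ((μ₁ : ℚ) + μ₂ + μ₃ - partSum ν J) * μ₂ - partSum ν K * ((μ₁ : ℚ) + μ₂)

/-- `C_{JK} = ν_J μ₃ - ν_K (μ₂ + μ₃)`. -/
def coeffC {n : ℕ} (μ₂ μ₃ : ℕ) (ν : Fin n → ℕ) (J K : Finset (Fin n)) : ℚ :=
  (partSum ν J : ℚ) * μ₃ - partSum ν K * ((μ₂ : ℚ) + μ₃)

/-! ### Abel–Hurwitz identities for sums over subsets -/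

section AbelHurwitz

open Finset Polynomial

variable {ι M R : Type*} [DecidableEq ι]

/-! By orbit–stabilizer, the weighted number of classes of covers is the number of covers divided by
d!. The monodromy at 0 is determined by the rest, so a cover amounts to a permutation σ with
labelled cycles (the poles) together with transpositions and a labelling of the cycles of the final
product (the zeros). There are d!/(μ₁μ₂μ₃) choices of σ with its labelling
(`sum_isCycleLabelling_mul`), so it suffices to count the factorizations for a fixed σ.

Absorbing the first transposition into σ either joins two cycles or cuts one. Genus zero is the case
of equality in the Riemann–Hurwitz inequality `card_cyclesIn_add_le`, so a cut must disconnect the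
cover (`not_orbitRel_of_card`). The induction therefore runs over disconnected covers whose
components, the blocks, are labelled. `factCount_eq` states that r transpositions give r! times the
product of the weights of the blocks. The induction closes because a block with p poles and zeros T
has p + #T - 2 branch points, its weight satisfies the cut-and-join recursion with that factor
(`blockWeight_recursion`), and these numbers add up to r.

Write v_A for the sum of v over A. The weight of a block with a single pole of order a is a^(#T -
1). With two or three poles, the zeros are distributed over the poles in all ways; each distribution
contributes the product of the powers (order)^(number of zeros), times a piecewise polynomial
function of the excesses, the excess of a pole being its order minus the sum of the zeros assigned
to it. Cutting off a part that carries the zeros S contributes v_S^(#S - 1), and summing over S with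
the Abel–Hurwitz identities turns the cuts into a factor counting the zeros at the pole. The joins,
which contain powers of b + c, are expanded over distributions by `sum_powerset_key`. What is left
can be checked one distribution at a time, according to the signs of the excesses
(`threePoleKernel_remainder`), apart from a correction whose total is zero.

The excesses of three poles add up to zero. On that plane `threePoleKernel_eq` rewrites the kernel
with only two regions: the first yields the first two sums of the theorem (no zero, or some zeros,
at the third pole), the second yields the third sum. -/

theorem sum_powerset_sum_mem [AddCommMonoid M] (T : Finset ι) (F : Finset ι → ι → M) :
    ∑ A ∈ T.powerset, ∑ j ∈ A, F A j
      = ∑ j ∈ T, ∑ A ∈ (T.erase j).powerset, F (insert j A) j := by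
  rw [Finset.sum_comm' (t' := T) (s' := fun j => T.powerset.filter (j ∈ ·))]
  · refine Finset.sum_congr rfl fun j hj => ?_
    refine Finset.sum_nbij' (fun A => A.erase j) (fun A => insert j A) ?_ ?_ ?_ ?_ ?_
    · intro A hA
      simp only [mem_filter, mem_powerset] at hA ⊢
      exact Finset.erase_subset_erase _ hA.1
    · intro A hA
      simp only [mem_filter, mem_powerset] at hA ⊢
      exact ⟨Finset.insert_subset hj (hA.trans (Finset.erase_subset _ _)), by simp⟩
    · intro A hA
      simp only [mem_filter] at hA
      exact Finset.insert_erase hA.2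
    · intro A hA
      simp only [mem_powerset] at hA
      exact Finset.erase_insert fun h => by simpa using hA h
    · intro A hA
      simp only [mem_filter] at hA
      simp only [Finset.insert_erase hA.2]
  · intro A j
    simp only [mem_powerset, mem_filter]
    exact ⟨fun h => ⟨⟨h.1, h.2⟩, h.1 h.2⟩, fun h => h.1⟩

theorem sum_powerset_sum_sdiff [AddCommMonoid M] (T : Finset ι) (F : Finset ι → ι → M) :
    ∑ A ∈ T.powerset, ∑ j ∈ T \ A, F A j
      = ∑ j ∈ T, ∑ A ∈ (T.erase j).powerset, F A j := by
  refine Finset.sum_comm' fun A j => ?_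
  simp only [mem_powerset, mem_sdiff, Finset.subset_erase]
  tauto

/-- The sum `∑ (x + v_A) ^ |A| * (y + v_B) ^ |B|` over the partitions `T = A ⊔ B`. -/
def abelSum [CommRing R] (v : ι → R) (T : Finset ι) (x y : R) : R :=
  ∑ A ∈ T.powerset, (x + ∑ j ∈ A, v j) ^ #A * (y + ∑ j ∈ T \ A, v j) ^ #(T \ A)

/-- `abelSum` depends only on x + y: its derivative in the direction (1, -1) is a sum over j of
differences of the same kind for `T.erase j`, which vanish by induction on the cardinality. -/
theorem abelSum_shift [CommRing R] [IsDomain R] [CharZero R] (v : ι → R) (T : Finset ι)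
    (x y t : R) : abelSum v T (x + t) y = abelSum v T x (y + t) := by
  induction hc : #T generalizing T x y t with
  | zero =>
    rw [Finset.card_eq_zero] at hc
    simp [abelSum, hc]
  | succ n ih =>
    -- The polynomial interpolates between the two sides: X = t gives the left one, X = 0 the right
    -- one.
    let p : R[X] := ∑ A ∈ T.powerset, (C (x + ∑ j ∈ A, v j) + X) ^ #A *
      (C (y + t + ∑ j ∈ T \ A, v j) - X) ^ #(T \ A)
    have hp : derivative p = 0 := by
      refine Polynomial.funext fun z => ?_
      have h1 : (derivative p).eval z = ∑ A ∈ T.powerset,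
          ((∑ j ∈ A, (x + z + ∑ j ∈ A, v j) ^ (#A - 1) *
              (y + t - z + ∑ j ∈ T \ A, v j) ^ #(T \ A))
            - ∑ j ∈ T \ A, (x + z + ∑ j ∈ A, v j) ^ #A *
              (y + t - z + ∑ j ∈ T \ A, v j) ^ (#(T \ A) - 1)) := by
        simp only [p, derivative_sum, eval_finsetSum]
        refine Finset.sum_congr rfl fun A _ => ?_
        simp only [derivative_mul, derivative_pow, eval_add, eval_mul, eval_pow, eval_sub,
          derivative_add, derivative_sub, derivative_C, derivative_X, eval_C, eval_X,
          Finset.sum_const, nsmul_eq_mul, eval_one, eval_zero]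
        ring
      rw [h1, Finset.sum_sub_distrib, sum_powerset_sum_mem T
        (fun A _ => (x + z + ∑ j ∈ A, v j) ^ (#A - 1) *
              (y + t - z + ∑ j ∈ T \ A, v j) ^ #(T \ A)), sum_powerset_sum_sdiff T
        (fun A _ => (x + z + ∑ j ∈ A, v j) ^ #A *
              (y + t - z + ∑ j ∈ T \ A, v j) ^ (#(T \ A) - 1)), ← Finset.sum_sub_distrib]
      simp only [eval_zero]
      refine Finset.sum_eq_zero fun j hj => ?_
      have hcj : #(T.erase j) = n := by rw [Finset.card_erase_of_mem hj, hc]; rfl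
      -- Differentiating the first factor leaves j in A and the second leaves j outside A, so v j is
      -- added to x or to y respectively; the induction hypothesis with shift v j equates the two.
      have := ih (T.erase j) (x + z) (y + t - z) (v j) hcj
      rw [sub_eq_zero]
      unfold abelSum at this
      convert this using 1
      · refine Finset.sum_congr rfl fun A hA => ?_
        rw [mem_powerset] at hA
        have hjA : j ∉ A := fun h => by simpa using hA h
        have e : T \ insert j A = T.erase j \ A := by
          ext k; simp only [mem_sdiff, mem_insert, mem_erase]; tauto
        rw [Finset.card_insert_of_notMem hjA, Finset.sum_insert hjA, e, Nat.add_sub_cancel]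
        ring_nf
      · refine Finset.sum_congr rfl fun A hA => ?_
        rw [mem_powerset] at hA
        have hjA : j ∉ A := fun h => by simpa using hA h
        have e : T \ A = insert j (T.erase j \ A) := by
          ext k; simp only [mem_sdiff, mem_insert, mem_erase]
          by_cases hk : k = j
          · subst hk; simp [hj, hjA]
          · simp [hk]
        rw [e, Finset.card_insert_of_notMem (by simp), Finset.sum_insert (by simp),
          Nat.add_sub_cancel]
        ring_nf
    have hconst := Polynomial.eq_C_of_natDegree_eq_zero
      (Polynomial.derivative_eq_zero.1 hp)
    have h0 : p.eval t = p.eval 0 := by rw [hconst]; simp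
    simp only [p, eval_finsetSum, eval_mul, eval_pow, eval_add, eval_sub, eval_C, eval_X] at h0
    unfold abelSum
    convert h0 using 2 <;> · congr 2 <;> ring

theorem abelSum_eq [CommRing R] [IsDomain R] [CharZero R] (v : ι → R) (T : Finset ι)
    {x y x' y' : R} (h : x + y = x' + y') : abelSum v T x y = abelSum v T x' y' := by
  have := abelSum_shift v T x' y (x - x')
  rw [add_sub_cancel] at this
  rw [this]
  congr 1
  linear_combination h

/-- Hurwitz's multivariate form of Abel's binomial identity. -/
theorem hurwitz_identity [CommRing R] [IsDomain R] [CharZero R] (v : ι → R) (T : Finset ι)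
    (x y : R) :
    ∑ A ∈ T.powerset, (if A = ∅ then 1 else x * (x + ∑ j ∈ A, v j) ^ (#A - 1)) *
      (y + ∑ j ∈ T \ A, v j) ^ #(T \ A) = (x + y + ∑ j ∈ T, v j) ^ #T := by
  -- Uses x (x + v_A)^(#A - 1) = (x + v_A)^#A - v_A (x + v_A)^(#A - 1), with v_A then split over the
  -- elements of A.
  have key : ∀ x y : R, ∑ A ∈ T.powerset,
      (if A = ∅ then 1 else x * (x + ∑ j ∈ A, v j) ^ (#A - 1)) *
      (y + ∑ j ∈ T \ A, v j) ^ #(T \ A)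
      = abelSum v T x y - ∑ j ∈ T, v j * abelSum v (T.erase j) (x + v j) y := by
    intro x y
    have h1 : ∑ j ∈ T, v j * abelSum v (T.erase j) (x + v j) y
        = ∑ A ∈ T.powerset, ∑ j ∈ A, v j * ((x + ∑ j ∈ A, v j) ^ (#A - 1) *
          (y + ∑ j ∈ T \ A, v j) ^ #(T \ A)) := by
      rw [sum_powerset_sum_mem T (fun A j => v j * ((x + ∑ j ∈ A, v j) ^ (#A - 1) *
          (y + ∑ j ∈ T \ A, v j) ^ #(T \ A)))]
      refine Finset.sum_congr rfl fun j hj => ?_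
      rw [abelSum, Finset.mul_sum]
      refine Finset.sum_congr rfl fun A hA => ?_
      rw [mem_powerset] at hA
      have hjA : j ∉ A := fun h => by simpa using hA h
      have e : T \ insert j A = T.erase j \ A := by
        ext k; simp only [mem_sdiff, mem_insert, mem_erase]; tauto
      rw [Finset.card_insert_of_notMem hjA, Finset.sum_insert hjA, e, Nat.add_sub_cancel]
      ring_nf
    rw [h1, abelSum, ← Finset.sum_sub_distrib]
    refine Finset.sum_congr rfl fun A _ => ?_
    rw [← Finset.sum_mul]
    split_ifs with hA
    · simp [hA]
    · obtain ⟨k, hk⟩ : ∃ k, #A = k + 1 :=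
        ⟨#A - 1, by have := Finset.card_pos.2 (Finset.nonempty_iff_ne_empty.2 hA); omega⟩
      rw [hk, Nat.add_sub_cancel]
      ring
  -- By `key` the sum depends only on x + y, so x can be moved to 0, where only A = ∅ survives.
  have h0 : ∑ A ∈ T.powerset, (if A = ∅ then 1 else x * (x + ∑ j ∈ A, v j) ^ (#A - 1)) *
      (y + ∑ j ∈ T \ A, v j) ^ #(T \ A) =
      ∑ A ∈ T.powerset, (if A = ∅ then 1 else 0 * (0 + ∑ j ∈ A, v j) ^ (#A - 1)) *
      (x + y + ∑ j ∈ T \ A, v j) ^ #(T \ A) := by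
    rw [key, key, abelSum_eq v T (show x + y = 0 + (x + y) by ring)]
    congr 1
    refine Finset.sum_congr rfl fun j _ => ?_
    rw [abelSum_eq v _ (show x + v j + y = 0 + v j + (x + y) by ring)]
  rw [h0, Finset.sum_eq_single ∅]
  · simp
  · intro A _ hA
    simp [hA]
  · simp

/-- Abel's identity, differentiated at the origin. -/
theorem sum_nonempty_pow_mul_pow [CommRing R] [IsDomain R] [CharZero R] (v : ι → R)
    (T : Finset ι) (y : R) :
    ∑ A ∈ T.powerset with A.Nonempty, (∑ j ∈ A, v j) ^ (#A - 1) *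
      (y - ∑ j ∈ A, v j) ^ #(T \ A) = #T * y ^ (#T - 1) := by
  -- The second argument is chosen so that at X = 0 the factor of T \ A becomes (y - v_A)^#(T \ A)
  -- and the right side is the derivative of (X + y)^#T.
  have h := hurwitz_identity (fun j => C (v j)) T (X : R[X]) (C (y - ∑ j ∈ T, v j))
  have h' := congrArg (fun p => eval 0 (derivative p)) h
  simp only [derivative_sum, eval_finsetSum] at h'
  rw [Finset.sum_filter]
  trans ∑ A ∈ T.powerset, eval 0 (derivative ((if A = ∅ then 1 else X *
    (X + ∑ j ∈ A, C (v j)) ^ (#A - 1)) *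
      (C (y - ∑ j ∈ T, v j) + ∑ j ∈ T \ A, C (v j)) ^ #(T \ A)))
  · refine Finset.sum_congr rfl fun A hA => ?_
    rw [mem_powerset] at hA
    have e : ∑ j ∈ T \ A, v j = ∑ j ∈ T, v j - ∑ j ∈ A, v j := by
      rw [← Finset.sum_sdiff hA]; ring
    simp only [← map_sum, ← map_add, ← map_pow, e]
    rw [derivative_mul, derivative_C]
    rcases A.eq_empty_or_nonempty with rfl | hne
    · simp
    · simp only [hne, hne.ne_empty, if_true, if_false, derivative_mul, derivative_X, eval_add,
        eval_mul, eval_C, eval_X, eval_pow, eval_one, eval_zero]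
      ring_nf
  · rw [h']
    simp only [derivative_pow, derivative_add, derivative_X, derivative_C, ← map_sum,
      eval_mul, eval_add, eval_pow, eval_X, eval_C, eval_one, eval_zero]
    ring_nf

end AbelHurwitz
-- Ordered partitions and moments of binomial sums over subsets
section SubsetSums

open Finset

variable {ι M : Type*} [DecidableEq ι]

theorem sum_powerset_sdiff_self [AddCommMonoid M] (T : Finset ι)
    (F : Finset ι → Finset ι → M) :
    ∑ A ∈ T.powerset, F A (T \ A) = ∑ A ∈ T.powerset, F (T \ A) A := by
  refine Finset.sum_nbij' (fun A => T \ A) (fun A => T \ A) ?_ ?_ ?_ ?_ ?_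
  · intro A _; simp
  · intro A _; simp
  · intro A hA; simpa using hA
  · intro A hA; simpa using hA
  · intro A hA
    rw [Finset.sdiff_sdiff_eq_self (mem_powerset.1 hA)]

theorem sum_powerset_union [AddCommMonoid M] (T : Finset ι) (F : Finset ι → Finset ι → M) :
    ∑ S ∈ T.powerset, ∑ A ∈ (T \ S).powerset, F S A
      = ∑ D ∈ T.powerset, ∑ S ∈ D.powerset, F S (D \ S) := by
  rw [Finset.sum_sigma', Finset.sum_sigma']
  refine Finset.sum_nbij' (fun p => ⟨p.1 ∪ p.2, p.1⟩) (fun p => ⟨p.2, p.1 \ p.2⟩) ?_ ?_ ?_ ?_ ?_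
  · rintro ⟨S, A⟩ h
    simp only [mem_sigma, mem_powerset] at h ⊢
    exact ⟨union_subset h.1 (h.2.trans sdiff_subset), subset_union_left⟩
  · rintro ⟨D, S⟩ h
    simp only [mem_sigma, mem_powerset] at h ⊢
    exact ⟨h.2.trans h.1, sdiff_subset_sdiff h.1 le_rfl⟩
  · rintro ⟨S, A⟩ h
    simp only [mem_sigma, mem_powerset] at h
    have : Disjoint S A := (disjoint_sdiff).mono_right h.2
    simp only [Finset.union_sdiff_cancel_left this]
  · rintro ⟨D, S⟩ h
    simp only [mem_sigma, mem_powerset] at h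
    simp only [Finset.union_sdiff_of_subset h.2]
  · rintro ⟨S, A⟩ h
    simp only [mem_sigma, mem_powerset] at h
    have : Disjoint S A := (disjoint_sdiff).mono_right h.2
    simp only [Finset.union_sdiff_cancel_left this]

theorem sum_powerset_swap [AddCommMonoid M] (T : Finset ι) (F : Finset ι → Finset ι → M) :
    ∑ A ∈ T.powerset, ∑ B ∈ (T \ A).powerset, F A B
      = ∑ B ∈ T.powerset, ∑ A ∈ (T \ B).powerset, F A B := by
  refine Finset.sum_comm' fun A B => ?_
  simp only [mem_powerset, subset_sdiff]
  rw [disjoint_comm]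
  tauto

/-- The sum over all ordered partitions of `T` into three subsets. -/
def sumTri [AddCommMonoid M] (T : Finset ι) (F : Finset ι → Finset ι → Finset ι → M) : M :=
  ∑ A ∈ T.powerset, ∑ B ∈ (T \ A).powerset, F A B ((T \ A) \ B)

theorem sumTri_swap_left [AddCommMonoid M] (T : Finset ι)
    (F : Finset ι → Finset ι → Finset ι → M) :
    sumTri T (fun A B C => F B A C) = sumTri T F := by
  unfold sumTri
  rw [sum_powerset_swap T (fun A B => F A B ((T \ A) \ B))]
  simp only [sdiff_sdiff_comm]

theorem sumTri_swap_right [AddCommMonoid M] (T : Finset ι)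
    (F : Finset ι → Finset ι → Finset ι → M) :
    sumTri T (fun A B C => F A C B) = sumTri T F := by
  unfold sumTri
  refine Finset.sum_congr rfl fun A _ => ?_
  rw [sum_powerset_sdiff_self (T \ A) (fun B C => F A B C)]

theorem sumTri_congr [AddCommMonoid M] (T : Finset ι)
    {F G : Finset ι → Finset ι → Finset ι → M}
    (h : ∀ A B C, A ∪ B ∪ C = T → Disjoint A B → Disjoint (A ∪ B) C → F A B C = G A B C) :
    sumTri T F = sumTri T G := by
  refine Finset.sum_congr rfl fun A hA => Finset.sum_congr rfl fun B hB => h _ _ _ ?_ ?_ ?_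
  · rw [mem_powerset] at hA hB
    rw [union_assoc, union_sdiff_of_subset hB, union_sdiff_of_subset hA]
  · rw [mem_powerset] at hB
    exact disjoint_sdiff.mono_right hB
  · rw [sdiff_sdiff_left]
    exact disjoint_sdiff

theorem sumTri_add [AddCommMonoid M] (T : Finset ι)
    (F G : Finset ι → Finset ι → Finset ι → M) :
    sumTri T (fun A B C => F A B C + G A B C) = sumTri T F + sumTri T G := by
  simp only [sumTri, Finset.sum_add_distrib]

theorem sumTri_sub [AddCommGroup M] (T : Finset ι)
    (F G : Finset ι → Finset ι → Finset ι → M) :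
    sumTri T (fun A B C => F A B C - G A B C) = sumTri T F - sumTri T G := by
  simp only [sumTri, Finset.sum_sub_distrib]

theorem mul_sumTri (T : Finset ι) (r : ℚ) (F : Finset ι → Finset ι → Finset ι → ℚ) :
    r * sumTri T F = sumTri T (fun A B C => r * F A B C) := by
  simp only [sumTri, Finset.mul_sum]

theorem sumTri_eq_mid [AddCommMonoid M] (T : Finset ι)
    (F : Finset ι → Finset ι → Finset ι → M) :
    sumTri T F = ∑ B ∈ T.powerset, ∑ A ∈ (T \ B).powerset, F A B ((T \ B) \ A) := by
  rw [← sumTri_swap_left, sumTri]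

theorem sumTri_eq_right [AddCommMonoid M] (T : Finset ι)
    (F : Finset ι → Finset ι → Finset ι → M) :
    sumTri T F = ∑ C ∈ T.powerset, ∑ A ∈ (T \ C).powerset, F A ((T \ C) \ A) C := by
  rw [← sumTri_swap_right, sumTri_eq_mid]

/-- The weighted first moment of the binomial sum. Dividing by x + y instead of lowering the
exponent keeps T = ∅ from being a special case. -/
theorem sum_powerset_sum_mul (v : ι → ℚ) (T : Finset ι) {x y : ℚ} (h : x + y ≠ 0) :
    ∑ A ∈ T.powerset, (∑ j ∈ A, v j) * (x ^ #A * y ^ #(T \ A))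
      = x * (∑ j ∈ T, v j) * (x + y) ^ #T / (x + y) := by
  simp only [Finset.sum_mul]
  rw [sum_powerset_sum_mem T (fun A j => v j * (x ^ #A * y ^ #(T \ A))), eq_div_iff h,
    Finset.mul_sum, Finset.sum_mul, Finset.sum_mul]
  refine Finset.sum_congr rfl fun j hj => ?_
  have e : ∑ A ∈ (T.erase j).powerset, x ^ #A * y ^ (#(T.erase j) - #A)
      = (x + y) ^ #(T.erase j) := Finset.sum_pow_mul_eq_add_pow _ _ _
  have hc : #T = #(T.erase j) + 1 := by
    rw [Finset.card_erase_of_mem hj]; have := Finset.card_pos.2 ⟨j, hj⟩; omega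
  have e2 : ∑ A ∈ (T.erase j).powerset, v j * (x ^ #(insert j A) * y ^ #(T \ insert j A))
      = x * v j * ∑ A ∈ (T.erase j).powerset, x ^ #A * y ^ (#(T.erase j) - #A) := by
    rw [Finset.mul_sum]
    refine Finset.sum_congr rfl fun A hA => ?_
    rw [mem_powerset] at hA
    have hjA : j ∉ A := fun h => by simpa using hA h
    rw [card_sdiff_of_subset (Finset.insert_subset hj (hA.trans (Finset.erase_subset _ _))),
      Finset.card_insert_of_notMem hjA, hc, Nat.add_sub_add_right]
    ring
  rw [e2, e, hc]
  ring

theorem sum_powerset_pow (T : Finset ι) (x y : ℚ) :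
    ∑ A ∈ T.powerset, x ^ #A * y ^ #(T \ A) = (x + y) ^ #T := by
  rw [← Finset.sum_pow_mul_eq_add_pow]
  refine Finset.sum_congr rfl fun A hA => ?_
  rw [card_sdiff_of_subset (mem_powerset.1 hA)]

theorem sum_powerset_card_mul (T : Finset ι) {x y : ℚ} (h : x + y ≠ 0) :
    ∑ A ∈ T.powerset, (#A : ℚ) * (x ^ #A * y ^ #(T \ A))
      = x * #T * (x + y) ^ #T / (x + y) := by
  simpa using sum_powerset_sum_mul (fun _ : ι => (1 : ℚ)) T h

theorem sum_powerset_card_mul_sum_mul (v : ι → ℚ) (T : Finset ι) {x y : ℚ} (h : x + y ≠ 0) :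
    ∑ A ∈ T.powerset, (#A : ℚ) * (∑ j ∈ A, v j) * (x ^ #A * y ^ #(T \ A))
      = x * (∑ j ∈ T, v j) * (y + #T * x) * (x + y) ^ #T / (x + y) ^ 2 := by
  have e1 : ∀ A ∈ T.powerset, (#A : ℚ) * (∑ j ∈ A, v j) * (x ^ #A * y ^ #(T \ A))
      = ∑ j ∈ A, v j * ((#A : ℚ) * (x ^ #A * y ^ #(T \ A))) := by
    intro A _
    rw [← Finset.sum_mul]; ring
  rw [Finset.sum_congr rfl e1, sum_powerset_sum_mem T
    (fun A j => v j * ((#A : ℚ) * (x ^ #A * y ^ #(T \ A)))), eq_div_iff (pow_ne_zero 2 h),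
    Finset.mul_sum, Finset.sum_mul, Finset.sum_mul, Finset.sum_mul]
  refine Finset.sum_congr rfl fun j hj => ?_
  have hc : #T = #(T.erase j) + 1 := by
    rw [Finset.card_erase_of_mem hj]; have := Finset.card_pos.2 ⟨j, hj⟩; omega
  have e2 : ∑ A ∈ (T.erase j).powerset, v j * ((#(insert j A) : ℚ) *
      (x ^ #(insert j A) * y ^ #(T \ insert j A))) =
      v j * x * (∑ A ∈ (T.erase j).powerset, (#A : ℚ) * (x ^ #A * y ^ #(T.erase j \ A)) +
        ∑ A ∈ (T.erase j).powerset, x ^ #A * y ^ #(T.erase j \ A)) := by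
    rw [← Finset.sum_add_distrib, Finset.mul_sum]
    refine Finset.sum_congr rfl fun A hA => ?_
    rw [mem_powerset] at hA
    have hjA : j ∉ A := fun h => by simpa using hA h
    have e : T \ insert j A = T.erase j \ A := by
      ext k; simp only [mem_sdiff, mem_insert, mem_erase]; tauto
    rw [e, Finset.card_insert_of_notMem hjA]
    push_cast
    ring
  rw [e2, sum_powerset_card_mul _ h, sum_powerset_pow, hc]
  push_cast
  field_simp
  ring

/-- The bracket equals x v_T - (x + y) v_A, so this is the first-moment formula. It is the source of
the symmetry of `twoPole` and `threePole` in the poles. -/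
theorem sum_powerset_antisymm (v : ι → ℚ) (T : Finset ι) {x y : ℚ} (h : x + y ≠ 0) :
    ∑ A ∈ T.powerset, x ^ #A * y ^ #(T \ A) *
      (y * (x - ∑ j ∈ A, v j) - x * (y - ∑ j ∈ T \ A, v j)) = 0 := by
  have e : ∀ A ∈ T.powerset, x ^ #A * y ^ #(T \ A) *
      (y * (x - ∑ j ∈ A, v j) - x * (y - ∑ j ∈ T \ A, v j))
      = (x * ∑ j ∈ T, v j) * (x ^ #A * y ^ #(T \ A))
        - (x + y) * ((∑ j ∈ A, v j) * (x ^ #A * y ^ #(T \ A))) := by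
    intro A hA
    rw [← Finset.sum_sdiff (mem_powerset.1 hA)]; ring
  rw [Finset.sum_congr rfl e, Finset.sum_sub_distrib, ← Finset.mul_sum, ← Finset.mul_sum,
    sum_powerset_pow, sum_powerset_sum_mul v T h]
  field_simp
  ring

/-- Read from right to left, it expands the power of x + y belonging to a joined pole over the
distributions of its zeros between poles of orders x and y. The constant k is free because its
coefficient vanishes by `sum_powerset_antisymm`; the rest follows from the first moments and the
mixed second moment. -/
theorem sum_powerset_key (v : ι → ℚ) (T : Finset ι) {x y : ℚ} (h : x + y ≠ 0) (k : ℚ) :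
    ∑ A ∈ T.powerset, x ^ #A * y ^ #(T \ A) *
      ((k + #A) * (y * (x - ∑ j ∈ A, v j)) - (k + #A + 1) * (x * (y - ∑ j ∈ T \ A, v j)))
      = - (x * y * (x + y) ^ #T) := by
  have e : ∀ A ∈ T.powerset, x ^ #A * y ^ #(T \ A) *
      ((k + #A) * (y * (x - ∑ j ∈ A, v j)) - (k + #A + 1) * (x * (y - ∑ j ∈ T \ A, v j)))
      = k * (x ^ #A * y ^ #(T \ A) *
          (y * (x - ∑ j ∈ A, v j) - x * (y - ∑ j ∈ T \ A, v j)))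
        + (x * ∑ j ∈ T, v j) * ((#A : ℚ) * (x ^ #A * y ^ #(T \ A)))
        - (x + y) * ((#A : ℚ) * (∑ j ∈ A, v j) * (x ^ #A * y ^ #(T \ A)))
        - (x * (y - ∑ j ∈ T, v j)) * (x ^ #A * y ^ #(T \ A))
        - x * ((∑ j ∈ A, v j) * (x ^ #A * y ^ #(T \ A))) := by
    intro A hA
    rw [← Finset.sum_sdiff (mem_powerset.1 hA)]; ring
  rw [Finset.sum_congr rfl e]
  simp only [Finset.sum_sub_distrib, Finset.sum_add_distrib]
  simp only [← Finset.mul_sum]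
  rw [sum_powerset_antisymm v T h, sum_powerset_pow, sum_powerset_sum_mul v T h,
    sum_powerset_card_mul_sum_mul v T h, sum_powerset_card_mul T h]
  field_simp
  ring

end SubsetSums
-- Weights for one and two poles
section PoleSums

open Finset

variable {ι : Type*} [DecidableEq ι]

/-- `a b H(a, b) = ∑ a ^ |A| b ^ |B| (a - v_A)` over `T = A ⊔ B` with `v_A < a`: the number of
genus-zero covers with two poles of orders `a`, `b` and zeros of orders `v j`, `j ∈ T`, divided by
the factorial of the number of branch points and counted for a fixed monodromy at infinity. -/
def twoPole (v : ι → ℚ) (T : Finset ι) (a b : ℚ) : ℚ :=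
  ∑ A ∈ T.powerset,
    if ∑ j ∈ A, v j < a then a ^ #A * b ^ #(T \ A) * (a - ∑ j ∈ A, v j) else 0

/-- The coefficient with which a distribution of the zeros over three poles contributes to
`threePole`; the arguments `x`, `y`, `z` are the excesses of the poles. -/
def threePoleKernel (a b c x y z : ℚ) : ℚ :=
  (if 0 < y ∧ 0 < z then a * y * z else 0) - (if x < 0 ∧ 0 < z then b * x * z else 0)
    + (if x < 0 ∧ y < 0 then c * x * y else 0)

/-- The analogue of `twoPole` for three poles. -/
def threePole (v : ι → ℚ) (T : Finset ι) (a b c : ℚ) : ℚ :=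
  sumTri T fun A B C => a ^ #A * b ^ #B * c ^ #C *
    threePoleKernel a b c (a - ∑ j ∈ A, v j) (b - ∑ j ∈ B, v j) (c - ∑ j ∈ C, v j)

variable {v : ι → ℚ} {T : Finset ι} {a b c : ℚ}

theorem sum_union_sdiff_of_subset (v : ι → ℚ) {S D : Finset ι} (h : S ⊆ D) :
    ∑ j ∈ S, v j + ∑ j ∈ D \ S, v j = ∑ j ∈ D, v j := by
  rw [add_comm, Finset.sum_sdiff h]

omit [DecidableEq ι] in
theorem sum_le_sum_of_subset_of_pos (hv : ∀ j, 0 < v j) {S D : Finset ι} (h : S ⊆ D) :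
    ∑ j ∈ S, v j ≤ ∑ j ∈ D, v j :=
  Finset.sum_le_sum_of_subset_of_nonneg h fun j _ _ => (hv j).le

/-- The recursion for one pole. Writing v_T = v_S + v_{T \ S} gives two halves exchanged by
complementation; each is `sum_nonempty_pow_mul_pow` at y = v_T without its term S = T. -/
theorem sum_proper_pow_mul_pow (hT : T.Nonempty) :
    ∑ S ∈ T.powerset with S.Nonempty ∧ (T \ S).Nonempty,
      (∑ j ∈ T, v j) * ((∑ j ∈ S, v j) ^ (#S - 1) * (∑ j ∈ T \ S, v j) ^ (#(T \ S) - 1))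
      = 2 * (#T - 1) * (∑ j ∈ T, v j) ^ (#T - 1) := by
  have h1 : ∑ S ∈ T.powerset with S.Nonempty ∧ (T \ S).Nonempty,
      (∑ j ∈ S, v j) ^ (#S - 1) * (∑ j ∈ T \ S, v j) ^ #(T \ S)
      = (#T - 1) * (∑ j ∈ T, v j) ^ (#T - 1) := by
    have h := sum_nonempty_pow_mul_pow v T (∑ j ∈ T, v j)
    rw [Finset.sum_filter, ← Finset.sum_erase_add _ _ (mem_powerset_self T)] at h
    simp only [hT, if_true, sdiff_self, bot_eq_empty, card_empty, pow_zero, mul_one] at h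
    rw [Finset.sum_filter, ← Finset.sum_erase_add _ _ (mem_powerset_self T)]
    simp only [sdiff_self, bot_eq_empty, Finset.not_nonempty_empty, and_false, if_false, add_zero]
    rw [sub_one_mul, ← h, add_sub_cancel_right]
    refine Finset.sum_congr rfl fun S hS => ?_
    rw [mem_erase, mem_powerset] at hS
    have hne : (T \ S).Nonempty := by
      rw [Finset.sdiff_nonempty]
      exact fun h => hS.1 (Finset.Subset.antisymm hS.2 h)
    simp only [hne, and_true]
    rw [← sum_union_sdiff_of_subset v hS.2, add_sub_cancel_left]
  have h2 : ∑ S ∈ T.powerset with S.Nonempty ∧ (T \ S).Nonempty,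
      (∑ j ∈ S, v j) ^ #S * (∑ j ∈ T \ S, v j) ^ (#(T \ S) - 1)
      = (#T - 1) * (∑ j ∈ T, v j) ^ (#T - 1) := by
    rw [← h1, Finset.sum_filter, Finset.sum_filter]
    have := sum_powerset_sdiff_self T (fun A B => if A.Nonempty ∧ B.Nonempty then
      (∑ j ∈ A, v j) ^ #A * (∑ j ∈ B, v j) ^ (#B - 1) else 0)
    rw [this]
    refine Finset.sum_congr rfl fun S _ => ?_
    exact if_congr and_comm (mul_comm _ _) rfl
  rw [mul_assoc, two_mul]
  nth_rw 1 [← h1]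
  rw [← h2, ← Finset.sum_add_distrib]
  refine Finset.sum_congr rfl fun S hS => ?_
  simp only [mem_filter, mem_powerset] at hS
  obtain ⟨k, hk⟩ : ∃ k, #S = k + 1 := ⟨#S - 1, by have := hS.2.1.card_pos; omega⟩
  obtain ⟨l, hl⟩ : ∃ l, #(T \ S) = l + 1 := ⟨#(T \ S) - 1, by have := hS.2.2.card_pos; omega⟩
  rw [hk, hl, ← sum_union_sdiff_of_subset v hS.1, Nat.add_sub_cancel, Nat.add_sub_cancel]
  ring

/-- The excesses of the two poles are opposite, so at most one is positive. Up to the factor a + b,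
the difference of the two sides is therefore the untruncated sum of `sum_powerset_antisymm`. -/
theorem twoPole_comm (ha : 0 < a) (hb : 0 < b) (hT : ∑ j ∈ T, v j = a + b) :
    twoPole v T a b = twoPole v T b a := by
  have h0 := sum_powerset_antisymm v T (x := a) (y := b) (by positivity)
  unfold twoPole
  rw [sum_powerset_sdiff_self T (fun A B => if ∑ j ∈ A, v j < a then
    a ^ #A * b ^ #B * (a - ∑ j ∈ A, v j) else 0), ← sub_eq_zero, ← Finset.sum_sub_distrib]
  rw [sum_powerset_sdiff_self T (fun A B => a ^ #A * b ^ #B *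
      (b * (a - ∑ j ∈ A, v j) - a * (b - ∑ j ∈ B, v j)))] at h0
  have hab : a + b ≠ 0 := by positivity
  rw [← mul_right_inj' hab, mul_zero, Finset.mul_sum]
  refine Eq.trans ?_ h0
  refine Finset.sum_congr rfl fun A hA => ?_
  have := sum_union_sdiff_of_subset v (mem_powerset.1 hA)
  rw [hT] at this
  have e : ∑ j ∈ T \ A, v j = a + b - ∑ j ∈ A, v j := by linarith
  rw [e]
  split_ifs with h1 h2 h2
  · exfalso; linarith
  · ring
  · ring
  · have : b = ∑ j ∈ A, v j := by linarith
    rw [← this]; ring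

/-- If S is cut off and A stays at the shortened pole, the excess is a - v_D with D = S ∪ A. It
depends on D alone, so the sum over S inside D is `sum_nonempty_pow_mul_pow`, which produces the
factor #D. -/
theorem twoPole_cut (hv : ∀ j, 0 < v j) :
    a * ∑ S ∈ T.powerset, (if S.Nonempty ∧ ∑ j ∈ S, v j < a then
      (∑ j ∈ S, v j) ^ (#S - 1) * twoPole v (T \ S) (a - ∑ j ∈ S, v j) b else 0)
    = ∑ A ∈ T.powerset, #A *
      (if ∑ j ∈ A, v j < a then a ^ #A * b ^ #(T \ A) * (a - ∑ j ∈ A, v j) else 0) := by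
  have h1 : a * ∑ S ∈ T.powerset, (if S.Nonempty ∧ ∑ j ∈ S, v j < a then
      (∑ j ∈ S, v j) ^ (#S - 1) * twoPole v (T \ S) (a - ∑ j ∈ S, v j) b else 0)
      = ∑ S ∈ T.powerset, ∑ A ∈ (T \ S).powerset,
        if S.Nonempty ∧ ∑ j ∈ S, v j + ∑ j ∈ A, v j < a then
          a * b ^ #(T \ (S ∪ A)) * (a - (∑ j ∈ S, v j + ∑ j ∈ A, v j)) *
          ((∑ j ∈ S, v j) ^ (#S - 1) * (a - ∑ j ∈ S, v j) ^ #A) else 0 := by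
    rw [Finset.mul_sum]
    refine Finset.sum_congr rfl fun S _ => ?_
    unfold twoPole
    rw [ite_and]
    split_ifs with hne hS
    · rw [Finset.mul_sum, Finset.mul_sum]
      refine Finset.sum_congr rfl fun A _ => ?_
      rw [sdiff_sdiff_left]
      simp only [lt_sub_iff_add_lt', hne, true_and, sup_eq_union]
      split_ifs <;> ring
    · rw [mul_zero]
      symm
      refine Finset.sum_eq_zero fun A _ => if_neg fun h => hS ?_
      have := Finset.sum_nonneg (s := A) fun j _ => (hv j).le
      linarith [h.2]
    · simp [hne]
  rw [h1, sum_powerset_union T (fun S A => if S.Nonempty ∧ ∑ j ∈ S, v j + ∑ j ∈ A, v j < a then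
          a * b ^ #(T \ (S ∪ A)) * (a - (∑ j ∈ S, v j + ∑ j ∈ A, v j)) *
          ((∑ j ∈ S, v j) ^ (#S - 1) * (a - ∑ j ∈ S, v j) ^ #A) else 0)]
  refine Finset.sum_congr rfl fun D _ => ?_
  by_cases hD : ∑ j ∈ D, v j < a
  · have h2 := sum_nonempty_pow_mul_pow v D a
    rw [Finset.sum_filter] at h2
    simp only [hD, if_true]
    trans a * b ^ #(T \ D) * (a - ∑ j ∈ D, v j) * (#D * a ^ (#D - 1))
    · rw [← h2, Finset.mul_sum]
      refine Finset.sum_congr rfl fun S hS => ?_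
      have hS' := mem_powerset.1 hS
      rw [sum_union_sdiff_of_subset v hS', Finset.union_sdiff_of_subset hS']
      simp only [hD, and_true, mul_ite, mul_zero]
    · rcases Nat.eq_zero_or_pos #D with h0 | h0
      · simp [h0]
      · obtain ⟨k, hk⟩ : ∃ k, #D = k + 1 := ⟨#D - 1, by omega⟩
        rw [hk, Nat.add_sub_cancel]
        ring
  · simp only [hD, if_false, mul_zero]
    refine Finset.sum_eq_zero fun S hS => if_neg fun h => hD ?_
    rw [← sum_union_sdiff_of_subset v (mem_powerset.1 hS)]
    exact h.2

/-- The cut-and-join recursion for two poles. -/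
theorem twoPole_recursion (hv : ∀ j, 0 < v j) (ha : 0 < a) (hb : 0 < b)
    (hT : ∑ j ∈ T, v j = a + b) :
    #T * twoPole v T a b = a * b * (a + b) ^ (#T - 1)
      + a * (∑ S ∈ T.powerset, if S.Nonempty ∧ ∑ j ∈ S, v j < a then
        (∑ j ∈ S, v j) ^ (#S - 1) * twoPole v (T \ S) (a - ∑ j ∈ S, v j) b else 0)
      + b * (∑ S ∈ T.powerset, if S.Nonempty ∧ ∑ j ∈ S, v j < b then
        (∑ j ∈ S, v j) ^ (#S - 1) * twoPole v (T \ S) (b - ∑ j ∈ S, v j) a else 0) := by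
  have hab : a + b ≠ 0 := by positivity
  have hne : T.Nonempty := by
    rw [Finset.nonempty_iff_ne_empty]; rintro rfl; simp at hT; linarith
  have hB : ∀ A ∈ T.powerset, b - ∑ j ∈ T \ A, v j = -(a - ∑ j ∈ A, v j) := fun A hA => by
    have := sum_union_sdiff_of_subset v (mem_powerset.1 hA)
    linarith
  have hkey := sum_powerset_key v T hab (-#T)
  have hanti := sum_powerset_antisymm v T hab
  rw [twoPole_cut hv, twoPole_cut hv, twoPole, Finset.mul_sum,
    sum_powerset_sdiff_self T (fun A B => (#A : ℚ) * (if ∑ j ∈ A, v j < b then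
      b ^ #A * a ^ #B * (b - ∑ j ∈ A, v j) else 0)), add_assoc, ← Finset.sum_add_distrib,
    ← sub_eq_iff_eq_add, ← Finset.sum_sub_distrib]
  obtain ⟨k, hk⟩ : ∃ k, #T = k + 1 := ⟨#T - 1, by have := hne.card_pos; omega⟩
  rw [← mul_right_inj' (mul_ne_zero hab hab)]
  -- With e = a - v_A, a distribution with e > 0 contributes (#T - #A) e and one with e < 0
  -- contributes -#(T \ A) (-e), apart from the powers. Both equal #(T \ A) e, so the truncation
  -- disappears and `hkey` and `hanti` evaluate the sum.
  trans -((a + b) * (∑ A ∈ T.powerset, a ^ #A * b ^ #(T \ A) *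
      ((-#T + #A) * (b * (a - ∑ j ∈ A, v j)) - (-#T + #A + 1) * (a * (b - ∑ j ∈ T \ A, v j))))
      - a * ∑ A ∈ T.powerset, a ^ #A * b ^ #(T \ A) *
      (b * (a - ∑ j ∈ A, v j) - a * (b - ∑ j ∈ T \ A, v j)))
  · rw [Finset.mul_sum, Finset.mul_sum, Finset.mul_sum,
      ← Finset.sum_sub_distrib, ← Finset.sum_neg_distrib]
    refine Finset.sum_congr rfl fun A hA => ?_
    have hcard : (#T : ℚ) = #A + #(T \ A) := by
      rw [← Finset.card_sdiff_add_card_eq_card (mem_powerset.1 hA)]; push_cast; ring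
    have e := hB A hA
    rw [e, hcard]
    split_ifs with h1 h2 h2
    · exfalso; linarith
    · ring
    · ring
    · have : a = ∑ j ∈ A, v j := by linarith
      rw [← this]; ring
  · rw [hkey, hanti, hk, Nat.add_sub_cancel]; ring

end PoleSums
-- The kernel for three poles and its symmetries
section ThreePoles

open Finset

variable {ι : Type*} [DecidableEq ι] {v : ι → ℚ} {T : Finset ι} {a b c x y z : ℚ}

/-- The difference depends on a truncation in x only. With the zeros of the first pole held fixed,
the sum over the other two is thus untruncated and `sum_powerset_antisymm` kills it. -/
theorem threePoleKernel_swap_right (a b c x y z : ℚ) :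
    threePoleKernel a b c x y z - threePoleKernel a c b x z y
      = if x < 0 then x * (c * y - b * z) else 0 := by
  unfold threePoleKernel
  rcases lt_trichotomy x 0 with hx | rfl | hx <;> rcases lt_trichotomy y 0 with hy | rfl | hy <;>
  rcases lt_trichotomy z 0 with hz | rfl | hz <;> simp [*, not_lt_of_gt] <;> ring

theorem threePoleKernel_swap_left (a b c x y z : ℚ) :
    threePoleKernel a b c x y z - threePoleKernel b a c y x z
      = if 0 < z then -z * (b * x - a * y) else 0 := by
  unfold threePoleKernel
  rcases lt_trichotomy x 0 with hx | rfl | hx <;> rcases lt_trichotomy y 0 with hy | rfl | hy <;>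
  rcases lt_trichotomy z 0 with hz | rfl | hz <;> simp [*, not_lt_of_gt] <;> ring

theorem threePoleKernel_eq_zero (a b c : ℚ) (h : x + y + z = 0) (hz : z ≤ 0) :
    threePoleKernel a b c x y z = 0 := by
  unfold threePoleKernel
  rw [if_neg (fun h' => by linarith [h'.2]), if_neg (fun h' => by linarith [h'.2]),
    if_neg (fun h' => by linarith [h'.1, h'.2])]
  ring

/-- The recursion for one distribution, with k, l, m the numbers of zeros at the three poles. The
next three lines are the cuts of the poles c, b, a, the three after them the joins expanded by
`sum_powerset_key`; the last term sums to zero over all distributions. -/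
theorem threePoleKernel_remainder (h : x + y + z = 0) (k l m : ℚ) :
    (k + l + m + 1) * threePoleKernel a b c x y z
      = (m * threePoleKernel a b c x y z + if x < 0 ∧ y < 0 then c * x * y else 0)
      + (l * threePoleKernel a c b x z y + if x < 0 ∧ z < 0 then b * x * z else 0)
      + (k * threePoleKernel c b a z y x + if z < 0 ∧ y < 0 then a * z * y else 0)
      + (if x < 0 then x * ((k + l) * (c * y) - (k + l + 1) * (b * z)) else 0)
      + (if y < 0 then y * ((0 + k) * (c * x) - (0 + k + 1) * (a * z)) else 0)
      + (if z < 0 then z * ((0 + k) * (b * x) - (0 + k + 1) * (a * y)) else 0)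
      - y * ((0 + k) * (c * x) - (0 + k + 1) * (a * z)) := by
  unfold threePoleKernel
  rcases lt_trichotomy x 0 with hx | rfl | hx <;> rcases lt_trichotomy y 0 with hy | rfl | hy <;>
  rcases lt_trichotomy z 0 with hz | rfl | hz <;> first
    | (exfalso; linarith)
    | (simp [*, not_lt_of_gt] <;> ring)

theorem threePole_swap_right (h : b + c ≠ 0) : threePole v T a b c = threePole v T a c b := by
  unfold threePole
  rw [← sumTri_swap_right T (fun A B C => a ^ #A * c ^ #B * b ^ #C *
    threePoleKernel a c b (a - ∑ j ∈ A, v j) (c - ∑ j ∈ B, v j) (b - ∑ j ∈ C, v j)),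
    ← sub_eq_zero, ← sumTri_sub]
  refine Finset.sum_eq_zero fun A _ => ?_
  refine Eq.trans ?_ (mul_eq_zero_of_right (a ^ #A * (if a - ∑ j ∈ A, v j < 0 then
    a - ∑ j ∈ A, v j else 0)) (sum_powerset_antisymm v (T \ A) h))
  · rw [Finset.mul_sum]
    refine Finset.sum_congr rfl fun B _ => ?_
    trans a ^ #A * b ^ #B * c ^ #((T \ A) \ B) * (threePoleKernel a b c (a - ∑ j ∈ A, v j)
      (b - ∑ j ∈ B, v j) (c - ∑ j ∈ (T \ A) \ B, v j) - threePoleKernel a c b (a - ∑ j ∈ A, v j)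
      (c - ∑ j ∈ (T \ A) \ B, v j) (b - ∑ j ∈ B, v j))
    · ring
    · rw [threePoleKernel_swap_right]
      split_ifs <;> ring

theorem threePole_swap_left (h : a + b ≠ 0) : threePole v T a b c = threePole v T b a c := by
  unfold threePole
  rw [← sumTri_swap_left T (fun A B C => b ^ #A * a ^ #B * c ^ #C *
    threePoleKernel b a c (b - ∑ j ∈ A, v j) (a - ∑ j ∈ B, v j) (c - ∑ j ∈ C, v j)),
    ← sub_eq_zero, ← sumTri_sub, sumTri_eq_right]
  refine Finset.sum_eq_zero fun C _ => ?_
  refine Eq.trans ?_ (mul_eq_zero_of_right (c ^ #C * (if 0 < c - ∑ j ∈ C, v j then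
    -(c - ∑ j ∈ C, v j) else 0)) (sum_powerset_antisymm v (T \ C) h))
  · rw [Finset.mul_sum]
    refine Finset.sum_congr rfl fun A _ => ?_
    trans a ^ #A * b ^ #((T \ C) \ A) * c ^ #C * (threePoleKernel a b c (a - ∑ j ∈ A, v j)
      (b - ∑ j ∈ (T \ C) \ A, v j) (c - ∑ j ∈ C, v j) - threePoleKernel b a c
      (b - ∑ j ∈ (T \ C) \ A, v j) (a - ∑ j ∈ A, v j) (c - ∑ j ∈ C, v j))
    · ring
    · rw [threePoleKernel_swap_left]
      split_ifs <;> ring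

/-- Both sides run over ordered partitions of T into four sets. The left groups them by the two
components S and T \ S created by a cut; the right collects in C the zeros P and Q lying at the two
parts of the cut pole. -/
theorem sum_powerset_quad {M : Type*} [AddCommMonoid M] (T : Finset ι)
    (G : Finset ι → Finset ι → Finset ι → Finset ι → M) :
    ∑ S ∈ T.powerset, ∑ P ∈ S.powerset, ∑ Q ∈ (T \ S).powerset, G P (S \ P) Q ((T \ S) \ Q)
      = ∑ C ∈ T.powerset, ∑ A ∈ (T \ C).powerset, ∑ P ∈ C.powerset,
          G P A (C \ P) ((T \ C) \ A) := by
  have hR : ∀ C ∈ T.powerset, ∑ A ∈ (T \ C).powerset, ∑ P ∈ C.powerset,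
      G P A (C \ P) ((T \ C) \ A) = ∑ P ∈ C.powerset, ∑ A ∈ (T \ C).powerset,
      G P A (C \ P) ((T \ C) \ A) := fun C _ => Finset.sum_comm
  rw [Finset.sum_congr rfl hR]
  have e1 := sum_powerset_union T (fun P A => ∑ Q ∈ (T \ (P ∪ A)).powerset,
    G P A Q ((T \ (P ∪ A)) \ Q))
  have e2 := sum_powerset_union T (fun P Q => ∑ A ∈ (T \ (P ∪ Q)).powerset,
    G P A Q ((T \ (P ∪ Q)) \ A))
  trans ∑ S ∈ T.powerset, ∑ P ∈ S.powerset, ∑ Q ∈ (T \ (P ∪ S \ P)).powerset,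
    G P (S \ P) Q ((T \ (P ∪ S \ P)) \ Q)
  · refine Finset.sum_congr rfl fun S _ => Finset.sum_congr rfl fun P hP => ?_
    rw [union_sdiff_of_subset (mem_powerset.1 hP)]
  rw [← e1]
  trans ∑ S ∈ T.powerset, ∑ P ∈ S.powerset, ∑ A ∈ (T \ (P ∪ S \ P)).powerset,
    G P A (S \ P) ((T \ (P ∪ S \ P)) \ A)
  swap
  · refine Finset.sum_congr rfl fun S _ => Finset.sum_congr rfl fun P hP => ?_
    rw [union_sdiff_of_subset (mem_powerset.1 hP)]
  rw [← e2]
  refine Finset.sum_congr rfl fun P _ => ?_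
  have := sum_powerset_swap (T \ P) (fun A Q => G P A Q ((T \ (P ∪ A)) \ Q))
  simp only [sdiff_sdiff_left, sup_eq_union] at this ⊢
  rw [this]
  simp only [union_right_comm, union_assoc]

/-- Since `abelSum` depends only on the sum of its arguments, the second sum is that of v_S^#S (c -
v_S)^#(T \ S). Adding the first, the factor v_S + (c - v_S) = c comes out: the nonempty S give #T
c^#T by `sum_nonempty_pow_mul_pow`, and S = ∅ gives the remaining c^#T. -/
theorem abel_combination (h : x + y + (c - ∑ j ∈ T, v j) = 0) :
    ∑ S ∈ T.powerset, (if S.Nonempty then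
      (∑ j ∈ S, v j) ^ (#S - 1) * (c - ∑ j ∈ S, v j) ^ (#(T \ S) + 1) else 0)
    + ∑ S ∈ T.powerset, (∑ j ∈ S, v j - x) ^ #S * (∑ j ∈ T \ S, v j - y) ^ #(T \ S)
    = (#T + 1) * c ^ #T := by
  have h1 := abelSum_eq v T (show -x + -y = 0 + (c - ∑ j ∈ T, v j) by linarith)
  unfold abelSum at h1
  have h2 : ∑ S ∈ T.powerset, (∑ j ∈ S, v j - x) ^ #S * (∑ j ∈ T \ S, v j - y) ^ #(T \ S)
      = ∑ S ∈ T.powerset, (∑ j ∈ S, v j) ^ #S * (c - ∑ j ∈ S, v j) ^ #(T \ S) := by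
    trans ∑ A ∈ T.powerset, (-x + ∑ j ∈ A, v j) ^ #A * (-y + ∑ j ∈ T \ A, v j) ^ #(T \ A)
    · refine Finset.sum_congr rfl fun S _ => ?_
      ring
    · rw [h1]
      refine Finset.sum_congr rfl fun S hS => ?_
      rw [← sum_union_sdiff_of_subset v (mem_powerset.1 hS)]
      ring
  have h3 := sum_nonempty_pow_mul_pow v T c
  rw [Finset.sum_filter] at h3
  rw [h2, ← Finset.sum_add_distrib]
  have h4 : ∀ S ∈ T.powerset, ((if S.Nonempty then
      (∑ j ∈ S, v j) ^ (#S - 1) * (c - ∑ j ∈ S, v j) ^ (#(T \ S) + 1) else 0) +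
      (∑ j ∈ S, v j) ^ #S * (c - ∑ j ∈ S, v j) ^ #(T \ S))
      = c * (if S.Nonempty then
      (∑ j ∈ S, v j) ^ (#S - 1) * (c - ∑ j ∈ S, v j) ^ #(T \ S) else 0)
      + if S = ∅ then c ^ #T else 0 := by
    intro S _
    rcases S.eq_empty_or_nonempty with rfl | hne
    · simp
    · obtain ⟨k, hk⟩ : ∃ k, #S = k + 1 := ⟨#S - 1, by have := hne.card_pos; omega⟩
      simp only [hne, hne.ne_empty, if_true, if_false, hk, Nat.add_sub_cancel]
      ring
  rw [Finset.sum_congr rfl h4, Finset.sum_add_distrib, ← Finset.mul_sum, h3,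
    Finset.sum_ite_eq' _ _ (fun _ => c ^ #T), if_pos (empty_mem_powerset T)]
  rcases Nat.eq_zero_or_pos #T with h0 | h0
  · simp [h0]
  · obtain ⟨k, hk⟩ : ∃ k, #T = k + 1 := ⟨#T - 1, by omega⟩
    rw [hk, Nat.add_sub_cancel]
    push_cast
    ring

end ThreePoles
-- Cut-and-join recursion for three poles
section ThreePolesRecursion

open Finset

variable {ι : Type*} [DecidableEq ι] {v : ι → ℚ} {T : Finset ι} {a b c x y z : ℚ}

theorem threePoleKernel_eq_add (a b c c' x y z : ℚ) :
    threePoleKernel a b c' x y z = threePoleKernel a b c x y z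
      + (c' - c) * (if x < 0 ∧ y < 0 then x * y else 0) := by
  unfold threePoleKernel
  split_ifs <;> ring

/-- The contribution to the recursion for three poles of cutting the pole of order `c` into two
parts, one of which is not connected to the other two poles. -/
theorem threePole_cut_one (hv : ∀ j, 0 < v j) (hT : ∑ j ∈ T, v j = a + b + c) :
    c * ∑ S ∈ T.powerset, (if S.Nonempty ∧ ∑ j ∈ S, v j < c then
      (∑ j ∈ S, v j) ^ (#S - 1) * threePole v (T \ S) a b (c - ∑ j ∈ S, v j) else 0)
    = sumTri T fun A B C => a ^ #A * b ^ #B * (#C * c ^ #C *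
        (threePoleKernel a b c (a - ∑ j ∈ A, v j) (b - ∑ j ∈ B, v j) (c - ∑ j ∈ C, v j)
          - c * (if a - ∑ j ∈ A, v j < 0 ∧ b - ∑ j ∈ B, v j < 0 then
            (a - ∑ j ∈ A, v j) * (b - ∑ j ∈ B, v j) else 0))
        + c * (if a - ∑ j ∈ A, v j < 0 ∧ b - ∑ j ∈ B, v j < 0 then
            (a - ∑ j ∈ A, v j) * (b - ∑ j ∈ B, v j) else 0)
          * ∑ S ∈ C.powerset, (if S.Nonempty then
      (∑ j ∈ S, v j) ^ (#S - 1) * (c - ∑ j ∈ S, v j) ^ (#(C \ S) + 1) else 0)) := by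
  have h1 : c * ∑ S ∈ T.powerset, (if S.Nonempty ∧ ∑ j ∈ S, v j < c then
      (∑ j ∈ S, v j) ^ (#S - 1) * threePole v (T \ S) a b (c - ∑ j ∈ S, v j) else 0)
      = ∑ S ∈ T.powerset, ∑ C ∈ (T \ S).powerset, ∑ A ∈ (T \ (S ∪ C)).powerset,
        if S.Nonempty ∧ ∑ j ∈ S, v j < c then c * ((∑ j ∈ S, v j) ^ (#S - 1) *
          (a ^ #A * b ^ #((T \ (S ∪ C)) \ A) * (c - ∑ j ∈ S, v j) ^ #C *
          threePoleKernel a b (c - ∑ j ∈ S, v j) (a - ∑ j ∈ A, v j)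
            (b - ∑ j ∈ (T \ (S ∪ C)) \ A, v j) (c - (∑ j ∈ S, v j + ∑ j ∈ C, v j)))) else 0 := by
    rw [Finset.mul_sum]
    refine Finset.sum_congr rfl fun S _ => ?_
    split_ifs with hS
    · rw [threePole, sumTri_eq_right]
      simp only [Finset.mul_sum]
      refine Finset.sum_congr rfl fun C _ => ?_
      rw [sdiff_sdiff_left, sup_eq_union]
      refine Finset.sum_congr rfl fun A _ => ?_
      rw [sub_sub]
    · simp
  rw [h1, sum_powerset_union T (fun S C => ∑ A ∈ (T \ (S ∪ C)).powerset,
        if S.Nonempty ∧ ∑ j ∈ S, v j < c then c * ((∑ j ∈ S, v j) ^ (#S - 1) *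
          (a ^ #A * b ^ #((T \ (S ∪ C)) \ A) * (c - ∑ j ∈ S, v j) ^ #C *
          threePoleKernel a b (c - ∑ j ∈ S, v j) (a - ∑ j ∈ A, v j)
            (b - ∑ j ∈ (T \ (S ∪ C)) \ A, v j) (c - (∑ j ∈ S, v j + ∑ j ∈ C, v j)))) else 0),
    sumTri_eq_right]
  refine Finset.sum_congr rfl fun C hC => ?_
  have hC := mem_powerset.1 hC
  trans ∑ S ∈ C.powerset, ∑ A ∈ (T \ C).powerset,
        if S.Nonempty ∧ ∑ j ∈ S, v j < c then c * ((∑ j ∈ S, v j) ^ (#S - 1) *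
          (a ^ #A * b ^ #((T \ C) \ A) * (c - ∑ j ∈ S, v j) ^ #(C \ S) *
          threePoleKernel a b (c - ∑ j ∈ S, v j) (a - ∑ j ∈ A, v j)
            (b - ∑ j ∈ (T \ C) \ A, v j) (c - ∑ j ∈ C, v j))) else 0
  · refine Finset.sum_congr rfl fun S hS => ?_
    have hS := mem_powerset.1 hS
    rw [union_sdiff_of_subset hS, sum_union_sdiff_of_subset v hS]
  rw [Finset.sum_comm]
  refine Finset.sum_congr rfl fun A hA => ?_
  have hA := mem_powerset.1 hA
  have hxyz : (a - ∑ j ∈ A, v j) + (b - ∑ j ∈ (T \ C) \ A, v j) + (c - ∑ j ∈ C, v j) = 0 := by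
    have e1 := sum_union_sdiff_of_subset v hA
    have e2 := sum_union_sdiff_of_subset v hC
    linarith
  set x := a - ∑ j ∈ A, v j
  set y := b - ∑ j ∈ (T \ C) \ A, v j
  -- If the third excess is not positive, the kernel vanishes whatever the orders. Otherwise v_S ≤
  -- v_C < c for every S ⊆ C, so the restriction on S is automatic.
  by_cases hz : c - ∑ j ∈ C, v j ≤ 0
  · have hxy : ¬ (x < 0 ∧ y < 0) := fun h => by linarith [h.1, h.2]
    simp only [threePoleKernel_eq_zero _ _ _ hxyz hz, if_neg hxy, mul_zero, ite_self,
      Finset.sum_const_zero, zero_mul, sub_zero, add_zero]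
  · have h2 := sum_nonempty_pow_mul_pow v C c
    rw [Finset.sum_filter] at h2
    have h3 : (#C : ℚ) * c ^ #C = c * (#C * c ^ (#C - 1)) := by
      rcases Nat.eq_zero_or_pos #C with h0 | h0
      · simp [h0]
      · obtain ⟨k, hk⟩ : ∃ k, #C = k + 1 := ⟨#C - 1, by omega⟩
        rw [hk, Nat.add_sub_cancel]; ring
    rw [h3, ← h2, Finset.mul_sum, Finset.mul_sum, Finset.sum_mul, ← Finset.sum_add_distrib,
      Finset.mul_sum]
    refine Finset.sum_congr rfl fun S hS => ?_
    have hlt : ∑ j ∈ S, v j < c := by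
      have := sum_le_sum_of_subset_of_pos hv (mem_powerset.1 hS)
      linarith
    simp only [hlt, and_true]
    -- The order of the third pole occurs in the kernel only as the coefficient c - v_S of the last
    -- term, which accounts for the exponent larger by one in the second sum.
    rw [threePoleKernel_eq_add a b c (c - ∑ j ∈ S, v j)]
    split_ifs <;> ring

/-- The contribution to the recursion for three poles of cutting the pole of order `c` into two
parts, each of which is connected to one of the other two poles. -/
theorem threePole_cut_two (hv : ∀ j, 0 < v j) (hT : ∑ j ∈ T, v j = a + b + c) :
    c * ∑ S ∈ T.powerset, (if a < ∑ j ∈ S, v j ∧ ∑ j ∈ S, v j < a + c then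
      twoPole v S (∑ j ∈ S, v j - a) a * twoPole v (T \ S) (c - (∑ j ∈ S, v j - a)) b else 0)
    = sumTri T fun A B C => a ^ #A * b ^ #B *
        (c * (if a - ∑ j ∈ A, v j < 0 ∧ b - ∑ j ∈ B, v j < 0 then
            (a - ∑ j ∈ A, v j) * (b - ∑ j ∈ B, v j) else 0)
          * ∑ S ∈ C.powerset, (∑ j ∈ S, v j - (a - ∑ j ∈ A, v j)) ^ #S *
              (∑ j ∈ C \ S, v j - (b - ∑ j ∈ B, v j)) ^ #(C \ S)) := by
  rw [sumTri_eq_right]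
  simp only [Finset.mul_sum]
  rw [← sum_powerset_quad T (fun S A S' B => a ^ #A * b ^ #B *
        (c * (if a - ∑ j ∈ A, v j < 0 ∧ b - ∑ j ∈ B, v j < 0 then
            (a - ∑ j ∈ A, v j) * (b - ∑ j ∈ B, v j) else 0)
          * ((∑ j ∈ S, v j - (a - ∑ j ∈ A, v j)) ^ #S *
              (∑ j ∈ S', v j - (b - ∑ j ∈ B, v j)) ^ #S')))]
  refine Finset.sum_congr rfl fun S hS => ?_
  have hS := mem_powerset.1 hS
  split_ifs with h
  · rw [twoPole, twoPole, Finset.sum_mul_sum]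
    simp only [Finset.mul_sum]
    refine Finset.sum_congr rfl fun P hP => Finset.sum_congr rfl fun Q hQ => ?_
    have e1 := sum_union_sdiff_of_subset v hS
    have e2 := sum_union_sdiff_of_subset v (mem_powerset.1 hP)
    have e3 := sum_union_sdiff_of_subset v (mem_powerset.1 hQ)
    have f1 : ∑ j ∈ S \ P, v j = ∑ j ∈ S, v j - ∑ j ∈ P, v j := by linarith
    have f2 : ∑ j ∈ (T \ S) \ Q, v j = a + b + c - ∑ j ∈ S, v j - ∑ j ∈ Q, v j := by linarith
    rw [f1, f2]
    -- In each component the two excesses are opposite, so the positivity required by `twoPole` at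
    -- the new pole is negativity at the old one.
    rw [if_congr (show (a - (∑ j ∈ S, v j - ∑ j ∈ P, v j) < 0 ∧
      b - (a + b + c - ∑ j ∈ S, v j - ∑ j ∈ Q, v j) < 0) ↔ (∑ j ∈ P, v j < ∑ j ∈ S, v j - a ∧
      ∑ j ∈ Q, v j < c - (∑ j ∈ S, v j - a)) by constructor <;> rintro ⟨h1, h2⟩ <;>
        constructor <;> linarith) rfl rfl, ite_and]
    split_ifs <;> ring
  · rw [mul_zero]
    symm
    refine Finset.sum_eq_zero fun P hP => Finset.sum_eq_zero fun Q hQ => ?_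
    have e2 := sum_union_sdiff_of_subset v (mem_powerset.1 hP)
    have e3 := sum_union_sdiff_of_subset v (mem_powerset.1 hQ)
    have p1 := Finset.sum_nonneg (s := P) fun j _ => (hv j).le
    have p2 := Finset.sum_nonneg (s := Q) fun j _ => (hv j).le
    have e1 := sum_union_sdiff_of_subset v hS
    rw [if_neg fun h' => h ⟨by linarith [h'.1], by linarith [h'.2]⟩]
    ring

/-- The contribution to the recursion for three poles of cutting the pole of order `c`. -/
def threePoleCut (v : ι → ℚ) (T : Finset ι) (a b c : ℚ) : ℚ :=
  c * (∑ S ∈ T.powerset, (if S.Nonempty ∧ ∑ j ∈ S, v j < c then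
      (∑ j ∈ S, v j) ^ (#S - 1) * threePole v (T \ S) a b (c - ∑ j ∈ S, v j) else 0))
  + c * ∑ S ∈ T.powerset, (if a < ∑ j ∈ S, v j ∧ ∑ j ∈ S, v j < a + c then
      twoPole v S (∑ j ∈ S, v j - a) a * twoPole v (T \ S) (c - (∑ j ∈ S, v j - a)) b else 0)

/-- The two kinds of cut are not separately of closed form; over the zeros C of the cut pole,
`abel_combination` evaluates their sum to (#C + 1) c^#C. -/
theorem threePoleCut_eq (hv : ∀ j, 0 < v j) (hT : ∑ j ∈ T, v j = a + b + c) :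
    threePoleCut v T a b c = sumTri T fun A B C => a ^ #A * b ^ #B * c ^ #C * (#C *
        threePoleKernel a b c (a - ∑ j ∈ A, v j) (b - ∑ j ∈ B, v j) (c - ∑ j ∈ C, v j)
        + (if a - ∑ j ∈ A, v j < 0 ∧ b - ∑ j ∈ B, v j < 0 then
            c * (a - ∑ j ∈ A, v j) * (b - ∑ j ∈ B, v j) else 0)) := by
  rw [threePoleCut, threePole_cut_one hv hT, threePole_cut_two hv hT, ← sumTri_add]
  refine sumTri_congr T fun A B C hU hAB hABC => ?_
  have e := Finset.sum_union hABC (f := v)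
  rw [Finset.sum_union hAB, hU, hT] at e
  have := abel_combination (v := v) (T := C) (c := c) (x := a - ∑ j ∈ A, v j)
    (y := b - ∑ j ∈ B, v j) (by linarith)
  split_ifs
  · linear_combination (a ^ #A * b ^ #B * c * (a - ∑ j ∈ A, v j) * (b - ∑ j ∈ B, v j)) * this
  · ring

/-- With v_T = a + b the excesses are opposite, so a + b times the summand is that of
`sum_powerset_antisymm`. -/
theorem sum_powerset_sub_eq_zero (h : a + b ≠ 0) (hT : ∑ j ∈ T, v j = a + b) :
    ∑ A ∈ T.powerset, a ^ #A * b ^ #(T \ A) * (a - ∑ j ∈ A, v j) = 0 := by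
  have := sum_powerset_antisymm v T h
  rw [← mul_right_inj' h, mul_zero, Finset.mul_sum]
  refine Eq.trans (Finset.sum_congr rfl fun A hA => ?_) this
  have e := sum_union_sdiff_of_subset v (mem_powerset.1 hA)
  linear_combination (-(a ^ #A * b ^ #(T \ A) * a)) * (e + hT)

theorem mul_twoPole_compl (hT : ∑ j ∈ T, v j = a + b + c) :
    b * c * twoPole v T (b + c) a = ∑ A ∈ T.powerset, a ^ #A *
      (if a - ∑ j ∈ A, v j < 0 then a - ∑ j ∈ A, v j else 0)
        * -(b * c * (b + c) ^ #(T \ A)) := by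
  rw [twoPole, Finset.mul_sum, sum_powerset_sdiff_self T (fun A B => b * c *
    (if ∑ j ∈ A, v j < b + c then (b + c) ^ #A * a ^ #B * (b + c - ∑ j ∈ A, v j) else 0))]
  refine Finset.sum_congr rfl fun A hA => ?_
  have e := sum_union_sdiff_of_subset v (mem_powerset.1 hA)
  have e1 : ∑ j ∈ T \ A, v j = a + b + c - ∑ j ∈ A, v j := by linarith
  rw [e1]
  split_ifs with h1 h2 h2
  · ring
  · exfalso; linarith
  · exfalso; linarith
  · ring

/-- A positive excess of the joined pole b + c is a negative excess of a, and the power of b + c is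
expanded by `sum_powerset_key` over T \ A. The free constant may vary with A. -/
theorem mul_twoPole_compl_key (hbc : b + c ≠ 0) (hT : ∑ j ∈ T, v j = a + b + c)
    (k : Finset ι → ℚ) :
    b * c * twoPole v T (b + c) a = ∑ A ∈ T.powerset, ∑ B ∈ (T \ A).powerset,
      a ^ #A * b ^ #B * c ^ #((T \ A) \ B) * (if a - ∑ j ∈ A, v j < 0 then (a - ∑ j ∈ A, v j) *
        ((k A + #B) * (c * (b - ∑ j ∈ B, v j))
          - (k A + #B + 1) * (b * (c - ∑ j ∈ (T \ A) \ B, v j))) else 0) := by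
  rw [mul_twoPole_compl hT]
  refine Finset.sum_congr rfl fun A _ => ?_
  rw [← sum_powerset_key v (T \ A) hbc (k A), Finset.mul_sum]
  refine Finset.sum_congr rfl fun B _ => ?_
  split_ifs <;> ring

/-- The cut-and-join recursion for three poles. -/
theorem threePole_recursion (hv : ∀ j, 0 < v j) (ha : 0 < a) (hb : 0 < b) (hc : 0 < c)
    (hT : ∑ j ∈ T, v j = a + b + c) :
    (#T + 1) * threePole v T a b c = b * c * twoPole v T (b + c) a
      + a * c * twoPole v T (a + c) b + a * b * twoPole v T (a + b) c
      + threePoleCut v T a b c + threePoleCut v T a c b + threePoleCut v T c b a := by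
  have hbc : b + c ≠ 0 := by positivity
  have hac : a + c ≠ 0 := by positivity
  have hab : a + b ≠ 0 := by positivity
  have hT2 : ∑ j ∈ T, v j = a + c + b := by linarith
  have hT3 : ∑ j ∈ T, v j = c + b + a := by linarith
  have hT4 : ∑ j ∈ T, v j = b + a + c := by linarith
  have hT5 : ∑ j ∈ T, v j = c + a + b := by linarith
  have hT6 : ∑ j ∈ T, v j = b + (a + c) := by linarith
  -- This is the last term of `threePoleKernel_remainder`. Summed over the zeros of a and c it
  -- leaves a multiple of (b - v_B) b^#B (a + c)^#(T \ B), whose sum over B vanishes.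
  have hzero : sumTri T (fun A B C => a ^ #A * b ^ #B * c ^ #C * ((b - ∑ j ∈ B, v j) *
      ((0 + #A) * (c * (a - ∑ j ∈ A, v j)) - (0 + #A + 1) * (a * (c - ∑ j ∈ C, v j))))) = 0 := by
    rw [sumTri_eq_mid]
    refine Eq.trans ?_ (mul_eq_zero_of_right (-(a * c))
      (sum_powerset_sub_eq_zero (v := v) (T := T) (a := b) (b := a + c) (by positivity) hT6))
    rw [Finset.mul_sum]
    refine Finset.sum_congr rfl fun B _ => ?_
    trans b ^ #B * (b - ∑ j ∈ B, v j) * -(a * c * (a + c) ^ #(T \ B))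
    · rw [← sum_powerset_key v (T \ B) hac 0, Finset.mul_sum]
      refine Finset.sum_congr rfl fun A _ => ?_
      ring
    · ring
  -- The free constants #A, 0 and 0 in the three joins are the ones that match
  -- `threePoleKernel_remainder`.
  have h1 := mul_twoPole_compl_key hbc hT (fun A => #A)
  have h2 := mul_twoPole_compl_key hac hT4 (fun _ => 0)
  have h3 := mul_twoPole_compl_key hab hT5 (fun _ => 0)
  have h1' : b * c * twoPole v T (b + c) a = sumTri T fun A B C => a ^ #A * b ^ #B * c ^ #C *
      (if a - ∑ j ∈ A, v j < 0 then (a - ∑ j ∈ A, v j) * ((#A + #B) * (c * (b - ∑ j ∈ B, v j))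
          - (#A + #B + 1) * (b * (c - ∑ j ∈ C, v j))) else 0) := h1
  have h2' : a * c * twoPole v T (a + c) b = sumTri T fun A B C => a ^ #A * b ^ #B * c ^ #C *
      (if b - ∑ j ∈ B, v j < 0 then (b - ∑ j ∈ B, v j) * ((0 + #A) * (c * (a - ∑ j ∈ A, v j))
          - (0 + #A + 1) * (a * (c - ∑ j ∈ C, v j))) else 0) := by
    rw [h2, sumTri_eq_mid]
    refine Finset.sum_congr rfl fun A _ => Finset.sum_congr rfl fun B _ => ?_
    ring
  have h3' : a * b * twoPole v T (a + b) c = sumTri T fun A B C => a ^ #A * b ^ #B * c ^ #C *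
      (if c - ∑ j ∈ C, v j < 0 then (c - ∑ j ∈ C, v j) * ((0 + #A) * (b * (a - ∑ j ∈ A, v j))
          - (0 + #A + 1) * (a * (b - ∑ j ∈ B, v j))) else 0) := by
    rw [h3, sumTri_eq_right]
    refine Finset.sum_congr rfl fun A _ => Finset.sum_congr rfl fun B _ => ?_
    ring
  have h5 : threePoleCut v T a c b = _ := (threePoleCut_eq hv hT2).trans (sumTri_swap_right T _).symm
  have h6 : threePoleCut v T c b a = _ := (threePoleCut_eq hv hT3).trans
    (((sumTri_swap_left T _).symm.trans (sumTri_swap_right T _).symm).trans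
      (sumTri_swap_left T _).symm)
  rw [← sub_zero (_ + threePoleCut v T c b a), ← hzero, h1', h2', h3', threePoleCut_eq hv hT, h5, h6, threePole, mul_sumTri, ← sumTri_add,
    ← sumTri_add, ← sumTri_add, ← sumTri_add, ← sumTri_add, ← sumTri_sub]
  refine sumTri_congr T fun A B C hU hAB hABC => ?_
  have e := Finset.sum_union hABC (f := v)
  have hcard : (#T : ℚ) = #A + #B + #C := by
    rw [← hU, Finset.card_union_of_disjoint hABC, Finset.card_union_of_disjoint hAB]
    push_cast; ring
  rw [Finset.sum_union hAB, hU, hT] at e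
  have := threePoleKernel_remainder (x := a - ∑ j ∈ A, v j) (y := b - ∑ j ∈ B, v j)
    (z := c - ∑ j ∈ C, v j) (a := a) (b := b) (c := c) (by linarith) #A #B #C
  rw [hcard]
  linear_combination (a ^ #A * b ^ #B * c ^ #C) * this

end ThreePolesRecursion
-- Multiplying a permutation by a transposition
section CutJoin

open Finset Equiv Equiv.Perm

variable {X : Type*} [Fintype X] [DecidableEq X] {σ : Perm X} {x y u v : X}

/-- The cycle of `σ` containing `x`, as a set (a singleton if `x` is fixed). -/
def cycleSet (σ : Perm X) (x : X) : Finset X := {y | σ.SameCycle x y}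

theorem mem_cycleSet : y ∈ cycleSet σ x ↔ σ.SameCycle x y := by simp [cycleSet]

theorem self_mem_cycleSet : x ∈ cycleSet σ x := mem_cycleSet.2 (SameCycle.refl _ _)

theorem cycleSet_eq_iff : cycleSet σ x = cycleSet σ y ↔ σ.SameCycle x y := by
  constructor
  · intro h
    rw [← mem_cycleSet, h]
    exact self_mem_cycleSet
  · intro h
    ext z
    rw [mem_cycleSet, mem_cycleSet]
    exact ⟨h.symm.trans, h.trans⟩

theorem isCycleOn_cycleSet (σ : Perm X) (x : X) : σ.IsCycleOn (cycleSet σ x) := by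
  refine ⟨⟨fun y hy => ?_, σ.injective.injOn, fun y hy => ?_⟩, fun y hy z hz => ?_⟩
  · rw [mem_coe, mem_cycleSet] at hy ⊢
    exact sameCycle_apply_right.2 hy
  · rw [mem_coe, mem_cycleSet] at hy
    exact ⟨σ.symm y, mem_coe.2 (mem_cycleSet.2 (sameCycle_symm_apply_right.2 hy)), by simp⟩
  · rw [mem_coe, mem_cycleSet] at hy hz
    exact hy.symm.trans hz

omit [DecidableEq X] in
theorem sameCycle_mono {s : Set X} (hs : ∀ z ∈ s, σ z ∈ s) (hx : x ∈ s)
    (h : σ.SameCycle x y) : y ∈ s := by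
  obtain ⟨n, rfl⟩ := h.exists_nat_pow_eq
  induction n with
  | zero => simpa
  | succ n ih =>
    rw [pow_succ', Perm.mul_apply]
    exact hs _ (ih ⟨n, by simp⟩)

omit [Fintype X] in
theorem mul_swap_apply_left (σ : Perm X) (x y : X) : (σ * swap x y) x = σ y := by simp

omit [Fintype X] in
theorem mul_swap_apply_right (σ : Perm X) (x y : X) : (σ * swap x y) y = σ x := by simp

omit [Fintype X] in
theorem mul_swap_apply_of_ne (σ : Perm X) (hx : u ≠ x) (hy : u ≠ y) :
    (σ * swap x y) u = σ u := by simp [swap_apply_of_ne_of_ne hx hy]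

/-- The new permutation sends x to σ y and then follows the old cycle of y, which does not contain
x, until it returns to y. -/
theorem sameCycle_mul_swap (h : ¬ σ.SameCycle x y) : (σ * swap x y).SameCycle x y := by
  have key : ∀ i : ℕ, (σ * swap x y).SameCycle x ((σ ^ (i + 1)) y) := by
    intro i
    induction i with
    | zero =>
      rw [zero_add, pow_one, ← mul_swap_apply_left σ x y]
      exact sameCycle_apply_right.2 (SameCycle.refl _ _)
    | succ i ih =>
      by_cases hy : (σ ^ (i + 1)) y = y
      · rw [pow_succ', Perm.mul_apply, hy, ← mul_swap_apply_left σ x y]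
        exact sameCycle_apply_right.2 (SameCycle.refl _ _)
      · have hx : (σ ^ (i + 1)) y ≠ x := fun hx =>
          h (SameCycle.symm ⟨((i + 1 : ℕ) : ℤ), by rw [zpow_natCast, hx]⟩)
        rw [pow_succ', Perm.mul_apply, ← mul_swap_apply_of_ne σ hx hy]
        exact sameCycle_apply_right.2 ih
  have := key (orderOf σ - 1)
  rwa [Nat.sub_add_cancel (orderOf_pos σ), pow_orderOf_eq_one] at this

theorem sameCycle_mul_swap_of_sameCycle (h : ¬ σ.SameCycle x y) (huv : σ.SameCycle u v) :
    (σ * swap x y).SameCycle u v := by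
  have hxy := sameCycle_mul_swap h
  refine sameCycle_mono (s := {v | (σ * swap x y).SameCycle u v}) (fun z hz => ?_)
    (SameCycle.refl _ _) huv
  simp only [Set.mem_ofPred_eq] at hz ⊢
  by_cases hzx : z = x
  · rw [hzx, ← mul_swap_apply_right σ x y]
    exact sameCycle_apply_right.2 ((hzx ▸ hz).trans hxy)
  by_cases hzy : z = y
  · rw [hzy, ← mul_swap_apply_left σ x y]
    exact sameCycle_apply_right.2 ((hzy ▸ hz).trans hxy.symm)
  · rw [← mul_swap_apply_of_ne σ hzx hzy]
    exact sameCycle_apply_right.2 hz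

/-- Multiplying by a transposition that meets two cycles joins them. -/
theorem sameCycle_mul_swap_iff (h : ¬ σ.SameCycle x y) :
    (σ * swap x y).SameCycle u v ↔ σ.SameCycle u v ∨
      ((σ.SameCycle x u ∨ σ.SameCycle y u) ∧ (σ.SameCycle x v ∨ σ.SameCycle y v)) := by
  have hxy := sameCycle_mul_swap h
  constructor
  · intro huv
    refine sameCycle_mono (s := {v | σ.SameCycle u v ∨
      ((σ.SameCycle x u ∨ σ.SameCycle y u) ∧ (σ.SameCycle x v ∨ σ.SameCycle y v))})
      (fun z hz => ?_) (Or.inl (SameCycle.refl _ _)) huv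
    simp only [Set.mem_ofPred_eq] at hz ⊢
    by_cases hzx : z = x
    · subst hzx
      rw [mul_swap_apply_left]
      simp only [sameCycle_apply_right]
      refine Or.inr ⟨?_, Or.inr (SameCycle.refl _ _)⟩
      rcases hz with hz | hz
      · exact Or.inl hz.symm
      · exact hz.1
    by_cases hzy : z = y
    · subst hzy
      rw [mul_swap_apply_right]
      simp only [sameCycle_apply_right]
      refine Or.inr ⟨?_, Or.inl (SameCycle.refl _ _)⟩
      rcases hz with hz | hz
      · exact Or.inr hz.symm
      · exact hz.1
    · rw [mul_swap_apply_of_ne σ hzx hzy]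
      simpa only [sameCycle_apply_right] using hz
  · rintro (huv | ⟨hu, hv⟩)
    · exact sameCycle_mul_swap_of_sameCycle h huv
    · have hx : ∀ {w}, σ.SameCycle x w ∨ σ.SameCycle y w → (σ * swap x y).SameCycle x w := by
        rintro w (hw | hw)
        · exact sameCycle_mul_swap_of_sameCycle h hw
        · exact hxy.trans (sameCycle_mul_swap_of_sameCycle h hw)
      exact (hx hu).symm.trans (hx hv)

/-- Multiplying by a transposition that meets only one cycle cuts it; one of the parts. -/
theorem cycleSet_mul_swap_pow {k : ℕ} (hk : 1 ≤ k) (hk' : k < #(cycleSet σ x)) :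
    cycleSet (σ * swap x ((σ ^ k) x)) ((σ ^ k) x) = (Finset.Icc 1 k).image fun i => (σ ^ i) x := by
  have hc := isCycleOn_cycleSet σ x
  have hne : ∀ i j, i < #(cycleSet σ x) → j < #(cycleSet σ x) → (σ ^ i) x = (σ ^ j) x → i = j := by
    intro i j hi hj h
    exact Nat.ModEq.eq_of_lt_of_lt ((hc.pow_apply_eq_pow_apply self_mem_cycleSet).1 h) hi hj
  have hstep : ∀ i, 1 ≤ i → i < k → (σ * swap x ((σ ^ k) x)) ((σ ^ i) x) = (σ ^ (i + 1)) x := by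
    intro i hi hik
    rw [mul_swap_apply_of_ne, pow_succ', Perm.mul_apply]
    · intro h
      have := hne i 0 (hik.trans hk') (by omega) (by simpa using h)
      omega
    · intro h
      have := hne i k (hik.trans hk') hk' h
      omega
  ext v
  rw [mem_cycleSet]
  constructor
  · intro h
    rw [← mem_coe]
    refine sameCycle_mono (fun z hz => ?_) ?_ h
    · simp only [coe_image, coe_Icc, Set.mem_image, Set.mem_Icc] at hz ⊢
      obtain ⟨i, ⟨hi1, hi2⟩, rfl⟩ := hz
      rcases hi2.lt_or_eq with hi | rfl
      · exact ⟨i + 1, ⟨by omega, by omega⟩, (hstep i hi1 hi).symm⟩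
      · exact ⟨1, ⟨le_rfl, hi1⟩, by rw [mul_swap_apply_right, pow_one]⟩
    · simp only [coe_image, coe_Icc, Set.mem_image, Set.mem_Icc]
      exact ⟨k, ⟨hk, le_rfl⟩, rfl⟩
  · simp only [mem_image, mem_Icc]
    rintro ⟨i, ⟨hi1, hi2⟩, rfl⟩
    induction i, hi1 using Nat.le_induction with
    | base =>
      rw [pow_one, ← mul_swap_apply_right σ x ((σ ^ k) x)]
      exact sameCycle_apply_right.2 (SameCycle.refl _ _)
    | succ i hi ih =>
      rw [← hstep i hi (by omega)]
      exact sameCycle_apply_right.2 (ih (by omega))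

theorem exists_pow_of_sameCycle (h : σ.SameCycle x y) (hne : x ≠ y) :
    ∃ k, 1 ≤ k ∧ k < #(cycleSet σ x) ∧ (σ ^ k) x = y := by
  obtain ⟨k, hk, rfl⟩ := (isCycleOn_cycleSet σ x).exists_pow_eq self_mem_cycleSet
    (mem_cycleSet.2 h)
  refine ⟨k, ?_, hk, rfl⟩
  rcases Nat.eq_zero_or_pos k with rfl | h0
  · simp at hne
  · exact h0

theorem card_cycleSet_mul_swap_pow {k : ℕ} (hk : 1 ≤ k) (hk' : k < #(cycleSet σ x)) :
    #(cycleSet (σ * swap x ((σ ^ k) x)) ((σ ^ k) x)) = k := by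
  rw [cycleSet_mul_swap_pow hk hk', Finset.card_image_of_injOn, Nat.card_Icc, Nat.add_sub_cancel]
  intro i hi j hj h
  simp only [coe_Icc, Set.mem_Icc] at hi hj
  exact Nat.ModEq.eq_of_lt_of_lt
    (((isCycleOn_cycleSet σ x).pow_apply_eq_pow_apply self_mem_cycleSet).1 h)
    (by omega) (by omega)

theorem not_sameCycle_mul_swap (h : σ.SameCycle x y) (hne : x ≠ y) :
    ¬ (σ * swap x y).SameCycle x y := by
  obtain ⟨k, hk, hk', rfl⟩ := exists_pow_of_sameCycle h hne
  intro hs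
  have hx := mem_cycleSet.2 hs.symm
  rw [cycleSet_mul_swap_pow hk hk', mem_image] at hx
  obtain ⟨i, hi, hix⟩ := hx
  rw [mem_Icc] at hi
  have := Nat.ModEq.eq_of_lt_of_lt
    (((isCycleOn_cycleSet σ x).pow_apply_eq_pow_apply (n := 0) self_mem_cycleSet).1
      (by simpa using hix)) (by omega) (by omega)
  omega

/-- For y = σ^k x the part containing y has length k, so as y varies over the rest of the cycle each
length from 1 to the full length minus 1 occurs exactly once. -/
theorem sum_cycleSet_mul_swap {M : Type*} [AddCommMonoid M] (σ : Perm X) (x : X) (f : ℕ → M) :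
    ∑ y ∈ (cycleSet σ x).erase x, f #(cycleSet (σ * swap x y) y)
      = ∑ k ∈ Ico 1 #(cycleSet σ x), f k := by
  symm
  refine Finset.sum_bij (fun k _ => (σ ^ k) x) ?_ ?_ ?_ ?_
  · intro k hk
    rw [mem_Ico] at hk
    refine mem_erase.2 ⟨fun h => ?_, mem_cycleSet.2 ⟨k, by simp⟩⟩
    have := Nat.ModEq.eq_of_lt_of_lt
      (((isCycleOn_cycleSet σ x).pow_apply_eq_pow_apply (n := 0) self_mem_cycleSet).1
      (by simpa using h)) (by omega) (by omega)
    omega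
  · intro k hk l hl h
    rw [mem_Ico] at hk hl
    exact Nat.ModEq.eq_of_lt_of_lt
      (((isCycleOn_cycleSet σ x).pow_apply_eq_pow_apply self_mem_cycleSet).1 h) hk.2 hl.2
  · intro y hy
    rw [mem_erase, mem_cycleSet] at hy
    obtain ⟨k, hk, hk', rfl⟩ := exists_pow_of_sameCycle hy.2 hy.1.symm
    exact ⟨k, mem_Ico.2 ⟨hk, hk'⟩, rfl⟩
  · intro k hk
    rw [mem_Ico] at hk
    rw [card_cycleSet_mul_swap_pow hk.1 hk.2]

end CutJoin
-- Cycles inside an invariant set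
section CyclesIn

open Finset Equiv Equiv.Perm

variable {X : Type*} [Fintype X] [DecidableEq X] {σ : Perm X} {x y u v : X} {U V : Finset X}

/-- The set of cycles of `σ` meeting `U`. -/
def cyclesIn (σ : Perm X) (U : Finset X) : Finset (Finset X) := U.image (cycleSet σ)

/-- `U` is a union of cycles of `σ`. -/
def IsCycleUnion (σ : Perm X) (U : Finset X) : Prop := ∀ x, σ x ∈ U ↔ x ∈ U

omit [DecidableEq X] in
theorem IsCycleUnion.mem_iff (hU : IsCycleUnion σ U) (h : σ.SameCycle x y) : x ∈ U ↔ y ∈ U := by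
  constructor
  · exact fun hx => sameCycle_mono (s := U) (fun z hz => (hU z).2 hz) hx h
  · exact fun hy => sameCycle_mono (s := U) (fun z hz => (hU z).2 hz) hy h.symm

omit [Fintype X] [DecidableEq X] in
theorem isCycleUnion_of_sameCycle (h : ∀ x y : X, σ.SameCycle x y → x ∈ U → y ∈ U) :
    IsCycleUnion σ U := fun _ =>
  ⟨h _ _ (sameCycle_apply_left.2 (SameCycle.refl _ _)),
    h _ _ (sameCycle_apply_right.2 (SameCycle.refl _ _))⟩

theorem IsCycleUnion.cycleSet_subset (hU : IsCycleUnion σ U) (hx : x ∈ U) : cycleSet σ x ⊆ U :=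
  fun _ hy => (hU.mem_iff (mem_cycleSet.1 hy)).1 hx

omit [DecidableEq X] in
theorem isCycleUnion_univ (σ : Perm X) : IsCycleUnion σ univ := fun x => by simp

omit [Fintype X] in
theorem IsCycleUnion.sdiff (hU : IsCycleUnion σ U) (hV : IsCycleUnion σ V) :
    IsCycleUnion σ (U \ V) := fun x => by rw [mem_sdiff, mem_sdiff, hU x, hV x]

theorem mem_cyclesIn_cycleSet (hU : IsCycleUnion σ U) : cycleSet σ x ∈ cyclesIn σ U ↔ x ∈ U := by
  rw [cyclesIn, mem_image]
  constructor
  · rintro ⟨y, hy, h⟩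
    exact (hU.mem_iff (cycleSet_eq_iff.1 h)).1 hy
  · exact fun h => ⟨x, h, rfl⟩

theorem eq_cycleSet_of_mem {c : Finset X} (hc : c ∈ cyclesIn σ U) (hx : x ∈ c) :
    c = cycleSet σ x := by
  rw [cyclesIn, mem_image] at hc
  obtain ⟨y, _, rfl⟩ := hc
  exact cycleSet_eq_iff.2 (mem_cycleSet.1 hx)

theorem nonempty_of_mem_cyclesIn {c : Finset X} (hc : c ∈ cyclesIn σ U) : c.Nonempty := by
  rw [cyclesIn, mem_image] at hc
  obtain ⟨y, _, rfl⟩ := hc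
  exact ⟨y, self_mem_cycleSet⟩

theorem mem_iff_exists_cyclesIn (hU : IsCycleUnion σ U) : x ∈ U ↔ ∃ c ∈ cyclesIn σ U, x ∈ c := by
  constructor
  · exact fun hx => ⟨_, (mem_cyclesIn_cycleSet hU).2 hx, self_mem_cycleSet⟩
  · rintro ⟨c, hc, hx⟩
    rw [eq_cycleSet_of_mem hc hx] at hc
    exact (mem_cyclesIn_cycleSet hU).1 hc

theorem cyclesIn_nonempty (hU : U.Nonempty) : (cyclesIn σ U).Nonempty := hU.image _

theorem sum_eq_sum_cyclesIn {M : Type*} [AddCommMonoid M] (hU : IsCycleUnion σ U)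
    (g : X → M) : ∑ x ∈ U, g x = ∑ c ∈ cyclesIn σ U, ∑ x ∈ c, g x := by
  rw [← Finset.sum_fiberwise_of_maps_to (g := cycleSet σ) (t := cyclesIn σ U)
    (fun x hx => (mem_cyclesIn_cycleSet hU).2 hx)]
  refine Finset.sum_congr rfl fun c hc => Finset.sum_congr ?_ fun _ _ => rfl
  ext x
  rw [mem_filter]
  constructor
  · rintro ⟨_, rfl⟩
    exact self_mem_cycleSet
  · exact fun hx => ⟨(mem_iff_exists_cyclesIn hU).2 ⟨c, hc, hx⟩, (eq_cycleSet_of_mem hc hx).symm⟩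

theorem sum_card_cyclesIn (hU : IsCycleUnion σ U) : ∑ c ∈ cyclesIn σ U, #c = #U := by
  rw [Finset.card_eq_sum_ones U, sum_eq_sum_cyclesIn hU]
  simp

/-- The lengths of a set of cycles. -/
def cycleLengths (D : Finset (Finset X)) : Multiset ℕ := D.val.map Finset.card

omit [Fintype X] in
theorem cycleLengths_insert {D : Finset (Finset X)} {c : Finset X} (h : c ∉ D) :
    cycleLengths (insert c D) = #c ::ₘ cycleLengths D := by
  rw [cycleLengths, Finset.insert_val_of_notMem h, Multiset.map_cons, cycleLengths]

theorem cycleSet_mul_swap_of_notMem (hx : ¬ σ.SameCycle u x) (hy : ¬ σ.SameCycle u y) :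
    cycleSet (σ * swap x y) u = cycleSet σ u := by
  by_cases h : σ.SameCycle x y
  · rcases eq_or_ne x y with rfl | hne
    · rw [swap_self]; rfl
    have h' := not_sameCycle_mul_swap h hne
    have e : σ * swap x y * swap x y = σ := by rw [mul_assoc, swap_mul_self, mul_one]
    have key : ∀ v, σ.SameCycle u v ↔ (σ * swap x y).SameCycle u v ∨
        (((σ * swap x y).SameCycle x u ∨ (σ * swap x y).SameCycle y u) ∧
        ((σ * swap x y).SameCycle x v ∨ (σ * swap x y).SameCycle y v)) := by
      intro v
      rw [← sameCycle_mul_swap_iff h', e]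
    ext v
    rw [mem_cycleSet, mem_cycleSet, key]
    have hnx : ¬ (σ * swap x y).SameCycle x u := fun hh => hx ((key x).2 (Or.inl hh.symm))
    have hny : ¬ (σ * swap x y).SameCycle y u := fun hh => hy ((key y).2 (Or.inl hh.symm))
    tauto
  · ext v
    rw [mem_cycleSet, mem_cycleSet, sameCycle_mul_swap_iff h]
    have hx' : ¬ σ.SameCycle x u := fun h => hx h.symm
    have hy' : ¬ σ.SameCycle y u := fun h => hy h.symm
    tauto

theorem cyclesIn_mul_swap_of_notMem (hU : IsCycleUnion σ U) (hx : x ∉ U) (hy : y ∉ U) :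
    cyclesIn (σ * swap x y) U = cyclesIn σ U := by
  refine Finset.image_congr fun u hu => ?_
  exact cycleSet_mul_swap_of_notMem (fun h => hx ((hU.mem_iff h).1 hu))
    (fun h => hy ((hU.mem_iff h).1 hu))

omit [Fintype X] in
theorem IsCycleUnion.mul_swap (hU : IsCycleUnion σ U) (h : x ∈ U ↔ y ∈ U) :
    IsCycleUnion (σ * swap x y) U := by
  intro u
  rw [Perm.mul_apply, hU]
  by_cases hux : u = x
  · rw [hux, swap_apply_left, h]
  by_cases huy : u = y
  · rw [huy, swap_apply_right, h]
  rw [swap_apply_of_ne_of_ne hux huy]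

omit [Fintype X] in
theorem mul_swap_mul_swap (σ : Perm X) (x y : X) : σ * swap x y * swap x y = σ := by
  rw [mul_assoc, swap_mul_self, mul_one]

theorem cycleSet_mul_swap_left (h : ¬ σ.SameCycle x y) :
    cycleSet (σ * swap x y) x = cycleSet σ x ∪ cycleSet σ y := by
  ext v
  rw [mem_cycleSet, mem_union, mem_cycleSet, mem_cycleSet, sameCycle_mul_swap_iff h]
  have := SameCycle.refl σ x
  tauto

theorem disjoint_cycleSet (h : ¬ σ.SameCycle x y) :
    Disjoint (cycleSet σ x) (cycleSet σ y) := by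
  rw [Finset.disjoint_left]
  intro z hx hy
  rw [mem_cycleSet] at hx hy
  exact h (hx.trans hy.symm)

theorem cyclesIn_mul_swap (hx : x ∈ U)
    (h : ¬ σ.SameCycle x y) : cyclesIn (σ * swap x y) U =
      insert (cycleSet σ x ∪ cycleSet σ y)
        (((cyclesIn σ U).erase (cycleSet σ x)).erase (cycleSet σ y)) := by
  have hl := cycleSet_mul_swap_left h
  have hr : cycleSet (σ * swap x y) y = cycleSet σ x ∪ cycleSet σ y := by
    rw [← hl]; exact (cycleSet_eq_iff.2 (sameCycle_mul_swap h)).symm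
  ext c
  simp only [cyclesIn, mem_image, mem_insert, mem_erase]
  constructor
  · rintro ⟨u, hu, rfl⟩
    by_cases hux : σ.SameCycle u x
    · left
      rw [← hl, cycleSet_eq_iff]
      exact sameCycle_mul_swap_of_sameCycle h hux
    by_cases huy : σ.SameCycle u y
    · left
      rw [← hr, cycleSet_eq_iff]
      exact sameCycle_mul_swap_of_sameCycle h huy
    · right
      rw [cycleSet_mul_swap_of_notMem hux huy]
      exact ⟨fun e => huy (cycleSet_eq_iff.1 e), fun e => hux (cycleSet_eq_iff.1 e), u, hu, rfl⟩
  · rintro (rfl | ⟨h1, h2, u, hu, rfl⟩)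
    · exact ⟨x, hx, hl⟩
    · exact ⟨u, hu, cycleSet_mul_swap_of_notMem (fun e => h2 (cycleSet_eq_iff.2 e))
        (fun e => h1 (cycleSet_eq_iff.2 e))⟩

theorem union_notMem_cyclesIn (h : ¬ σ.SameCycle x y) :
    cycleSet σ x ∪ cycleSet σ y ∉ cyclesIn σ U := by
  intro hc
  have e := eq_cycleSet_of_mem hc (mem_union_left _ self_mem_cycleSet)
  refine h (mem_cycleSet.1 ?_)
  rw [← e]
  exact mem_union_right _ self_mem_cycleSet

theorem cycleLengths_mul_swap (hx : x ∈ U) (h : ¬ σ.SameCycle x y) : cycleLengths (cyclesIn (σ * swap x y) U) =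
      (#(cycleSet σ x) + #(cycleSet σ y)) ::ₘ
        cycleLengths (((cyclesIn σ U).erase (cycleSet σ x)).erase (cycleSet σ y)) := by
  rw [cyclesIn_mul_swap hx h, cycleLengths_insert, card_union_of_disjoint
    (disjoint_cycleSet h)]
  intro hc
  exact union_notMem_cyclesIn h (mem_of_mem_erase (mem_of_mem_erase hc))

theorem card_cyclesIn_mul_swap (hU : IsCycleUnion σ U) (hx : x ∈ U) (hy : y ∈ U)
    (h : ¬ σ.SameCycle x y) : #(cyclesIn (σ * swap x y) U) + 1 = #(cyclesIn σ U) := by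
  have hne : cycleSet σ y ≠ cycleSet σ x := fun e => h (cycleSet_eq_iff.1 e.symm)
  have h1 : cycleSet σ x ∈ cyclesIn σ U := (mem_cyclesIn_cycleSet hU).2 hx
  have h2 : cycleSet σ y ∈ (cyclesIn σ U).erase (cycleSet σ x) :=
    mem_erase.2 ⟨hne, (mem_cyclesIn_cycleSet hU).2 hy⟩
  rw [cyclesIn_mul_swap hx h, Finset.card_insert_of_notMem fun hc =>
    union_notMem_cyclesIn h (mem_of_mem_erase (mem_of_mem_erase hc)),
    Finset.card_erase_of_mem h2, Finset.card_erase_of_mem h1]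
  have := Finset.card_pos.2 ⟨_, h2⟩
  rw [Finset.card_erase_of_mem h1] at this
  omega

/-- A cut is a join read backwards: multiplying by the same transposition again restores σ. -/
theorem card_cyclesIn_mul_swap_of_sameCycle (hU : IsCycleUnion σ U) (hx : x ∈ U)
    (h : σ.SameCycle x y) (hne : x ≠ y) :
    #(cyclesIn (σ * swap x y) U) = #(cyclesIn σ U) + 1 := by
  have hy := (hU.mem_iff h).1 hx
  have := card_cyclesIn_mul_swap (hU.mul_swap (x := x) (y := y) (by tauto)) hx hy
    (not_sameCycle_mul_swap h hne)
  rw [mul_swap_mul_swap] at this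
  exact this.symm

/-- The two parts of a cycle cut by a transposition. -/
theorem cycleSet_eq_union (h : σ.SameCycle x y) (hne : x ≠ y) :
    cycleSet σ x = cycleSet (σ * swap x y) x ∪ cycleSet (σ * swap x y) y := by
  have := cycleSet_mul_swap_left (not_sameCycle_mul_swap h hne)
  rwa [mul_swap_mul_swap] at this

theorem card_cycleSet_mul_swap_left (h : σ.SameCycle x y) (hne : x ≠ y) :
    #(cycleSet (σ * swap x y) x) = #(cycleSet σ x) - #(cycleSet (σ * swap x y) y) := by
  rw [cycleSet_eq_union h hne, card_union_of_disjoint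
    (disjoint_cycleSet (not_sameCycle_mul_swap h hne)), Nat.add_sub_cancel]

theorem cyclesIn_erase_eq (hU : IsCycleUnion σ U) (hx : x ∈ U) (h : σ.SameCycle x y)
    (hne : x ≠ y) : (cyclesIn σ U).erase (cycleSet σ x) =
      ((cyclesIn (σ * swap x y) U).erase (cycleSet (σ * swap x y) x)).erase
        (cycleSet (σ * swap x y) y) := by
  have hy := (hU.mem_iff h).1 hx
  have h' := not_sameCycle_mul_swap h hne
  have := cyclesIn_mul_swap hx h'
  rw [mul_swap_mul_swap] at this
  rw [this, cycleSet_eq_union h hne, Finset.erase_insert]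
  exact fun hc => union_notMem_cyclesIn h' (mem_of_mem_erase (mem_of_mem_erase hc))

open Classical in
/-- The unions of cycles of `σ * swap x y` in `U` which contain `y` but not `x`. -/
noncomputable def cutSets (σ : Perm X) (U : Finset X) (x y : X) : Finset (Finset X) :=
  U.powerset.filter fun V => IsCycleUnion (σ * swap x y) V ∧ y ∈ V ∧ x ∉ V

omit [Fintype X] in
theorem mem_cutSets : V ∈ cutSets σ U x y ↔
    V ⊆ U ∧ IsCycleUnion (σ * swap x y) V ∧ y ∈ V ∧ x ∉ V := by
  classical
  simp [cutSets]

theorem cyclesIn_biUnion {D : Finset (Finset X)} (hD : D ⊆ cyclesIn σ U) :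
    cyclesIn σ (D.biUnion id) = D := by
  ext c
  rw [cyclesIn, mem_image]
  constructor
  · rintro ⟨x, hx, rfl⟩
    rw [mem_biUnion] at hx
    obtain ⟨c, hc, hxc⟩ := hx
    rwa [← eq_cycleSet_of_mem (hD hc) hxc]
  · intro hc
    obtain ⟨x, hx⟩ := nonempty_of_mem_cyclesIn (hD hc)
    exact ⟨x, mem_biUnion.2 ⟨c, hc, hx⟩, (eq_cycleSet_of_mem (hD hc) hx).symm⟩

theorem isCycleUnion_biUnion {D : Finset (Finset X)} (hD : D ⊆ cyclesIn σ U) :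
    IsCycleUnion σ (D.biUnion id) := by
  refine isCycleUnion_of_sameCycle fun x y hxy hx => ?_
  rw [mem_biUnion] at hx ⊢
  obtain ⟨c, hc, hxc⟩ := hx
  refine ⟨c, hc, ?_⟩
  rw [id, eq_cycleSet_of_mem (hD hc) hxc]
  exact mem_cycleSet.2 hxy

theorem biUnion_cyclesIn (hU : IsCycleUnion σ U) : (cyclesIn σ U).biUnion id = U := by
  ext x
  rw [mem_biUnion, mem_iff_exists_cyclesIn hU]
  simp

theorem cyclesIn_mono (h : V ⊆ U) : cyclesIn σ V ⊆ cyclesIn σ U := Finset.image_subset_image h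

theorem cyclesIn_sdiff (hU : IsCycleUnion σ U) (hV : IsCycleUnion σ V) :
    cyclesIn σ (U \ V) = cyclesIn σ U \ cyclesIn σ V := by
  ext c
  rw [mem_sdiff]
  constructor
  · intro hc
    refine ⟨cyclesIn_mono sdiff_subset hc, fun hc' => ?_⟩
    obtain ⟨x, hx⟩ := nonempty_of_mem_cyclesIn hc
    have := (mem_iff_exists_cyclesIn (hU.sdiff hV)).2 ⟨c, hc, hx⟩
    rw [mem_sdiff] at this
    exact this.2 ((mem_iff_exists_cyclesIn hV).2 ⟨c, hc', hx⟩)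
  · rintro ⟨hc, hc'⟩
    obtain ⟨x, hx⟩ := nonempty_of_mem_cyclesIn hc
    obtain rfl := eq_cycleSet_of_mem hc hx
    rw [mem_cyclesIn_cycleSet hU] at hc
    rw [mem_cyclesIn_cycleSet hV] at hc'
    exact (mem_cyclesIn_cycleSet (hU.sdiff hV)).2 (mem_sdiff.2 ⟨hc, hc'⟩)

/-- Such a V consists of the part of the cut cycle containing y and an arbitrary set D of cycles
that the transposition does not touch; the complement in U contains the part of x and the other
untouched cycles. -/
theorem sum_cutSets {M : Type*} [AddCommMonoid M] (hU : IsCycleUnion σ U) (hx : x ∈ U)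
    (h : σ.SameCycle x y) (hne : x ≠ y) (F : Multiset ℕ → Multiset ℕ → M) :
    ∑ V ∈ cutSets σ U x y, F (cycleLengths (cyclesIn (σ * swap x y) V))
        (cycleLengths (cyclesIn (σ * swap x y) (U \ V)))
      = ∑ D ∈ ((cyclesIn σ U).erase (cycleSet σ x)).powerset,
        F (#(cycleSet (σ * swap x y) y) ::ₘ cycleLengths D)
          ((#(cycleSet σ x) - #(cycleSet (σ * swap x y) y)) ::ₘ
            cycleLengths ((cyclesIn σ U).erase (cycleSet σ x) \ D)) := by
  have hy := (hU.mem_iff h).1 hx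
  have h' := not_sameCycle_mul_swap h hne
  have hU' := hU.mul_swap (x := x) (y := y) (by tauto)
  rw [← card_cycleSet_mul_swap_left h hne, cyclesIn_erase_eq hU hx h hne]
  set σ' := σ * swap x y
  set c := cycleSet σ' x with hc_def
  set c' := cycleSet σ' y with hc'_def
  have hcc' : c' ≠ c := fun e => h' (cycleSet_eq_iff.1 e.symm)
  have hcU : c ∈ cyclesIn σ' U := (mem_cyclesIn_cycleSet hU').2 hx
  have hc'U : c' ∈ cyclesIn σ' U := (mem_cyclesIn_cycleSet hU').2 hy
  have hsub : ∀ D, D ⊆ ((cyclesIn σ' U).erase c).erase c' → insert c' D ⊆ cyclesIn σ' U :=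
    fun D hD => Finset.insert_subset hc'U
      (hD.trans ((Finset.erase_subset _ _).trans (Finset.erase_subset _ _)))
  have hnot : ∀ D, D ⊆ ((cyclesIn σ' U).erase c).erase c' → c' ∉ D ∧ c ∉ D := fun D hD =>
    ⟨fun hc => by simpa using hD hc, fun hc => by simpa using hD hc⟩
  symm
  refine Finset.sum_bij' (fun D _ => (insert c' D).biUnion id) (fun V _ => (cyclesIn σ' V).erase c')
    ?_ ?_ ?_ ?_ ?_
  · intro D hD
    have hD := mem_powerset.1 hD
    rw [mem_cutSets]
    refine ⟨?_, isCycleUnion_biUnion (hsub D hD), ?_, ?_⟩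
    · rw [← biUnion_cyclesIn hU']
      exact Finset.biUnion_subset_biUnion_of_subset_left _ (hsub D hD)
    · exact mem_biUnion.2 ⟨c', mem_insert_self _ _, self_mem_cycleSet⟩
    · intro hx'
      rw [← mem_cyclesIn_cycleSet (isCycleUnion_biUnion (hsub D hD)),
        cyclesIn_biUnion (hsub D hD), mem_insert] at hx'
      exact hx'.elim hcc'.symm (hnot D hD).2
  · intro V hV
    obtain ⟨hVU, hVc, hyV, hxV⟩ := mem_cutSets.1 hV
    rw [mem_powerset]
    refine Finset.erase_subset_erase _ fun d hd => mem_erase.2 ⟨?_, cyclesIn_mono hVU hd⟩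
    rintro rfl
    exact hxV ((mem_cyclesIn_cycleSet hVc).1 hd)
  · intro D hD
    have hD := mem_powerset.1 hD
    change (cyclesIn σ' ((insert c' D).biUnion id)).erase c' = D
    rw [cyclesIn_biUnion (hsub D hD), Finset.erase_insert (hnot D hD).1]
  · intro V hV
    obtain ⟨hVU, hVc, hyV, hxV⟩ := mem_cutSets.1 hV
    rw [Finset.insert_erase ((mem_cyclesIn_cycleSet hVc).2 hyV), biUnion_cyclesIn hVc]
  · intro D hD
    have hD := mem_powerset.1 hD
    rw [cyclesIn_sdiff hU' (isCycleUnion_biUnion (hsub D hD)), cyclesIn_biUnion (hsub D hD),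
      cycleLengths_insert (hnot D hD).1]
    congr 1
    rw [← cycleLengths_insert]
    · congr 1
      ext d
      simp only [mem_insert, mem_sdiff, mem_erase]
      by_cases hdc : d = c
      · subst hdc
        simp [hcc'.symm, hcU, (hnot D hD).2]
      · simp only [hdc, false_or, not_or]
        tauto
    · simp

end CyclesIn
-- Block weights as functions of multisets of pole orders
section BlockWeight

open Finset

variable {ι : Type*} [DecidableEq ι] {ν : ι → ℕ} {T : Finset ι}

/-- The weight of a block with at most three poles of the listed orders. -/
def listWeight (v : ι → ℚ) (T : Finset ι) : List ℕ → ℚ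
  | [a] => (a : ℚ) ^ (#T - 1)
  | [a, b] => twoPole v T a b
  | [a, b, c] => threePole v T a b c
  | _ => 0

theorem perm_pair_iff {α : Type*} {b c b' c' : α} (h : [b, c].Perm [b', c']) :
    (b = b' ∧ c = c') ∨ (b = c' ∧ c = b') := by
  have hb : b ∈ [b', c'] := h.subset (by simp)
  simp only [List.mem_cons, List.not_mem_nil, or_false] at hb
  rcases hb with rfl | rfl
  · have := (List.perm_cons b).1 h
    rw [List.singleton_perm_singleton] at this
    exact Or.inl ⟨rfl, this⟩
  · have := (List.perm_cons b).1 (h.trans (List.Perm.swap _ _ _))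
    rw [List.singleton_perm_singleton] at this
    exact Or.inr ⟨rfl, this⟩

/-- Adjacent swaps suffice. Swapping two poles needs the degree condition `hs`; swapping among three
needs only positive orders. -/
theorem listWeight_perm {v : ι → ℚ} {L L' : List ℕ} (h : L.Perm L') (hpos : ∀ a ∈ L, 0 < a)
    (hs : ∑ j ∈ T, v j = ((L.sum : ℕ) : ℚ)) : listWeight v T L = listWeight v T L' := by
  induction h with
  | nil => rfl
  | @cons a l l' h ih =>
    match l, l', h with
    | [], l', h => rw [List.nil_perm.1 h]
    | [b], l', h => rw [List.singleton_perm.1 h]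
    | [b, c], [b', c'], h =>
      rcases perm_pair_iff h with ⟨rfl, rfl⟩ | ⟨rfl, rfl⟩
      · rfl
      · have hb : 0 < b := hpos b (by simp)
        exact threePole_swap_right (by positivity)
    | [b, c], [], h => simpa using h.length_eq
    | [b, c], [_], h => simpa using h.length_eq
    | [b, c], _ :: _ :: _ :: _, h => simpa using h.length_eq
    | _ :: _ :: _ :: _, [], h => simpa using h.length_eq
    | _ :: _ :: _ :: _, [_], h => simpa using h.length_eq
    | _ :: _ :: _ :: _, [_, _], h => simpa using h.length_eq
    | _ :: _ :: _ :: _, _ :: _ :: _ :: _, h => rfl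
  | swap b a l =>
    have ha : 0 < a := hpos a (by simp)
    have hb : 0 < b := hpos b (by simp)
    have ha' : (0 : ℚ) < a := by exact_mod_cast ha
    have hb' : (0 : ℚ) < b := by exact_mod_cast hb
    match l with
    | [] =>
      refine twoPole_comm ha' hb' ?_
      rw [hs]; simp
    | [c] => exact threePole_swap_left (by positivity)
    | _ :: _ :: _ => rfl
  | trans h₁ h₂ ih₁ ih₂ =>
    rw [ih₁ hpos hs, ih₂ (fun a ha => hpos a (h₁.mem_iff.2 ha)) (by rw [hs, h₁.sum_eq])]

/-- The weight of a block with zeros `T` and at most three poles, whose orders are `M`: the number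
of genus-zero covers for a fixed monodromy at infinity, divided by the factorial of the number of
branch points. -/
def blockWeight (ν : ι → ℕ) (T : Finset ι) (M : Multiset ℕ) : ℚ :=
  if M.sum = ∑ j ∈ T, ν j then listWeight (fun j => (ν j : ℚ)) T (M.sort (· ≤ ·)) else 0

/-- Sorting in `blockWeight` only selects a representative; by symmetry any listing of the poles may
be used. -/
theorem blockWeight_coe {L : List ℕ} (hpos : ∀ a ∈ L, 0 < a) :
    blockWeight ν T (L : Multiset ℕ) =
      if L.sum = ∑ j ∈ T, ν j then listWeight (fun j => (ν j : ℚ)) T L else 0 := by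
  rw [blockWeight, Multiset.sum_coe]
  refine ite_congr rfl (fun h => ?_) fun _ => rfl
  have hp : L.Perm ((L : Multiset ℕ).sort (· ≤ ·)) := by
    rw [← Multiset.coe_eq_coe, Multiset.sort_eq]
  refine (listWeight_perm hp hpos ?_).symm
  rw [h]; push_cast; rfl

theorem blockWeight_one (a : ℕ) (T : Finset ι) :
    blockWeight ν T {a} = if a = ∑ j ∈ T, ν j then (a : ℚ) ^ (#T - 1) else 0 := by
  rw [blockWeight, Multiset.sum_singleton, Multiset.sort_singleton]
  rfl

theorem blockWeight_two {a b : ℕ} (ha : 0 < a) (hb : 0 < b) (T : Finset ι) :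
    blockWeight ν T (a ::ₘ {b}) =
      if a + b = ∑ j ∈ T, ν j then twoPole (fun j => (ν j : ℚ)) T a b else 0 := by
  have := blockWeight_coe (ν := ν) (T := T) (L := [a, b]) (by simp [ha, hb])
  rw [show (a ::ₘ {b} : Multiset ℕ) = ([a, b] : List ℕ) from rfl, this]
  simp [listWeight]

theorem blockWeight_three {a b c : ℕ} (ha : 0 < a) (hb : 0 < b) (hc : 0 < c) (T : Finset ι) :
    blockWeight ν T (a ::ₘ b ::ₘ {c}) =
      if a + b + c = ∑ j ∈ T, ν j then threePole (fun j => (ν j : ℚ)) T a b c else 0 := by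
  have := blockWeight_coe (ν := ν) (T := T) (L := [a, b, c]) (by simp [ha, hb, hc])
  rw [show (a ::ₘ b ::ₘ {c} : Multiset ℕ) = ([a, b, c] : List ℕ) from rfl, this]
  simp [listWeight, add_assoc]

theorem blockWeight_eq_zero {M : Multiset ℕ} (h : M.sum ≠ ∑ j ∈ T, ν j) :
    blockWeight ν T M = 0 := if_neg h

omit [DecidableEq ι] in
theorem sum_pos_iff_nonempty (hν : ∀ j, 0 < ν j) {S : Finset ι} :
    0 < ∑ j ∈ S, ν j ↔ S.Nonempty := by
  constructor
  · intro h
    by_contra hS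
    rw [Finset.not_nonempty_iff_eq_empty] at hS
    simp [hS] at h
  · exact fun h => Finset.sum_pos (fun j _ => hν j) h

/-- The contribution of cutting a pole of order `a` when the poles `M₁` and `M₂` stay with either
part. -/
def cutSum (w : Finset ι → Multiset ℕ → ℚ) (T : Finset ι) (a : ℕ) (M₁ M₂ : Multiset ℕ) : ℚ :=
  ∑ k ∈ Ico 1 a, ∑ S ∈ T.powerset, w S (k ::ₘ M₁) * w (T \ S) ((a - k) ::ₘ M₂)

theorem cutSum_comm (w : Finset ι → Multiset ℕ → ℚ) (T : Finset ι) (a : ℕ)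
    (M₁ M₂ : Multiset ℕ) : cutSum w T a M₁ M₂ = cutSum w T a M₂ M₁ := by
  unfold cutSum
  refine Finset.sum_nbij' (fun k => a - k) (fun k => a - k) ?_ ?_ ?_ ?_ ?_
  · intro k hk; rw [mem_Ico] at hk ⊢; omega
  · intro k hk; rw [mem_Ico] at hk ⊢; omega
  · intro k hk; rw [mem_Ico] at hk; omega
  · intro k hk; rw [mem_Ico] at hk; omega
  · intro k hk
    rw [mem_Ico] at hk
    rw [sum_powerset_sdiff_self T (fun S S' => w S (k ::ₘ M₁) * w S' ((a - k) ::ₘ M₂))]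
    refine Finset.sum_congr rfl fun S _ => ?_
    rw [Nat.sub_sub_self hk.2.le, mul_comm]

theorem cutSum_eq_zero {a : ℕ} {M₁ M₂ : Multiset ℕ} (h : a + M₁.sum + M₂.sum ≠ ∑ j ∈ T, ν j) :
    cutSum (blockWeight ν) T a M₁ M₂ = 0 := by
  refine Finset.sum_eq_zero fun k hk => Finset.sum_eq_zero fun S hS => ?_
  rw [mem_Ico] at hk
  by_cases h1 : (k ::ₘ M₁).sum = ∑ j ∈ S, ν j
  · rw [blockWeight_eq_zero (M := (a - k) ::ₘ M₂), mul_zero]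
    intro h2
    rw [Multiset.sum_cons] at h1 h2
    have := Finset.sum_sdiff (f := ν) (mem_powerset.1 hS)
    omega
  · rw [blockWeight_eq_zero h1, zero_mul]

/-- A component whose only pole is the new part of order k has degree k, which forces k = v_S and
leaves one term of the sum over k. -/
theorem cutSum_zero_left (hν : ∀ j, 0 < ν j) (a : ℕ) (M : Multiset ℕ) :
    cutSum (blockWeight ν) T a 0 M = ∑ S ∈ T.powerset,
      if S.Nonempty ∧ ∑ j ∈ S, ν j < a then
        ((∑ j ∈ S, ν j : ℕ) : ℚ) ^ (#S - 1) * blockWeight ν (T \ S) ((a - ∑ j ∈ S, ν j) ::ₘ M)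
      else 0 := by
  unfold cutSum
  rw [Finset.sum_comm]
  refine Finset.sum_congr rfl fun S _ => ?_
  simp only [Multiset.cons_zero, blockWeight_one, ite_mul, zero_mul]
  rw [Finset.sum_ite_eq' (Ico 1 a) (∑ j ∈ S, ν j)
    (fun k => (k : ℚ) ^ (#S - 1) * blockWeight ν (T \ S) ((a - k) ::ₘ M))]
  refine if_congr ?_ rfl rfl
  rw [mem_Ico, Nat.one_le_iff_ne_zero, ← Nat.pos_iff_ne_zero, sum_pos_iff_nonempty hν]

theorem cutSum_singleton_left {b : ℕ} (hb : 0 < b) (a : ℕ) (M : Multiset ℕ) :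
    cutSum (blockWeight ν) T a {b} M = ∑ S ∈ T.powerset,
      if b < ∑ j ∈ S, ν j ∧ ∑ j ∈ S, ν j < b + a then
        twoPole (fun j => (ν j : ℚ)) S ((∑ j ∈ S, ν j - b : ℕ) : ℚ) b *
          blockWeight ν (T \ S) ((a - (∑ j ∈ S, ν j - b)) ::ₘ M)
      else 0 := by
  unfold cutSum
  rw [Finset.sum_comm]
  refine Finset.sum_congr rfl fun S _ => ?_
  have h1 : ∀ k ∈ Ico 1 a, blockWeight ν S (k ::ₘ {b}) * blockWeight ν (T \ S) ((a - k) ::ₘ M)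
      = if ∑ j ∈ S, ν j - b = k then (if b < ∑ j ∈ S, ν j then
        twoPole (fun j => (ν j : ℚ)) S k b * blockWeight ν (T \ S) ((a - k) ::ₘ M) else 0)
        else 0 := by
    intro k hk
    rw [mem_Ico] at hk
    rw [blockWeight_two (by omega) hb, ite_mul, zero_mul, ← ite_and]
    -- Here k ≥ 1, so the truncated equation v_S - b = k already forces b < v_S.
    exact if_congr (by omega) rfl rfl
  rw [Finset.sum_congr rfl h1, Finset.sum_ite_eq (Ico 1 a) (∑ j ∈ S, ν j - b)
    (fun k => if b < ∑ j ∈ S, ν j then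
        twoPole (fun j => (ν j : ℚ)) S k b * blockWeight ν (T \ S) ((a - k) ::ₘ M) else 0),
    ← ite_and]
  refine if_congr ?_ rfl rfl
  rw [mem_Ico]
  omega

/-- The factor 2 is present because both orders of the two parts occur; for more poles, unlike here,
it appears only after `cutSum_comm` pairs the terms. -/
theorem cutSum_recursion_one (hT : T.Nonempty) (hν : ∀ j, 0 < ν j) (a : ℕ) :
    a * cutSum (blockWeight ν) T a 0 0 = 2 * ((#T - 1) * blockWeight ν T {a}) := by
  by_cases h : a = ∑ j ∈ T, ν j
  swap
  · rw [cutSum_eq_zero (by simpa using h), blockWeight_one, if_neg h]; simp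
  have hp := sum_proper_pow_mul_pow (v := fun j => (ν j : ℚ)) hT
  rw [cutSum_zero_left hν, blockWeight_one, if_pos h, ← mul_assoc, Finset.mul_sum]
  subst h
  push_cast
  rw [← hp, Finset.sum_filter]
  refine Finset.sum_congr rfl fun S hS => ?_
  have e := Finset.sum_sdiff (f := ν) (mem_powerset.1 hS)
  have e2 : (∑ j ∈ T \ S, ν j) = ∑ j ∈ T, ν j - ∑ j ∈ S, ν j := by omega
  have hiff : ∑ j ∈ S, ν j < ∑ j ∈ T, ν j ↔ (T \ S).Nonempty := by
    rw [← sum_pos_iff_nonempty hν]; omega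
  rw [Multiset.cons_zero, blockWeight_one, e2, if_pos rfl, ← e2, if_congr
    (and_congr_right fun _ => hiff) rfl rfl]
  push_cast
  split_ifs <;> ring

theorem cutSum_zero_singleton (hν : ∀ j, 0 < ν j) {a b : ℕ} (hb : 0 < b)
    (h : a + b = ∑ j ∈ T, ν j) :
    cutSum (blockWeight ν) T a 0 {b} = ∑ S ∈ T.powerset,
      if S.Nonempty ∧ ∑ j ∈ S, (ν j : ℚ) < a then
        (∑ j ∈ S, (ν j : ℚ)) ^ (#S - 1) *
          twoPole (fun j => (ν j : ℚ)) (T \ S) (a - ∑ j ∈ S, (ν j : ℚ)) b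
      else 0 := by
  rw [cutSum_zero_left hν]
  refine Finset.sum_congr rfl fun S hS => ?_
  have e := Finset.sum_sdiff (f := ν) (mem_powerset.1 hS)
  by_cases hc : S.Nonempty ∧ ∑ j ∈ S, ν j < a
  · have hc' : S.Nonempty ∧ ∑ j ∈ S, (ν j : ℚ) < a := ⟨hc.1, by exact_mod_cast hc.2⟩
    rw [if_pos hc, if_pos hc', blockWeight_two (by omega) hb, if_pos (by omega),
      Nat.cast_sub hc.2.le]
    push_cast
    rfl
  · have hc' : ¬ (S.Nonempty ∧ ∑ j ∈ S, (ν j : ℚ) < a) := fun h' =>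
      hc ⟨h'.1, by exact_mod_cast h'.2⟩
    rw [if_neg hc, if_neg hc']

theorem cutSum_recursion_two (hν : ∀ j, 0 < ν j) {a b : ℕ} (ha : 0 < a) (hb : 0 < b) :
    a * b * blockWeight ν T {a + b} + a * cutSum (blockWeight ν) T a 0 {b}
      + b * cutSum (blockWeight ν) T b 0 {a} = #T * blockWeight ν T (a ::ₘ {b}) := by
  by_cases h : a + b = ∑ j ∈ T, ν j
  swap
  · rw [cutSum_eq_zero (by simpa using h), cutSum_eq_zero (by simpa [add_comm] using h),
      blockWeight_one, blockWeight_two ha hb, if_neg h]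
    simp [h]
  have ha' : (0 : ℚ) < a := by exact_mod_cast ha
  have hb' : (0 : ℚ) < b := by exact_mod_cast hb
  have hT : ∑ j ∈ T, (ν j : ℚ) = a + b := by rw [← Nat.cast_sum, ← h]; push_cast; rfl
  rw [cutSum_zero_singleton hν hb h, cutSum_zero_singleton hν ha (by omega), blockWeight_one,
    blockWeight_two ha hb, if_pos h, if_pos h,
    twoPole_recursion (fun j => by exact_mod_cast hν j) ha' hb' hT]
  push_cast
  ring

theorem cutSum_zero_pair (hν : ∀ j, 0 < ν j) {a b c : ℕ} (hb : 0 < b) (hc : 0 < c)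
    (h : a + b + c = ∑ j ∈ T, ν j) :
    cutSum (blockWeight ν) T a 0 (b ::ₘ {c}) = ∑ S ∈ T.powerset,
      if S.Nonempty ∧ ∑ j ∈ S, (ν j : ℚ) < a then
        (∑ j ∈ S, (ν j : ℚ)) ^ (#S - 1) *
          threePole (fun j => (ν j : ℚ)) (T \ S) b c (a - ∑ j ∈ S, (ν j : ℚ))
      else 0 := by
  rw [cutSum_zero_left hν]
  refine Finset.sum_congr rfl fun S hS => ?_
  have e := Finset.sum_sdiff (f := ν) (mem_powerset.1 hS)
  by_cases hs : S.Nonempty ∧ ∑ j ∈ S, ν j < a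
  · have hs' : S.Nonempty ∧ ∑ j ∈ S, (ν j : ℚ) < a := ⟨hs.1, by exact_mod_cast hs.2⟩
    have h3 : (a - ∑ j ∈ S, ν j) ::ₘ b ::ₘ {c}
        = b ::ₘ c ::ₘ ({a - ∑ j ∈ S, ν j} : Multiset ℕ) := by
      rw [Multiset.cons_swap]
      congr 1
      exact Multiset.pair_comm _ _
    rw [if_pos hs, if_pos hs', h3, blockWeight_three hb hc (by omega), if_pos (by omega),
      Nat.cast_sub hs.2.le]
    push_cast
    rfl
  · have hs' : ¬ (S.Nonempty ∧ ∑ j ∈ S, (ν j : ℚ) < a) := fun h' =>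
      hs ⟨h'.1, by exact_mod_cast h'.2⟩
    rw [if_neg hs, if_neg hs']

theorem cutSum_singleton_singleton {a b c : ℕ} (hb : 0 < b) (hc : 0 < c)
    (h : a + b + c = ∑ j ∈ T, ν j) :
    cutSum (blockWeight ν) T a {b} {c} = ∑ S ∈ T.powerset,
      if (b : ℚ) < ∑ j ∈ S, (ν j : ℚ) ∧ ∑ j ∈ S, (ν j : ℚ) < b + a then
        twoPole (fun j => (ν j : ℚ)) S (∑ j ∈ S, (ν j : ℚ) - b) b *
          twoPole (fun j => (ν j : ℚ)) (T \ S) (a - (∑ j ∈ S, (ν j : ℚ) - b)) c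
      else 0 := by
  rw [cutSum_singleton_left hb]
  refine Finset.sum_congr rfl fun S hS => ?_
  have e := Finset.sum_sdiff (f := ν) (mem_powerset.1 hS)
  by_cases hs : b < ∑ j ∈ S, ν j ∧ ∑ j ∈ S, ν j < b + a
  · have hs' : (b : ℚ) < ∑ j ∈ S, (ν j : ℚ) ∧ ∑ j ∈ S, (ν j : ℚ) < b + a :=
      ⟨by exact_mod_cast hs.1, by exact_mod_cast hs.2⟩
    rw [if_pos hs, if_pos hs', blockWeight_two (by omega) hc, if_pos (by omega),
      Nat.cast_sub (show ∑ j ∈ S, ν j - b ≤ a by omega), Nat.cast_sub hs.1.le]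
    push_cast
    rfl
  · have hs' : ¬ ((b : ℚ) < ∑ j ∈ S, (ν j : ℚ) ∧ ∑ j ∈ S, (ν j : ℚ) < b + a) := fun h' =>
      hs ⟨by exact_mod_cast h'.1, by exact_mod_cast h'.2⟩
    rw [if_neg hs, if_neg hs']

theorem mul_cutSum_eq_threePoleCut (hν : ∀ j, 0 < ν j) {a b c : ℕ} (hb : 0 < b) (hc : 0 < c)
    (h : a + b + c = ∑ j ∈ T, ν j) :
    a * (cutSum (blockWeight ν) T a 0 (b ::ₘ {c}) + cutSum (blockWeight ν) T a {b} {c})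
      = threePoleCut (fun j => (ν j : ℚ)) T b c a := by
  rw [cutSum_zero_pair hν hb hc h, cutSum_singleton_singleton hb hc h, threePoleCut, mul_add]

theorem cutSum_recursion_three (hν : ∀ j, 0 < ν j) {a b c : ℕ} (ha : 0 < a) (hb : 0 < b)
    (hc : 0 < c) :
    b * c * blockWeight ν T ((b + c) ::ₘ {a}) + a * c * blockWeight ν T ((a + c) ::ₘ {b})
      + a * b * blockWeight ν T ((a + b) ::ₘ {c})
      + c * (cutSum (blockWeight ν) T c 0 (a ::ₘ {b}) + cutSum (blockWeight ν) T c {a} {b})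
      + b * (cutSum (blockWeight ν) T b 0 (a ::ₘ {c}) + cutSum (blockWeight ν) T b {a} {c})
      + a * (cutSum (blockWeight ν) T a 0 (c ::ₘ {b}) + cutSum (blockWeight ν) T a {c} {b})
      = (#T + 1) * blockWeight ν T (a ::ₘ b ::ₘ {c}) := by
  have h1 := blockWeight_two (ν := ν) (a := b + c) (b := a) (by omega) ha T
  have h2 := blockWeight_two (ν := ν) (a := a + c) (b := b) (by omega) hb T
  have h3 := blockWeight_two (ν := ν) (a := a + b) (b := c) (by omega) hc T
  by_cases h : a + b + c = ∑ j ∈ T, ν j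
  swap
  · rw [h1, h2, h3, blockWeight_three ha hb hc, if_neg h, if_neg (by omega), if_neg (by omega),
      if_neg (by omega)]
    rw [cutSum_eq_zero (by simp; omega), cutSum_eq_zero (by simp; omega),
      cutSum_eq_zero (by simp; omega), cutSum_eq_zero (by simp; omega),
      cutSum_eq_zero (by simp; omega), cutSum_eq_zero (by simp; omega)]
    simp
  have ha' : (0 : ℚ) < a := by exact_mod_cast ha
  have hb' : (0 : ℚ) < b := by exact_mod_cast hb
  have hc' : (0 : ℚ) < c := by exact_mod_cast hc
  have hT : ∑ j ∈ T, (ν j : ℚ) = a + b + c := by rw [← Nat.cast_sum, ← h]; push_cast; rfl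
  rw [mul_cutSum_eq_threePoleCut hν ha hb (by omega), mul_cutSum_eq_threePoleCut hν ha hc (by omega),
    mul_cutSum_eq_threePoleCut hν hc hb (by omega), h1, h2, h3, if_pos (by omega),
    if_pos (by omega), if_pos (by omega), blockWeight_three ha hb hc, if_pos h,
    threePole_recursion (fun j => by exact_mod_cast hν j) ha' hb' hc' hT]
  push_cast
  ring

end BlockWeight
-- The cut-and-join recursion for a block
section BlockRecursion

open Finset Equiv Equiv.Perm

variable {X ι : Type*} [Fintype X] [DecidableEq X] [DecidableEq ι] {σ : Perm X} {x y : X}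
  {U : Finset X} {T : Finset ι} {ν : ι → ℕ}

theorem cyclesIn_sdiff_cycleSet (hU : IsCycleUnion σ U) (x : X) :
    cyclesIn σ (U \ cycleSet σ x) = (cyclesIn σ U).erase (cycleSet σ x) := by
  have hc : IsCycleUnion σ (cycleSet σ x) := fun y => by
    rw [mem_cycleSet, mem_cycleSet, sameCycle_apply_right]
  rw [cyclesIn_sdiff hU hc, Finset.erase_eq]
  congr 1
  ext c
  rw [cyclesIn, mem_image, mem_singleton]
  constructor
  · rintro ⟨y, hy, rfl⟩
    exact (cycleSet_eq_iff.2 (mem_cycleSet.1 hy)).symm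
  · rintro rfl
    exact ⟨x, self_mem_cycleSet, rfl⟩

/-- The sum over the transpositions `swap x y` in a block, in terms of the cycles of the block. -/
theorem sum_mul_swap_eq (w : Finset ι → Multiset ℕ → ℚ) (hU : IsCycleUnion σ U) (T : Finset ι) :
    ∑ x ∈ U, ∑ y ∈ U.erase x, (if σ.SameCycle x y then
      ∑ V ∈ cutSets σ U x y, ∑ S ∈ T.powerset,
        w S (cycleLengths (cyclesIn (σ * swap x y) V)) *
          w (T \ S) (cycleLengths (cyclesIn (σ * swap x y) (U \ V)))
      else w T (cycleLengths (cyclesIn (σ * swap x y) U)))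
    = ∑ c ∈ cyclesIn σ U, (#c : ℚ) * (∑ c' ∈ (cyclesIn σ U).erase c, (#c' : ℚ) *
        w T ((#c + #c') ::ₘ cycleLengths (((cyclesIn σ U).erase c).erase c'))
      + ∑ D ∈ ((cyclesIn σ U).erase c).powerset,
        cutSum w T #c (cycleLengths D) (cycleLengths ((cyclesIn σ U).erase c \ D))) := by
  rw [sum_eq_sum_cyclesIn hU]
  refine Finset.sum_congr rfl fun c hc => ?_
  rw [← nsmul_eq_mul]
  -- The inner sum is the same for all x in the cycle c, hence the factor #c.
  refine Finset.sum_eq_card_nsmul fun x hx => ?_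
  obtain rfl := eq_cycleSet_of_mem hc hx
  have hxU := (mem_iff_exists_cyclesIn hU).2 ⟨_, hc, hx⟩
  -- Points y outside the cycle of x give joins, the others give cuts.
  have hsplit : U.erase x = (U \ cycleSet σ x) ∪ (cycleSet σ x).erase x := by
    ext y
    have h1 : y ∈ cycleSet σ x → y ∈ U := fun h => hU.cycleSet_subset hxU h
    have h2 : x ∈ cycleSet σ x := self_mem_cycleSet
    simp only [mem_erase, mem_union, mem_sdiff]
    by_cases hy : y = x
    · subst hy; simp [h2]
    · tauto
  rw [hsplit, Finset.sum_union]
  swap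
  · exact (Finset.disjoint_sdiff.mono_left (Finset.erase_subset _ _)).symm
  congr 1
  · have hc' : IsCycleUnion σ (U \ cycleSet σ x) := hU.sdiff fun y => by
      rw [mem_cycleSet, mem_cycleSet, sameCycle_apply_right]
    rw [sum_eq_sum_cyclesIn hc', cyclesIn_sdiff_cycleSet hU]
    refine Finset.sum_congr rfl fun c' hc' => ?_
    rw [← nsmul_eq_mul]
    refine Finset.sum_eq_card_nsmul fun y hy => ?_
    obtain ⟨hne, hc'U⟩ := mem_erase.1 hc'
    obtain rfl := eq_cycleSet_of_mem hc'U hy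
    have hnot : ¬ σ.SameCycle x y := fun h => hne (cycleSet_eq_iff.2 h.symm)
    rw [if_neg hnot, cycleLengths_mul_swap hxU hnot]
  · trans ∑ y ∈ (cycleSet σ x).erase x, ∑ D ∈ ((cyclesIn σ U).erase (cycleSet σ x)).powerset,
      ∑ S ∈ T.powerset, w S (#(cycleSet (σ * swap x y) y) ::ₘ cycleLengths D) *
        w (T \ S) ((#(cycleSet σ x) - #(cycleSet (σ * swap x y) y)) ::ₘ
          cycleLengths ((cyclesIn σ U).erase (cycleSet σ x) \ D))
    · refine Finset.sum_congr rfl fun y hy => ?_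
      rw [mem_erase, mem_cycleSet] at hy
      rw [if_pos hy.2]
      exact sum_cutSets hU hxU hy.2 hy.1.symm
        (fun M N => ∑ S ∈ T.powerset, w S M * w (T \ S) N)
    · rw [sum_cycleSet_mul_swap σ x (fun k => ∑ D ∈ ((cyclesIn σ U).erase (cycleSet σ x)).powerset,
        ∑ S ∈ T.powerset, w S (k ::ₘ cycleLengths D) *
        w (T \ S) ((#(cycleSet σ x) - k) ::ₘ
          cycleLengths ((cyclesIn σ U).erase (cycleSet σ x) \ D))), Finset.sum_comm]
      rfl

theorem sum_powerset_singleton {α : Type*} [DecidableEq α] (b : α) (f : Finset α → ℚ) :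
    ∑ D ∈ ({b} : Finset α).powerset, f D = f ∅ + f {b} := by
  rw [← insert_empty_eq, Finset.sum_powerset_insert (by simp)]
  simp

theorem sum_powerset_pair {α : Type*} [DecidableEq α] {b c : α} (h : b ≠ c)
    (f : Finset α → ℚ) :
    ∑ D ∈ ({b, c} : Finset α).powerset, f D = f ∅ + f {b} + f {c} + f {b, c} := by
  rw [Finset.sum_powerset_insert (by simpa using h), sum_powerset_singleton,
    sum_powerset_singleton, insert_empty_eq]
  ring

omit [Fintype X] [DecidableEq X] in
theorem cycleLengths_empty : cycleLengths (∅ : Finset (Finset X)) = 0 := rfl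

omit [Fintype X] [DecidableEq X] in
theorem cycleLengths_singleton (c : Finset X) : cycleLengths {c} = {#c} := rfl

/-- The cut-and-join recursion for a block with at most three poles. -/
theorem blockWeight_recursion (hν : ∀ j, 0 < ν j) (hU : IsCycleUnion σ U) (hne : U.Nonempty)
    (hcard : #(cyclesIn σ U) ≤ 3) (hT : T.Nonempty) :
    ∑ x ∈ U, ∑ y ∈ U.erase x, (if σ.SameCycle x y then
      ∑ V ∈ cutSets σ U x y, ∑ S ∈ T.powerset,
        blockWeight ν S (cycleLengths (cyclesIn (σ * swap x y) V)) *
          blockWeight ν (T \ S) (cycleLengths (cyclesIn (σ * swap x y) (U \ V)))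
      else blockWeight ν T (cycleLengths (cyclesIn (σ * swap x y) U)))
    = 2 * (#(cyclesIn σ U) + #T - 2) * blockWeight ν T (cycleLengths (cyclesIn σ U)) := by
  rw [sum_mul_swap_eq (blockWeight ν) hU T]
  have hpos : ∀ c ∈ cyclesIn σ U, 0 < #c := fun c hc =>
    Finset.card_pos.2 (nonempty_of_mem_cyclesIn hc)
  have h1 : 1 ≤ #(cyclesIn σ U) := Finset.card_pos.2 (cyclesIn_nonempty hne)
  -- From here on only a set of at most three nonempty cycles matters, not the permutation.
  generalize cyclesIn σ U = 𝒞 at *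
  have hcases : #𝒞 = 1 ∨ #𝒞 = 2 ∨ #𝒞 = 3 := by omega
  rcases hcases with h | h | h
  · obtain ⟨A, rfl⟩ := Finset.card_eq_one.1 h
    have := cutSum_recursion_one hT hν #A
    simp only [sum_singleton, erase_singleton, sum_empty, powerset_empty, zero_add,
      card_singleton, cycleLengths, empty_val, Multiset.map_zero, singleton_val,
      Multiset.map_singleton, sdiff_self, bot_eq_empty, Nat.cast_one]
    rw [this]
    ring
  · obtain ⟨A, B, hAB, rfl⟩ := Finset.card_eq_two.1 h
    have hA := hpos A (by simp)
    have hB := hpos B (by simp)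
    have e1 : ({A, B} : Finset (Finset X)).erase A = {B} := by
      rw [Finset.erase_insert (by simpa using hAB)]
    have e2 : ({A, B} : Finset (Finset X)).erase B = {A} := by
      rw [Finset.pair_comm, Finset.erase_insert (by simpa using hAB.symm)]
    have hlen : cycleLengths {A, B} = #A ::ₘ {#B} := by
      rw [cycleLengths_insert (by simpa using hAB)]; rfl
    have := cutSum_recursion_two (T := T) hν hA hB
    rw [cutSum_comm _ _ #A] at this
    rw [Finset.sum_pair hAB, e1, e2, Finset.sum_singleton, Finset.sum_singleton,
      sum_powerset_singleton, sum_powerset_singleton, Finset.card_pair hAB, hlen]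
    simp only [erase_singleton, sdiff_empty, sdiff_self, bot_eq_empty, cycleLengths_empty,
      cycleLengths_singleton, Multiset.cons_zero]
    rw [cutSum_comm _ _ #A 0, cutSum_comm _ _ #B {#A}, add_comm #B #A]
    push_cast
    -- The 2 comes from ordered pairs: a join occurs from either cycle, a cut with its two parts in
    -- either order.
    linear_combination 2 * this
  · obtain ⟨A, B, C, hAB, hAC, hBC, rfl⟩ := Finset.card_eq_three.1 h
    have hA := hpos A (by simp)
    have hB := hpos B (by simp)
    have hC := hpos C (by simp)
    have e1 : ({A, B, C} : Finset (Finset X)).erase A = {B, C} := by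
      rw [Finset.erase_insert (by simp [hAB, hAC])]
    have e2 : ({A, B, C} : Finset (Finset X)).erase B = {A, C} := by
      rw [Finset.insert_comm, Finset.erase_insert (by simp [hAB.symm, hBC])]
    have e3 : ({A, B, C} : Finset (Finset X)).erase C = {A, B} := by
      rw [Finset.pair_comm B C, Finset.insert_comm, Finset.erase_insert (by
        simp [hAC.symm, hBC.symm])]
    have p1 : ∀ {A B : Finset X}, A ≠ B → ({A, B} : Finset (Finset X)).erase A = {B} :=
      fun h => Finset.erase_insert (by simpa using h)
    have p2 : ∀ {A B : Finset X}, A ≠ B → ({A, B} : Finset (Finset X)).erase B = {A} :=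
      fun h => by rw [Finset.pair_comm, Finset.erase_insert (by simpa using h.symm)]
    have q1 : ∀ {A B : Finset X}, A ≠ B → ({A, B} : Finset (Finset X)) \ {A} = {B} :=
      fun h => by rw [← Finset.erase_eq, p1 h]
    have q2 : ∀ {A B : Finset X}, A ≠ B → ({A, B} : Finset (Finset X)) \ {B} = {A} :=
      fun h => by rw [← Finset.erase_eq, p2 h]
    have l2 : ∀ {A B : Finset X}, A ≠ B → cycleLengths {A, B} = #A ::ₘ {#B} := fun h => by
      rw [cycleLengths_insert (by simpa using h)]; rfl
    have l3 : cycleLengths {A, B, C} = #A ::ₘ #B ::ₘ {#C} := by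
      rw [cycleLengths_insert (by simp [hAB, hAC]), l2 hBC]
    have hsum : ∀ f : Finset X → ℚ, ∑ c ∈ ({A, B, C} : Finset (Finset X)), f c
        = f A + (f B + f C) := fun f => by
      rw [Finset.sum_insert (by simp [hAB, hAC]), Finset.sum_pair hBC]
    have := cutSum_recursion_three (T := T) hν hA hB hC
    rw [hsum, e1, e2, e3, l3, Finset.sum_pair hBC, Finset.sum_pair hAC, Finset.sum_pair hAB,
      sum_powerset_pair hBC, sum_powerset_pair hAC, sum_powerset_pair hAB, h]
    simp only [p1 hAB, p1 hAC, p1 hBC, p2 hAB, p2 hAC, p2 hBC, q1 hAB, q1 hAC, q1 hBC, q2 hAB,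
      q2 hAC, q2 hBC, sdiff_empty, sdiff_self, bot_eq_empty, cycleLengths_empty,
      cycleLengths_singleton, l2 hAB, l2 hAC, l2 hBC]
    rw [cutSum_comm _ _ #A (#B ::ₘ {#C}), cutSum_comm _ _ #A {#C} {#B},
      cutSum_comm _ _ #B (#A ::ₘ {#C}), cutSum_comm _ _ #B {#C} {#A},
      cutSum_comm _ _ #C (#A ::ₘ {#B}), cutSum_comm _ _ #C {#B} {#A},
      add_comm #B #A, add_comm #C #A, add_comm #C #B]
    rw [show (#C ::ₘ {#B} : Multiset ℕ) = #B ::ₘ {#C} from Multiset.pair_comm _ _,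
      cutSum_comm _ _ #A {#C} {#B}] at this
    push_cast
    linear_combination 2 * this

end BlockRecursion
-- Orbits and the Riemann–Hurwitz inequality
section Factorizations

open Finset Equiv Equiv.Perm

variable {X J B : Type*} [Fintype X] [DecidableEq X] [Fintype J] [DecidableEq J] {r : ℕ}
  {σ : Perm X} {x y u v : X} {f : Fin r → Perm X} {β : X → B} {ψ : J → B} {ν : J → ℕ} {z : X → J}

/-- The relation of lying in the same orbit of the group generated by `σ` and the `f k`. -/
def OrbitRel (σ : Perm X) (f : Fin r → Perm X) (x y : X) : Prop :=
  ∃ g ∈ Subgroup.closure (insert σ (Set.range f)), g x = y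

omit [Fintype X] [DecidableEq X] in
theorem OrbitRel.refl (σ : Perm X) (f : Fin r → Perm X) (x : X) : OrbitRel σ f x x :=
  ⟨1, one_mem _, rfl⟩

omit [Fintype X] [DecidableEq X] in
theorem OrbitRel.symm (h : OrbitRel σ f x y) : OrbitRel σ f y x := by
  obtain ⟨g, hg, rfl⟩ := h
  exact ⟨g⁻¹, inv_mem hg, by simp⟩

omit [Fintype X] [DecidableEq X] in
theorem OrbitRel.trans (h : OrbitRel σ f x y) (h' : OrbitRel σ f y u) : OrbitRel σ f x u := by
  obtain ⟨g, hg, rfl⟩ := h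
  obtain ⟨g', hg', rfl⟩ := h'
  exact ⟨g' * g, mul_mem hg' hg, by simp⟩

omit [Fintype X] [DecidableEq X] in
theorem orbitRel_apply (σ : Perm X) (f : Fin r → Perm X) (x : X) : OrbitRel σ f x (σ x) :=
  ⟨σ, Subgroup.subset_closure (Set.mem_insert _ _), rfl⟩

omit [Fintype X] [DecidableEq X] in
theorem orbitRel_apply_fun (σ : Perm X) (f : Fin r → Perm X) (k : Fin r) (x : X) :
    OrbitRel σ f x (f k x) :=
  ⟨f k, Subgroup.subset_closure (Set.mem_insert_of_mem _ ⟨k, rfl⟩), rfl⟩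

omit [Fintype X] [DecidableEq X] in
theorem OrbitRel.of_sameCycle (h : σ.SameCycle x y) : OrbitRel σ f x y := by
  obtain ⟨n, rfl⟩ := h
  exact ⟨σ ^ n, zpow_mem (Subgroup.subset_closure (Set.mem_insert _ _)) n, rfl⟩

omit [Fintype X] [DecidableEq X] in
theorem rel_apply_of_mem_closure {s : Set (Perm X)} {R : X → X → Prop} (hR : Equivalence R)
    (hs : ∀ g ∈ s, ∀ x, R x (g x)) {g : Perm X} (hg : g ∈ Subgroup.closure s) (x : X) :
    R x (g x) := by
  induction hg using Subgroup.closure_induction generalizing x with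
  | mem g hg => exact hs g hg x
  | one => exact hR.refl _
  | mul a b _ _ iha ihb => exact hR.trans (ihb x) (iha (b x))
  | inv a _ iha => simpa using hR.symm (iha (a⁻¹ x))

omit [Fintype X] [DecidableEq X] in
theorem OrbitRel.rel {R : X → X → Prop} (hR : Equivalence R) (hσ : ∀ x, R x (σ x))
    (hf : ∀ k x, R x (f k x)) (h : OrbitRel σ f x y) : R x y := by
  obtain ⟨g, hg, rfl⟩ := h
  refine rel_apply_of_mem_closure hR ?_ hg x
  rintro g (rfl | ⟨k, rfl⟩)
  · exact hσ
  · exact hf k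

omit [Fintype X] [DecidableEq X] in
theorem orbitRel_zero_iff {f : Fin 0 → Perm X} : OrbitRel σ f x y ↔ σ.SameCycle x y :=
  ⟨OrbitRel.rel (SameCycle.equivalence σ)
    (fun _ => sameCycle_apply_right.2 (SameCycle.refl _ _)) (fun k => k.elim0),
    OrbitRel.of_sameCycle⟩

omit [Fintype X] in
theorem OrbitRel.cons (h : OrbitRel (σ * swap x y) f u v) :
    OrbitRel σ (Fin.cons (swap x y) f : Fin (r + 1) → Perm X) u v := by
  have hswap : ∀ w, OrbitRel σ (Fin.cons (swap x y) f : Fin (r + 1) → Perm X) w (swap x y w) :=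
    fun w => by simpa using orbitRel_apply_fun σ (Fin.cons (swap x y) f : Fin (r + 1) → Perm X) 0 w
  refine h.rel ⟨OrbitRel.refl _ _, OrbitRel.symm, OrbitRel.trans⟩ (fun w => ?_) fun k w => ?_
  · exact (hswap w).trans (orbitRel_apply _ _ _)
  · simpa using orbitRel_apply_fun σ (Fin.cons (swap x y) f : Fin (r + 1) → Perm X) k.succ w

omit [Fintype X] in
theorem orbitRel_cons_swap (σ : Perm X) (x y : X) (f : Fin r → Perm X) :
    OrbitRel σ (Fin.cons (swap x y) f : Fin (r + 1) → Perm X) x y := by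
  simpa using orbitRel_apply_fun σ (Fin.cons (swap x y) f : Fin (r + 1) → Perm X) 0 x

-- Together with the transposition, σ and σ * swap x y generate the same group, so prepending the
-- transposition merges the orbits of x and y and changes nothing else.
omit [Fintype X] in
theorem orbitRel_cons_iff : OrbitRel σ (Fin.cons (swap x y) f : Fin (r + 1) → Perm X) u v ↔
    OrbitRel (σ * swap x y) f u v ∨
    (OrbitRel (σ * swap x y) f x u ∨ OrbitRel (σ * swap x y) f y u) ∧
      (OrbitRel (σ * swap x y) f x v ∨ OrbitRel (σ * swap x y) f y v) := by
  set E := OrbitRel (σ * swap x y) f with hE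
  have hr : ∀ w, E w w := OrbitRel.refl _ _
  have hs : ∀ {a b}, E a b → E b a := OrbitRel.symm
  have ht : ∀ {a b c}, E a b → E b c → E a c := OrbitRel.trans
  constructor
  · have hequiv : Equivalence fun u v => E u v ∨ (E x u ∨ E y u) ∧ (E x v ∨ E y v) := by
      refine ⟨fun u => Or.inl (hr u), ?_, ?_⟩
      · rintro u v (h | ⟨h1, h2⟩)
        · exact Or.inl (hs h)
        · exact Or.inr ⟨h2, h1⟩
      · rintro u v w (h | ⟨h1, h2⟩) (h' | ⟨h1', h2'⟩)
        · exact Or.inl (ht h h')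
        · exact Or.inr ⟨h1'.imp (fun k => ht k (hs h)) (fun k => ht k (hs h)), h2'⟩
        · exact Or.inr ⟨h1, h2.imp (fun k => ht k h') (fun k => ht k h')⟩
        · exact Or.inr ⟨h1, h2'⟩
    have hswap : ∀ w, E w (swap x y w) ∨ (E x w ∨ E y w) ∧ (E x (swap x y w) ∨ E y (swap x y w)) := by
      intro w
      by_cases hx : w = x
      · subst hx; rw [swap_apply_left]; exact Or.inr ⟨Or.inl (hr _), Or.inr (hr _)⟩
      by_cases hy : w = y
      · subst hy; rw [swap_apply_right]; exact Or.inr ⟨Or.inr (hr _), Or.inl (hr _)⟩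
      · rw [swap_apply_of_ne_of_ne hx hy]; exact Or.inl (hr _)
    refine OrbitRel.rel hequiv (fun w => ?_) fun k w => ?_
    · refine hequiv.trans (hswap w) (Or.inl ?_)
      simpa using orbitRel_apply (σ * swap x y) f (swap x y w)
    · refine Fin.cases ?_ (fun k => ?_) k
      · exact hswap w
      · exact Or.inl (orbitRel_apply_fun _ _ _ _)
  · have hxy := orbitRel_cons_swap σ x y f
    rintro (h | ⟨h1, h2⟩)
    · exact h.cons
    · have hx : ∀ {w}, E x w ∨ E y w →
          OrbitRel σ (Fin.cons (swap x y) f : Fin (r + 1) → Perm X) x w := by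
        rintro w (h | h)
        · exact h.cons
        · exact hxy.trans h.cons
      exact (hx h1).symm.trans (hx h2)

omit [Fintype X] in
theorem orbitRel_cons_iff_of_orbitRel (h : OrbitRel (σ * swap x y) f x y) :
    OrbitRel σ (Fin.cons (swap x y) f : Fin (r + 1) → Perm X) u v ↔
      OrbitRel (σ * swap x y) f u v := by
  rw [orbitRel_cons_iff]
  refine ⟨?_, Or.inl⟩
  have hx : ∀ {w}, OrbitRel (σ * swap x y) f x w ∨ OrbitRel (σ * swap x y) f y w →
      OrbitRel (σ * swap x y) f x w := fun hw => hw.elim id h.trans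
  rintro (h' | ⟨h1, h2⟩)
  · exact h'
  · exact (hx h1).symm.trans (hx h2)

/-- The labelling obtained from `β` by giving a new label to the points of `V`. -/
def cutLabel {α : Type*} [DecidableEq α] (β : α → B) (V : Finset α) (u : α) : Option B :=
  if u ∈ V then none else some (β u)

omit [Fintype X] in
/-- When a transposition joins two orbits, the orbits before are given by a `cutLabel`. -/
theorem orbitRel_iff_cutLabel (hβ : ∀ u v,
      OrbitRel σ (Fin.cons (swap x y) f : Fin (r + 1) → Perm X) u v ↔ β u = β v)
    {V : Finset X}
    (hV : ∀ u, u ∈ V ↔ OrbitRel (σ * swap x y) f y u) (u v : X) :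
    OrbitRel (σ * swap x y) f u v ↔ cutLabel β V u = cutLabel β V v := by
  have hcons := fun u v => (hβ u v).symm.trans (orbitRel_cons_iff (σ := σ) (x := x) (y := y)
    (f := f) (u := u) (v := v))
  set E := OrbitRel (σ * swap x y) f with hE
  have hs : ∀ {a b}, E a b → E b a := OrbitRel.symm
  have ht : ∀ {a b c}, E a b → E b c → E a c := OrbitRel.trans
  unfold cutLabel
  by_cases hu : u ∈ V <;> by_cases hv : v ∈ V
  · simp only [hu, hv, if_true, iff_true]
    exact ht (hs ((hV u).1 hu)) ((hV v).1 hv)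
  · simp only [hu, hv, if_true, if_false, reduceCtorEq, iff_false]
    exact fun h => hv ((hV v).2 (ht ((hV u).1 hu) h))
  · simp only [hu, hv, if_true, if_false, reduceCtorEq, iff_false]
    exact fun h => hu ((hV u).2 (ht ((hV v).1 hv) (hs h)))
  · simp only [hu, hv, if_false, Option.some.injEq]
    rw [hcons]
    rw [hV] at hu hv
    constructor
    · exact Or.inl
    · rintro (h | ⟨h1 | h1, h2 | h2⟩)
      · exact h
      · exact ht (hs h1) h2
      · exact absurd h2 hv
      · exact absurd h1 hu
      · exact absurd h1 hu

theorem cutLabel_surjective {α : Type*} [DecidableEq α] {β : α → B}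
    (hβ : Function.Surjective β) {V : Finset α} (hne : V.Nonempty)
    (hV : ∀ u ∈ V, ∃ w ∉ V, β w = β u) : Function.Surjective (cutLabel β V) := by
  rintro (_ | b)
  · obtain ⟨y, hy⟩ := hne
    exact ⟨y, by simp [cutLabel, hy]⟩
  · obtain ⟨u, rfl⟩ := hβ b
    by_cases hu : u ∈ V
    · obtain ⟨w, hw, hwu⟩ := hV u hu
      exact ⟨w, by simp [cutLabel, hw, hwu]⟩
    · exact ⟨u, by simp [cutLabel, hu]⟩

/-- The Riemann--Hurwitz inequality. -/
theorem card_cyclesIn_add_le {r : ℕ} {σ : Perm X} {f : Fin r → Perm X} {B : Type} [Fintype B]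
    {β : X → B} (hf : ∀ k, (f k).IsSwap) (hβ : Function.Surjective β)
    (horb : ∀ u v, OrbitRel σ f u v ↔ β u = β v) :
    #(cyclesIn σ univ) + #(cyclesIn (σ * (List.ofFn f).prod) univ) ≤ r + 2 * Fintype.card B := by
  induction r generalizing σ B with
  | zero =>
    have hle : #(cyclesIn σ univ) ≤ Fintype.card B := by
      rw [← Finset.card_univ]
      have hex : ∀ b, ∃ u, β u = b := hβ
      choose g hg using hex
      rw [show cyclesIn σ univ = univ.image fun b => cycleSet σ (g b) from ?_]
      · exact Finset.card_image_le
      · ext c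
        simp only [cyclesIn, mem_image, mem_univ, true_and]
        constructor
        · rintro ⟨u, rfl⟩
          refine ⟨β u, cycleSet_eq_iff.2 ?_⟩
          rw [← orbitRel_zero_iff (f := f), horb, hg]
        · rintro ⟨b, rfl⟩
          exact ⟨_, rfl⟩
    simp only [List.ofFn_zero, List.prod_nil, mul_one]
    omega
  | succ r ih =>
    obtain ⟨x, y, hxy, hτ⟩ := hf 0
    obtain ⟨τ, f, rfl⟩ : ∃ τ f', f = Fin.cons τ f' := ⟨f 0, Fin.tail f, (Fin.cons_self_tail f).symm⟩
    rw [Fin.cons_zero] at hτ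
    subst hτ
    have hf' : ∀ k, (f k).IsSwap := fun k => by simpa using hf k.succ
    have hprod : σ * (List.ofFn (Fin.cons (swap x y) f : Fin (r + 1) → Perm X)).prod
        = σ * swap x y * (List.ofFn f).prod := by
      rw [List.ofFn_cons, List.prod_cons, mul_assoc]
    rw [hprod]
    -- If x and y remain in one orbit, the orbits are unchanged and σ has at most one cycle more
    -- than σ * swap x y, which the additional transposition pays for.
    by_cases h : OrbitRel (σ * swap x y) f x y
    · have := ih hf' hβ fun u v => (orbitRel_cons_iff_of_orbitRel h).symm.trans (horb u v)
      have hle : #(cyclesIn σ univ) ≤ #(cyclesIn (σ * swap x y) univ) + 1 := by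
        by_cases hs : σ.SameCycle x y
        · rw [card_cyclesIn_mul_swap_of_sameCycle (isCycleUnion_univ σ) (mem_univ _) hs hxy]
          omega
        · rw [card_cyclesIn_mul_swap (isCycleUnion_univ σ) (mem_univ _) (mem_univ _) hs]
      omega
    -- If x and y are separated, the transposition cannot join cycles and hence cuts one. The
    -- induction hypothesis then has one more cycle and one more orbit, which is exactly enough.
    · have hs : σ.SameCycle x y := by
        by_contra hs
        exact h (OrbitRel.of_sameCycle (sameCycle_mul_swap hs))
      classical
      let V : Finset X := {u | OrbitRel (σ * swap x y) f y u}
      have hV : ∀ u, u ∈ V ↔ OrbitRel (σ * swap x y) f y u := fun u => by simp [V]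
      have hxV : x ∉ V := fun hx => h ((hV x).1 hx).symm
      have := ih hf' (cutLabel_surjective hβ ⟨y, (hV y).2 (OrbitRel.refl _ _ _)⟩
        fun u hu => ⟨x, hxV, ((horb _ _).1 ((orbitRel_cons_swap σ x y f).trans
          ((hV u).1 hu).cons))⟩) (orbitRel_iff_cutLabel horb hV)
      rw [card_cyclesIn_mul_swap_of_sameCycle (isCycleUnion_univ σ) (mem_univ _) hs hxy,
        Fintype.card_option] at this
      omega

end Factorizations
-- Level sets of labellings and sums over transpositions
section LabelSets

open Finset Equiv Equiv.Perm

variable {X J B : Type*} [Fintype X] [DecidableEq X] [Fintype J] [DecidableEq J] [DecidableEq B]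
  {σ : Perm X} {β : X → B} {z : X → J}

/-- The set of points with a given label. -/
def labelSet (β : X → B) (b : B) : Finset X := {x | β x = b}

omit [DecidableEq X] in
@[simp]
theorem mem_labelSet {b : B} {x : X} : x ∈ labelSet β b ↔ β x = b := by simp [labelSet]

omit [DecidableEq X] in
theorem isCycleUnion_labelSet (hσ : ∀ x, β (σ x) = β x) (b : B) :
    IsCycleUnion σ (labelSet β b) := fun x => by rw [mem_labelSet, mem_labelSet, hσ]

theorem cyclesIn_univ_eq_image (hz : ∀ x y, z x = z y ↔ σ.SameCycle x y)
    (hs : Function.Surjective z) : cyclesIn σ univ = univ.image (labelSet z) := by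
  have key : ∀ x, cycleSet σ x = labelSet z (z x) := fun x => by
    ext y
    rw [mem_cycleSet, mem_labelSet, ← hz, eq_comm]
  ext c
  simp only [cyclesIn, mem_image, mem_univ, true_and]
  constructor
  · rintro ⟨x, rfl⟩
    exact ⟨z x, (key x).symm⟩
  · rintro ⟨j, rfl⟩
    obtain ⟨x, rfl⟩ := hs j
    exact ⟨x, key x⟩

omit [DecidableEq X] [Fintype J] in
theorem labelSet_injective (hs : Function.Surjective z) : Function.Injective (labelSet z) := by
  intro j j' h
  obtain ⟨x, rfl⟩ := hs j
  have : x ∈ labelSet z j' := by rw [← h, mem_labelSet]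
  exact mem_labelSet.1 this

theorem card_cyclesIn_univ_eq (hz : ∀ x y, z x = z y ↔ σ.SameCycle x y)
    (hs : Function.Surjective z) : #(cyclesIn σ univ) = Fintype.card J := by
  rw [cyclesIn_univ_eq_image hz hs, Finset.card_image_of_injective _ (labelSet_injective hs),
    Finset.card_univ]

theorem cycleLengths_univ_eq (hz : ∀ x y, z x = z y ↔ σ.SameCycle x y)
    (hs : Function.Surjective z) :
    cycleLengths (cyclesIn σ univ) = (univ : Finset J).val.map fun j => #(labelSet z j) := by
  rw [cyclesIn_univ_eq_image hz hs, cycleLengths,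
    Finset.image_val_of_injOn (labelSet_injective hs).injOn, Multiset.map_map]
  rfl

theorem sum_card_cyclesIn_labelSet [Fintype B] (hσ : ∀ x, β (σ x) = β x) :
    ∑ b, #(cyclesIn σ (labelSet β b)) = #(cyclesIn σ univ) := by
  rw [← Finset.card_biUnion]
  · congr 1
    ext c
    simp [cyclesIn]
  · intro b _ b' _ hbb
    rw [Function.onFun, Finset.disjoint_left]
    intro c hc hc'
    obtain ⟨x, hx⟩ := nonempty_of_mem_cyclesIn hc
    have h1 := (mem_iff_exists_cyclesIn (isCycleUnion_labelSet hσ b)).2 ⟨c, hc, hx⟩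
    have h2 := (mem_iff_exists_cyclesIn (isCycleUnion_labelSet hσ b')).2 ⟨c, hc', hx⟩
    rw [mem_labelSet] at h1 h2
    exact hbb (h1.symm.trans h2)

omit [DecidableEq X] in
theorem sum_card_labelSet [Fintype B] (β : X → B) : ∑ b, #(labelSet β b) = Fintype.card X := by
  rw [← Finset.card_univ, Finset.card_eq_sum_card_fiberwise (f := β) (t := univ) (by simp)]
  rfl

/-- Transpositions are counted twice by ordered pairs of distinct points. -/
theorem two_mul_sum_isSwap {g : Perm X → ℚ} (hg : ∀ τ, ¬ τ.IsSwap → g τ = 0) :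
    2 * ∑ τ, g τ = ∑ x, ∑ y ∈ univ.erase x, g (swap x y) := by
  have e : ∑ x : X, ∑ y ∈ univ.erase x, g (swap x y)
      = ∑ p ∈ (univ : Finset (X × X)) with p.1 ≠ p.2, g (swap p.1 p.2) := by
    rw [Finset.sum_filter, Fintype.sum_prod_type]
    refine Finset.sum_congr rfl fun x _ => ?_
    rw [← Finset.sum_filter]
    refine Finset.sum_congr ?_ fun _ _ => rfl
    ext y; simp [eq_comm]
  rw [e, ← Finset.sum_fiberwise_of_maps_to (t := univ) (g := fun p : X × X => swap p.1 p.2)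
    (fun _ _ => mem_univ _), Finset.mul_sum]
  refine Finset.sum_congr rfl fun τ _ => ?_
  rw [Finset.sum_congr rfl (g := fun _ => g τ) fun p hp => by rw [(mem_filter.1 hp).2],
    Finset.sum_const, nsmul_eq_mul]
  by_cases hτ : τ.IsSwap
  · obtain ⟨a, b, hab, rfl⟩ := hτ
    have : ({p ∈ ({p : X × X | p.1 ≠ p.2} : Finset _) | swap p.1 p.2 = swap a b} : Finset _)
        = {(a, b), (b, a)} := by
      ext ⟨x, y⟩
      simp only [mem_filter, mem_univ, true_and, mem_insert, mem_singleton, Prod.mk.injEq]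
      constructor
      · rintro ⟨hxy, h⟩
        have h1 : swap a b x = y := by rw [← h, swap_apply_left]
        by_cases hxa : x = a
        · subst hxa; rw [swap_apply_left] at h1; exact Or.inl ⟨rfl, h1.symm⟩
        by_cases hxb : x = b
        · subst hxb; rw [swap_apply_right] at h1; exact Or.inr ⟨rfl, h1.symm⟩
        · rw [swap_apply_of_ne_of_ne hxa hxb] at h1; exact absurd h1 hxy
      · rintro (⟨rfl, rfl⟩ | ⟨rfl, rfl⟩)
        · exact ⟨hab, rfl⟩
        · exact ⟨hab.symm, swap_comm _ _⟩
    rw [this, Finset.card_pair (by simp [hab])]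
    norm_num
  · rw [hg τ hτ]; simp

end LabelSets

/-! ### Removing the first transposition from a factorization -/

section FactorizationCount

open Finset Equiv Equiv.Perm

variable {X J : Type*} {B : Type} [Fintype X] [DecidableEq X] [Fintype J] [DecidableEq J]
  {r : ℕ} {σ : Perm X} {x y : X} {f : Fin r → Perm X}
  {β : X → B} {ψ : J → B} {ν : J → ℕ} {z : X → J}

/-- The transpositions `f k` have as orbits, together with `σ`, the level sets of `β`, and `z`
labels the cycles of `σ * f 0 * ⋯ * f (r - 1)`, of lengths `ν`, compatibly with `ψ`. -/
structure IsFactorization (ν : J → ℕ) (σ : Perm X) (β : X → B) (ψ : J → B)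
    (f : Fin r → Perm X) (z : X → J) : Prop where
  isSwap : ∀ k, (f k).IsSwap
  zero_eq_iff : ∀ x y, z x = z y ↔ (σ * (List.ofFn f).prod).SameCycle x y
  zero_mult : ∀ j, #(labelSet z j) = ν j
  orbit_iff : ∀ x y, OrbitRel σ f x y ↔ β x = β y
  label : ∀ x, ψ (z x) = β x

open Classical in
/-- The number of factorizations. -/
noncomputable def factCount (r : ℕ) (ν : J → ℕ) (σ : Perm X) (β : X → B) (ψ : J → B) : ℚ :=
  ∑ f : Fin r → Perm X, ∑ z : X → J, if IsFactorization ν σ β ψ f z then 1 else 0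

open Classical in
/-- The number of factorizations with a given first transposition. -/
noncomputable def factCountCons (r : ℕ) (ν : J → ℕ) (σ : Perm X) (β : X → B) (ψ : J → B)
    (τ : Perm X) : ℚ :=
  ∑ f : Fin r → Perm X, ∑ z : X → J,
    if IsFactorization ν σ β ψ (Fin.cons τ f : Fin (r + 1) → Perm X) z then 1 else 0

theorem factCount_succ (r : ℕ) (ν : J → ℕ) (σ : Perm X) (β : X → B) (ψ : J → B) :
    factCount (r + 1) ν σ β ψ = ∑ τ, factCountCons r ν σ β ψ τ := by
  unfold factCount factCountCons
  rw [← (Fin.consEquiv fun _ => Perm X).sum_comp, Fintype.sum_prod_type]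
  rfl

theorem factCountCons_eq_zero {τ : Perm X} (h : ∀ (f : Fin r → Perm X) (z : X → J),
    ¬ IsFactorization ν σ β ψ (Fin.cons τ f : Fin (r + 1) → Perm X) z) :
    factCountCons r ν σ β ψ τ = 0 :=
  Finset.sum_eq_zero fun f _ => Finset.sum_eq_zero fun z _ => if_neg (h f z)

theorem factCount_eq_zero (h : ∀ (f : Fin r → Perm X) (z : X → J),
    ¬ IsFactorization ν σ β ψ f z) : factCount r ν σ β ψ = 0 :=
  Finset.sum_eq_zero fun f _ => Finset.sum_eq_zero fun z _ => if_neg (h f z)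

theorem two_mul_factCount_succ (r : ℕ) (ν : J → ℕ) (σ : Perm X) (β : X → B) (ψ : J → B) :
    2 * factCount (r + 1) ν σ β ψ =
      ∑ x, ∑ y ∈ univ.erase x, factCountCons r ν σ β ψ (swap x y) := by
  rw [factCount_succ]
  refine two_mul_sum_isSwap fun τ hτ => factCountCons_eq_zero fun f z h => hτ ?_
  simpa using h.isSwap 0

omit [Fintype X] in
theorem mul_prod_ofFn_cons (σ : Perm X) (x y : X) (f : Fin r → Perm X) :
    σ * (List.ofFn (Fin.cons (swap x y) f : Fin (r + 1) → Perm X)).prod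
      = σ * swap x y * (List.ofFn f).prod := by
  rw [List.ofFn_cons, List.prod_cons, mul_assoc]

omit [Fintype J] in
theorem IsFactorization.surjective (h : IsFactorization ν σ β ψ f z) (hν : ∀ j, 0 < ν j) :
    Function.Surjective z := by
  intro j
  have := hν j
  rw [← h.zero_mult, Finset.card_pos] at this
  obtain ⟨x, hx⟩ := this
  exact ⟨x, mem_labelSet.1 hx⟩

theorem factCountCons_eq_zero_of_ne (h : β x ≠ β y) :
    factCountCons r ν σ β ψ (swap x y) = 0 :=
  factCountCons_eq_zero fun f _ hf => h ((hf.orbit_iff x y).1 (orbitRel_cons_swap σ x y f))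

omit [Fintype J] in
theorem isFactorization_cons_iff (hxy : x ≠ y) (h : OrbitRel (σ * swap x y) f x y) :
    IsFactorization ν σ β ψ (Fin.cons (swap x y) f : Fin (r + 1) → Perm X) z ↔
      IsFactorization ν (σ * swap x y) β ψ f z := by
  constructor
  · intro hf
    refine ⟨fun k => by simpa using hf.isSwap k.succ, ?_, hf.zero_mult, fun u v => ?_, hf.label⟩
    · simpa only [mul_prod_ofFn_cons] using hf.zero_eq_iff
    · rw [← orbitRel_cons_iff_of_orbitRel h, hf.orbit_iff]
  · intro hf
    refine ⟨Fin.cases ⟨x, y, hxy, rfl⟩ fun k => by simpa using hf.isSwap k, ?_, hf.zero_mult,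
      fun u v => ?_, hf.label⟩
    · simpa only [mul_prod_ofFn_cons] using hf.zero_eq_iff
    · rw [orbitRel_cons_iff_of_orbitRel h, hf.orbit_iff]

theorem factCountCons_of_not_sameCycle (h : ¬ σ.SameCycle x y) :
    factCountCons r ν σ β ψ (swap x y) = factCount r ν (σ * swap x y) β ψ := by
  classical
  have hxy : x ≠ y := fun e => h (e ▸ SameCycle.refl _ _)
  unfold factCountCons factCount
  refine Finset.sum_congr rfl fun f _ => Finset.sum_congr rfl fun z _ => ?_
  exact if_congr (isFactorization_cons_iff hxy (OrbitRel.of_sameCycle (sameCycle_mul_swap h)))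
    rfl rfl

omit [Fintype J] in
/-- The labels of the points of a part of a cut are those of that part. -/
theorem IsFactorization.mem_iff {V : Finset X} {S : Finset J}
    (h : IsFactorization ν σ (cutLabel β V) (cutLabel ψ S) f z) (u : X) : z u ∈ S ↔ u ∈ V := by
  have := h.label u
  unfold cutLabel at this
  split_ifs at this <;> tauto

/-- `hr` says that the genus is zero. If the orbits survived the cut, there would be one cycle more
and one transposition fewer, which violates `card_cyclesIn_add_le`. -/
theorem not_orbitRel_of_card [Fintype B] (hν : ∀ j, 0 < ν j) (hβ : Function.Surjective β)
    (hr : r + 1 + 2 * Fintype.card B = #(cyclesIn σ univ) + Fintype.card J)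
    (h : σ.SameCycle x y) (hxy : x ≠ y)
    (hf : IsFactorization ν σ β ψ (Fin.cons (swap x y) f : Fin (r + 1) → Perm X) z) :
    ¬ OrbitRel (σ * swap x y) f x y := by
  intro ho
  rw [isFactorization_cons_iff hxy ho] at hf
  have h1 := card_cyclesIn_add_le hf.isSwap hβ hf.orbit_iff
  rw [card_cyclesIn_univ_eq hf.zero_eq_iff (hf.surjective hν),
    card_cyclesIn_mul_swap_of_sameCycle (isCycleUnion_univ σ) (mem_univ x) h hxy] at h1
  omega

variable [DecidableEq B]

theorem IsFactorization.cons_of_cut {V : Finset X} {S : Finset J}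
    (hV : V ∈ cutSets σ (labelSet β (β x)) x y) (hS : S ⊆ labelSet ψ (β x)) (hxy : x ≠ y)
    (hf : IsFactorization ν (σ * swap x y) (cutLabel β V) (cutLabel ψ S) f z) :
    IsFactorization ν σ β ψ (Fin.cons (swap x y) f : Fin (r + 1) → Perm X) z := by
  obtain ⟨hVU, hVσ, hyV, hxV⟩ := mem_cutSets.1 hV
  have hVb : ∀ u ∈ V, β u = β x := fun u hu => mem_labelSet.1 (hVU hu)
  refine ⟨Fin.cases ⟨x, y, hxy, rfl⟩ fun k => by simpa using hf.isSwap k, ?_, hf.zero_mult,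
    fun u v => ?_, fun u => ?_⟩
  · simpa only [mul_prod_ofFn_cons] using hf.zero_eq_iff
  · rw [orbitRel_cons_iff]
    simp only [hf.orbit_iff, cutLabel, hxV, hyV, if_true, if_false]
    by_cases hu : u ∈ V <;> by_cases hv : v ∈ V <;> simp [hu, hv, hVb, eq_comm]
    exact fun h h' => h.symm.trans h'
  · have := hf.label u
    have hm := hf.mem_iff u
    unfold cutLabel at this
    by_cases hu : u ∈ V
    · rw [hVb u hu]
      exact mem_labelSet.1 (hS (hm.2 hu))
    · rw [if_neg hu, if_neg fun hc => hu (hm.1 hc)] at this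
      exact Option.some_injective _ this

/-- V is the orbit of y after the transposition is removed, and S is the set of zeros lying in it.
-/
theorem IsFactorization.exists_cut
    (hf : IsFactorization ν σ β ψ (Fin.cons (swap x y) f : Fin (r + 1) → Perm X) z)
    (ho : ¬ OrbitRel (σ * swap x y) f x y) :
    ∃ V ∈ cutSets σ (labelSet β (β x)) x y, ∃ S ⊆ labelSet ψ (β x),
      IsFactorization ν (σ * swap x y) (cutLabel β V) (cutLabel ψ S) f z := by
  classical
  let V : Finset X := {u | OrbitRel (σ * swap x y) f y u}
  have hV : ∀ u, u ∈ V ↔ OrbitRel (σ * swap x y) f y u := fun u => by simp [V]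
  have hβV : ∀ u ∈ V, β u = β x := fun u hu => by
    rw [eq_comm, ← hf.orbit_iff]
    exact (orbitRel_cons_swap σ x y f).trans ((hV u).1 hu).cons
  have hprod : ∀ u v, z u = z v ↔ (σ * swap x y * (List.ofFn f).prod).SameCycle u v := by
    simpa only [mul_prod_ofFn_cons] using hf.zero_eq_iff
  -- The final product belongs to the group generated by σ * swap x y and the f k, so each of its
  -- cycles lies in one orbit and no zero is shared between V and its complement.
  have hzV : ∀ u, z u ∈ V.image z ↔ u ∈ V := fun u => by
    rw [mem_image]
    refine ⟨?_, fun hu => ⟨u, hu, rfl⟩⟩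
    rintro ⟨v, hv, hvu⟩
    rw [hV] at hv ⊢
    refine hv.trans ?_
    obtain ⟨n, hn⟩ := (hprod v u).1 hvu
    refine ⟨_, zpow_mem (mul_mem (Subgroup.subset_closure (Set.mem_insert _ _))
      (list_prod_mem fun g hg => Subgroup.subset_closure (Set.mem_insert_of_mem _ ?_))) n, hn⟩
    rwa [List.mem_ofFn'] at hg
  refine ⟨V, mem_cutSets.2 ⟨fun u hu => mem_labelSet.2 (hβV u hu),
    isCycleUnion_of_sameCycle fun u v huv hu => ?_, (hV y).2 (OrbitRel.refl _ _ _),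
    fun hx => ho ((hV x).1 hx).symm⟩, V.image z, fun j hj => ?_, ?_, hprod, hf.zero_mult, ?_, ?_⟩
  · rw [hV] at hu ⊢
    exact hu.trans (OrbitRel.of_sameCycle huv)
  · obtain ⟨u, hu, rfl⟩ := mem_image.1 hj
    rw [mem_labelSet, hf.label, hβV u hu]
  · exact fun k => by simpa using hf.isSwap k.succ
  · exact orbitRel_iff_cutLabel hf.orbit_iff hV
  · intro u
    simp only [cutLabel, hzV, hf.label]

/-- A cut disconnects the block of x, and the pair (V, S) is recovered from the factorization: V is
the orbit of y and S consists of the labels occurring in V. Hence every factorization is counted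
exactly once on the right. -/
theorem factCountCons_of_sameCycle [Fintype B] (hν : ∀ j, 0 < ν j) (hβ : Function.Surjective β)
    (hr : r + 1 + 2 * Fintype.card B = #(cyclesIn σ univ) + Fintype.card J)
    (h : σ.SameCycle x y) (hxy : x ≠ y) :
    factCountCons r ν σ β ψ (swap x y) =
      ∑ V ∈ cutSets σ (labelSet β (β x)) x y, ∑ S ∈ (labelSet ψ (β x)).powerset,
        factCount r ν (σ * swap x y) (cutLabel β V) (cutLabel ψ S) := by
  classical
  unfold factCountCons factCount
  let F : Finset X × Finset J → (Fin r → Perm X) → (X → J) → ℚ := fun p f z =>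
    if IsFactorization ν (σ * swap x y) (cutLabel β p.1) (cutLabel ψ p.2) f z then 1 else 0
  change _ = ∑ V ∈ cutSets σ (labelSet β (β x)) x y, ∑ S ∈ (labelSet ψ (β x)).powerset,
    ∑ f, ∑ z, F (V, S) f z
  rw [← Finset.sum_product (f := fun p => ∑ f, ∑ z, F p f z)]
  refine Eq.trans (Finset.sum_congr rfl fun f _ => ?_) Finset.sum_comm
  refine Eq.trans (Finset.sum_congr rfl fun z _ => ?_) Finset.sum_comm
  unfold F
  by_cases hf : IsFactorization ν σ β ψ (Fin.cons (swap x y) f : Fin (r + 1) → Perm X) z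
  · rw [if_pos hf]
    obtain ⟨V, hV, S, hS, hfac⟩ := hf.exists_cut (not_orbitRel_of_card hν hβ hr h hxy hf)
    rw [Finset.sum_eq_single_of_mem (V, S) (mem_product.2 ⟨hV, mem_powerset.2 hS⟩), if_pos hfac]
    rintro ⟨V', S'⟩ hp hne
    obtain ⟨hV', hS'⟩ := mem_product.1 hp
    refine if_neg fun hfac' => hne ?_
    have key : ∀ {V : Finset X} {S : Finset J}, V ∈ cutSets σ (labelSet β (β x)) x y →
        IsFactorization ν (σ * swap x y) (cutLabel β V) (cutLabel ψ S) f z → ∀ u,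
          u ∈ V ↔ OrbitRel (σ * swap x y) f y u := by
      intro V S hV hfac u
      rw [hfac.orbit_iff]
      simp only [cutLabel, (mem_cutSets.1 hV).2.2.1, if_true]
      split_ifs <;> simp [*]
    have hVV : V' = V := by
      ext u
      rw [key hV' hfac', key hV hfac]
    subst hVV
    refine Prod.ext rfl ?_
    ext j
    obtain ⟨u, rfl⟩ := hfac.surjective hν j
    rw [hfac.mem_iff]
    exact hfac'.mem_iff u
  · rw [if_neg hf, eq_comm]
    refine Finset.sum_eq_zero ?_
    rintro ⟨V, S⟩ hp
    obtain ⟨hV, hS⟩ := mem_product.1 hp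
    exact if_neg fun hfac => hf (hfac.cons_of_cut hV (mem_powerset.1 hS) hxy)

end FactorizationCount
-- Counting factorizations in genus zero
section FactorizationFormula

open Finset Equiv Equiv.Perm

variable {X J : Type*} {B : Type} [Fintype X] [DecidableEq X] [Fintype J] [DecidableEq J]
  [DecidableEq B] {σ : Perm X} {x y : X} {β : X → B} {ψ : J → B} {ν : J → ℕ}

theorem cycleLengths_sum {U : Finset X} (hU : IsCycleUnion σ U) :
    (cycleLengths (cyclesIn σ U)).sum = #U := by
  rw [← sum_card_cyclesIn hU]; rfl

omit [DecidableEq X] in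
theorem labelSet_nonempty (hβ : Function.Surjective β) (b : B) : (labelSet β b).Nonempty := by
  obtain ⟨x, rfl⟩ := hβ b
  exact ⟨x, mem_labelSet.2 rfl⟩

theorem labelSet_cutLabel_none {V : Finset X} :
    labelSet (cutLabel β V) none = V := by
  ext u; simp [cutLabel]

theorem labelSet_cutLabel_some {V : Finset X} (b : B) :
    labelSet (cutLabel β V) (some b) = labelSet β b \ V := by
  ext u; simp only [mem_labelSet, cutLabel, mem_sdiff]
  split_ifs <;> simp [*]

theorem labelSet_cutLabel_some_of_ne {V : Finset X} {b b' : B} (hV : V ⊆ labelSet β b)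
    (h : b' ≠ b) : labelSet (cutLabel β V) (some b') = labelSet β b' := by
  rw [labelSet_cutLabel_some, Finset.sdiff_eq_self_iff_disjoint, Finset.disjoint_left]
  intro u hu hu'
  have := mem_labelSet.1 (hV hu')
  rw [mem_labelSet] at hu
  exact h (hu.symm.trans this)

/-- The product over all orbits of their weights. -/
noncomputable def totalWeight [Fintype B] (ν : J → ℕ) (σ : Perm X) (β : X → B) (ψ : J → B) : ℚ :=
  ∏ b, blockWeight ν (labelSet ψ b) (cycleLengths (cyclesIn σ (labelSet β b)))

variable [Fintype B]

/-- Every block has at least one pole and one zero, and `hr` makes the total twice the number of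
blocks, so each block is a single cycle with a single zero. The labelling of the zeros is then
forced, and the only condition left is that the degrees agree. -/
theorem factCount_zero (hσ : ∀ x, β (σ x) = β x)
    (hβ : Function.Surjective β) (hψ : Function.Surjective ψ)
    (hr : 2 * Fintype.card B = #(cyclesIn σ univ) + Fintype.card J) :
    factCount 0 ν σ β ψ = totalWeight ν σ β ψ := by
  classical
  have h1 : ∀ b, 1 ≤ #(cyclesIn σ (labelSet β b)) := fun b =>
    Finset.card_pos.2 (cyclesIn_nonempty (labelSet_nonempty hβ b))
  have h2 : ∀ b, 1 ≤ #(labelSet ψ b) := fun b => Finset.card_pos.2 (labelSet_nonempty hψ b)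
  have hsum : ∑ b, (#(cyclesIn σ (labelSet β b)) + #(labelSet ψ b)) = ∑ _b : B, 2 := by
    rw [Finset.sum_add_distrib, sum_card_cyclesIn_labelSet hσ, sum_card_labelSet, ← hr]
    simp [mul_comm]
  have h3 : ∀ b, 2 = #(cyclesIn σ (labelSet β b)) + #(labelSet ψ b) := fun b =>
    (Finset.sum_eq_sum_iff_of_le fun b _ => by have := h1 b; have := h2 b; omega).1
      hsum.symm b (mem_univ b)
  have hc : ∀ b, #(cyclesIn σ (labelSet β b)) = 1 := fun b => by
    have := h1 b; have := h2 b; have := h3 b; omega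
  have hl : ∀ b, #(labelSet ψ b) = 1 := fun b => by
    have := h1 b; have := h2 b; have := h3 b; omega
  have hψi : Function.Injective ψ := fun i j hij =>
    Finset.card_le_one.1 (hl (ψ i)).le i (mem_labelSet.2 rfl) j (mem_labelSet.2 hij.symm)
  have hbij : Function.Bijective ψ := ⟨hψi, hψ⟩
  let e := Equiv.ofBijective ψ hbij
  have he : ∀ b, labelSet ψ b = {e.symm b} := fun b => by
    ext j
    rw [mem_labelSet, mem_singleton, Equiv.eq_symm_apply]; rfl
  have hcyc : ∀ b, cyclesIn σ (labelSet β b) = {labelSet β b} := fun b => by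
    obtain ⟨c, hc'⟩ := Finset.card_eq_one.1 (hc b)
    have := biUnion_cyclesIn (isCycleUnion_labelSet hσ b)
    rw [hc'] at this ⊢
    rw [← this]; simp
  have hsame : ∀ u v, σ.SameCycle u v ↔ β u = β v := fun u v => by
    have hc : cycleSet σ u = labelSet β (β u) := by
      have := (mem_cyclesIn_cycleSet (isCycleUnion_labelSet hσ (β u))).2 (mem_labelSet.2 rfl)
      rwa [hcyc, mem_singleton] at this
    rw [← mem_cycleSet, hc, mem_labelSet, eq_comm]
  have hlab : ∀ j, labelSet (fun x => e.symm (β x)) j = labelSet β (ψ j) := fun j => by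
    ext x
    rw [mem_labelSet, mem_labelSet, Equiv.symm_apply_eq]; rfl
  have hW : totalWeight ν σ β ψ = if ∀ b, #(labelSet β b) = ν (e.symm b) then 1 else 0 := by
    unfold totalWeight
    simp only [he, hcyc, cycleLengths, singleton_val, Multiset.map_singleton, blockWeight_one,
      sum_singleton, card_singleton, tsub_self, pow_zero]
    rw [Finset.prod_ite_zero]
    simp
  rw [hW, factCount, Fintype.sum_unique,
    Finset.sum_eq_single_of_mem (fun x => e.symm (β x)) (mem_univ _)]
  · refine if_congr ⟨fun h b => ?_, fun h => ⟨fun k => k.elim0, fun u v => ?_, fun j => ?_,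
      fun u v => ?_, fun u => ?_⟩⟩ rfl rfl
    · have := h.zero_mult (e.symm b)
      rw [hlab] at this
      rw [← this]
      congr 2
      exact (e.apply_symm_apply b).symm
    · simp [hsame]
    · rw [hlab, h]
      congr 1
      exact e.symm_apply_apply j
    · rw [orbitRel_zero_iff, hsame]
    · exact e.apply_symm_apply _
  · intro z _ hz
    refine if_neg fun h => hz (funext fun u => ?_)
    rw [Equiv.eq_symm_apply]
    exact h.label u

theorem totalWeight_mul_swap (hσ : ∀ x, β (σ x) = β x) (hxy : β x = β y) :
    totalWeight ν (σ * swap x y) β ψ =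
      (∏ b ∈ univ.erase (β x),
        blockWeight ν (labelSet ψ b) (cycleLengths (cyclesIn σ (labelSet β b)))) *
      blockWeight ν (labelSet ψ (β x))
        (cycleLengths (cyclesIn (σ * swap x y) (labelSet β (β x)))) := by
  rw [totalWeight, ← Finset.prod_erase_mul _ _ (mem_univ (β x))]
  congr 1
  refine Finset.prod_congr rfl fun b hb => ?_
  have hb' := (mem_erase.1 hb).1
  rw [cyclesIn_mul_swap_of_notMem (isCycleUnion_labelSet hσ b)]
  · rw [mem_labelSet]; exact hb'.symm
  · rw [mem_labelSet, ← hxy]; exact hb'.symm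

theorem totalWeight_cutLabel (hσ : ∀ x, β (σ x) = β x) (hxy : β x = β y) {V : Finset X}
    {S : Finset J} (hV : V ⊆ labelSet β (β x)) (hS : S ⊆ labelSet ψ (β x)) :
    totalWeight ν (σ * swap x y) (cutLabel β V) (cutLabel ψ S) =
      (∏ b ∈ univ.erase (β x),
        blockWeight ν (labelSet ψ b) (cycleLengths (cyclesIn σ (labelSet β b)))) *
      (blockWeight ν S (cycleLengths (cyclesIn (σ * swap x y) V)) *
        blockWeight ν (labelSet ψ (β x) \ S)
          (cycleLengths (cyclesIn (σ * swap x y) (labelSet β (β x) \ V)))) := by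
  rw [totalWeight, Fintype.prod_option, ← Finset.prod_erase_mul _ _ (mem_univ (β x)),
    labelSet_cutLabel_none, labelSet_cutLabel_none, labelSet_cutLabel_some,
    labelSet_cutLabel_some, mul_left_comm]
  congr 1
  refine Finset.prod_congr rfl fun b hb => ?_
  have hb' := (mem_erase.1 hb).1
  rw [labelSet_cutLabel_some_of_ne hV hb', labelSet_cutLabel_some_of_ne hS hb',
    cyclesIn_mul_swap_of_notMem (isCycleUnion_labelSet hσ b)]
  · rw [mem_labelSet]; exact hb'.symm
  · rw [mem_labelSet, ← hxy]; exact hb'.symm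

omit [Fintype X] [DecidableEq B] [Fintype B] in
theorem label_mul_swap (hσ : ∀ x, β (σ x) = β x) (hxy : β x = β y) (u : X) :
    β ((σ * swap x y) u) = β u := by
  rw [Perm.mul_apply, hσ]
  by_cases hx : u = x
  · rw [hx, swap_apply_left, hxy]
  by_cases hy : u = y
  · rw [hy, swap_apply_right, hxy]
  rw [swap_apply_of_ne_of_ne hx hy]

/-- The number of factorizations in genus zero, for orbits with at most three cycles. -/
theorem factCount_eq {r : ℕ} {σ : Perm X} {B : Type} [Fintype B] [DecidableEq B] {β : X → B}
    {ψ : J → B} (hν : ∀ j, 0 < ν j) (hσ : ∀ x, β (σ x) = β x) (hβ : Function.Surjective β)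
    (hψ : Function.Surjective ψ)
    (hr : r + 2 * Fintype.card B = #(cyclesIn σ univ) + Fintype.card J)
    (hc : ∀ b, #(cyclesIn σ (labelSet β b)) ≤ 3) :
    factCount r ν σ β ψ = r ! * totalWeight ν σ β ψ := by
  -- Both must vary: the transposition changes σ, and a cut replaces B by `Option B`.
  induction r generalizing σ B with
  | zero => rw [factCount_zero hσ hβ hψ (by omega)]; simp
  | succ r ih =>
    have hU := isCycleUnion_labelSet hσ
    set W : B → ℚ := fun b =>
      blockWeight ν (labelSet ψ b) (cycleLengths (cyclesIn σ (labelSet β b))) with hW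
    have hjoin : ∀ x y, β x = β y → ¬ σ.SameCycle x y →
        factCountCons r ν σ β ψ (swap x y) = r ! * ((∏ b ∈ univ.erase (β x), W b) *
          blockWeight ν (labelSet ψ (β x))
            (cycleLengths (cyclesIn (σ * swap x y) (labelSet β (β x))))) := by
      intro x y hxy hs
      have hsw := label_mul_swap hσ hxy
      rw [factCountCons_of_not_sameCycle hs, ih hsw hβ hψ, totalWeight_mul_swap hσ hxy]
      · have := card_cyclesIn_mul_swap (isCycleUnion_univ σ) (mem_univ x) (mem_univ y) hs
        omega
      · intro b
        by_cases hb : β x = b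
        · have := card_cyclesIn_mul_swap (hU b) (mem_labelSet.2 hb)
            (mem_labelSet.2 (hxy ▸ hb)) hs
          have := hc b
          omega
        · rw [cyclesIn_mul_swap_of_notMem (hU b) (by simpa using hb) (by simpa [← hxy] using hb)]
          exact hc b
    have hcut : ∀ x y, x ≠ y → σ.SameCycle x y →
        factCountCons r ν σ β ψ (swap x y) = r ! * ((∏ b ∈ univ.erase (β x), W b) *
          ∑ V ∈ cutSets σ (labelSet β (β x)) x y, ∑ S ∈ (labelSet ψ (β x)).powerset,
            blockWeight ν S (cycleLengths (cyclesIn (σ * swap x y) V)) *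
              blockWeight ν (labelSet ψ (β x) \ S)
                (cycleLengths (cyclesIn (σ * swap x y) (labelSet β (β x) \ V)))) := by
      intro x y hne hs
      have hxU : x ∈ labelSet β (β x) := mem_labelSet.2 rfl
      have hxy : β x = β y := (mem_labelSet.1 (((hU (β x)).mem_iff hs).1 hxU)).symm
      have hUs := (hU (β x)).mul_swap (x := x) (y := y) (by simp [hxy])
      rw [factCountCons_of_sameCycle hν hβ (by omega) hs hne, Finset.mul_sum, Finset.mul_sum]
      refine Finset.sum_congr rfl fun V hV => ?_
      rw [Finset.mul_sum, Finset.mul_sum]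
      refine Finset.sum_congr rfl fun S hS => ?_
      rw [mem_powerset] at hS
      obtain ⟨hVU, hVs, hyV, hxV⟩ := mem_cutSets.1 hV
      -- A component with sheets but no zeros admits no factorization and has weight zero because
      -- its degree is positive. These cases are excluded since the induction hypothesis needs
      -- surjective labellings.
      rcases S.eq_empty_or_nonempty with rfl | hSne
      · rw [blockWeight_eq_zero, zero_mul, mul_zero, mul_zero]
        · refine factCount_eq_zero fun f z hf => ?_
          exact absurd ((hf.mem_iff y).2 hyV) (Finset.notMem_empty _)
        · rw [cycleLengths_sum hVs, Finset.sum_empty]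
          exact (Finset.card_pos.2 ⟨y, hyV⟩).ne'
      by_cases hST : labelSet ψ (β x) ⊆ S
      · rw [Finset.sdiff_eq_empty_iff_subset.2 hST, blockWeight_eq_zero (T := ∅), mul_zero,
          mul_zero, mul_zero]
        · refine factCount_eq_zero fun f z hf => ?_
          have hx := mt (hf.mem_iff x).1 hxV
          have := hf.label x
          simp only [cutLabel, hx, hxV, if_false, Option.some_inj] at this
          exact hx (hST (mem_labelSet.2 this))
        · rw [cycleLengths_sum (hUs.sdiff hVs), Finset.sum_empty]
          exact (Finset.card_pos.2 ⟨x, mem_sdiff.2 ⟨hxU, hxV⟩⟩).ne'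
      obtain ⟨j, hj, hjS⟩ := Finset.not_subset.1 hST
      rw [← totalWeight_cutLabel hσ hxy hVU hS, ih]
      · intro u
        have hu := hVs u
        have hb := label_mul_swap hσ hxy u
        simp only [cutLabel, hu, hb]
      · exact cutLabel_surjective hβ ⟨y, hyV⟩ fun u hu =>
          ⟨x, hxV, (mem_labelSet.1 (hVU hu)).symm⟩
      · exact cutLabel_surjective hψ hSne fun i hi =>
          ⟨j, hjS, (mem_labelSet.1 hj).trans (mem_labelSet.1 (hS hi)).symm⟩
      · rw [card_cyclesIn_mul_swap_of_sameCycle (isCycleUnion_univ σ) (mem_univ x) hs hne,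
          Fintype.card_option]
        omega
      -- The two parts have at most four cycles together and at least one each, so neither has more
      -- than three.
      · have hcard : #(cyclesIn (σ * swap x y) (labelSet β (β x) \ V)) +
            #(cyclesIn (σ * swap x y) V) = #(cyclesIn σ (labelSet β (β x))) + 1 := by
          rw [cyclesIn_sdiff hUs hVs, Finset.card_sdiff_add_card_eq_card (cyclesIn_mono hVU),
            card_cyclesIn_mul_swap_of_sameCycle (hU (β x)) hxU hs hne]
        have h3 := hc (β x)
        have p1 : 0 < #(cyclesIn (σ * swap x y) V) :=
          Finset.card_pos.2 (cyclesIn_nonempty ⟨y, hyV⟩)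
        have p2 : 0 < #(cyclesIn (σ * swap x y) (labelSet β (β x) \ V)) :=
          Finset.card_pos.2 (cyclesIn_nonempty ⟨x, mem_sdiff.2 ⟨hxU, hxV⟩⟩)
        rintro (_ | b)
        · rw [labelSet_cutLabel_none]
          omega
        · by_cases hb : b = β x
          · subst hb
            rw [labelSet_cutLabel_some]
            omega
          · rw [labelSet_cutLabel_some_of_ne hVU hb, cyclesIn_mul_swap_of_notMem (hU b)
              (by simpa using Ne.symm hb) (by simpa [← hxy] using Ne.symm hb)]
            exact hc b
    -- The ordered pairs (x, y) are grouped by the block of x. Only y in the same block contributes,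
    -- and the sum over a block is `blockWeight_recursion`.
    have key : 2 * factCount (r + 1) ν σ β ψ = ∑ b : B, r ! * ((∏ b' ∈ univ.erase b, W b') *
        (2 * ((#(cyclesIn σ (labelSet β b)) : ℚ) + #(labelSet ψ b) - 2) * W b)) := by
      rw [two_mul_factCount_succ, ← Finset.sum_fiberwise_of_maps_to (t := univ) (g := β)
        (fun _ _ => mem_univ _)]
      refine Finset.sum_congr rfl fun b _ => ?_
      rw [← blockWeight_recursion hν (hU b) (labelSet_nonempty hβ b) (hc b)
        (labelSet_nonempty hψ b), Finset.mul_sum, Finset.mul_sum]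
      refine Finset.sum_congr rfl fun x hx => ?_
      have hxb : β x = b := (mem_filter.1 hx).2
      subst hxb
      rw [Finset.mul_sum, Finset.mul_sum]
      refine (Finset.sum_subset (Finset.erase_subset_erase _ (Finset.subset_univ _))
        fun y hy hy' => ?_).symm.trans (Finset.sum_congr rfl fun y hy => ?_)
      · refine factCountCons_eq_zero_of_ne fun h => hy' (mem_erase.2 ⟨(mem_erase.1 hy).1, ?_⟩)
        exact mem_labelSet.2 h.symm
      · obtain ⟨hyx, hyU⟩ := mem_erase.1 hy
        by_cases hs : σ.SameCycle x y
        · rw [if_pos hs, hcut x y hyx.symm hs]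
        · rw [if_neg hs, hjoin x y (mem_labelSet.1 hyU).symm hs]
    -- The numbers of branch points of the blocks add up to r + 1, which turns r! into (r + 1)!.
    have hcount : ∑ b : B, ((#(cyclesIn σ (labelSet β b)) : ℚ) + #(labelSet ψ b) - 2) = r + 1 := by
      rw [Finset.sum_sub_distrib, Finset.sum_add_distrib, ← Nat.cast_sum, ← Nat.cast_sum,
        sum_card_cyclesIn_labelSet hσ, sum_card_labelSet, Finset.sum_const, Finset.card_univ,
        nsmul_eq_mul]
      have : ((r + 1 + 2 * Fintype.card B : ℕ) : ℚ) = (#(cyclesIn σ univ) + Fintype.card J : ℕ) := by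
        rw [hr]
      push_cast at this
      linear_combination -this
    have hterm : ∀ b : B, r ! * ((∏ b' ∈ univ.erase b, W b') *
        (2 * ((#(cyclesIn σ (labelSet β b)) : ℚ) + #(labelSet ψ b) - 2) * W b)) =
        2 * r ! * (∏ b', W b') * ((#(cyclesIn σ (labelSet β b)) : ℚ) + #(labelSet ψ b) - 2) := by
      intro b
      rw [← Finset.prod_erase_mul _ _ (mem_univ b)]
      ring
    rw [Finset.sum_congr rfl fun b _ => hterm b, ← Finset.mul_sum, hcount] at key
    rw [totalWeight, Nat.factorial_succ]
    push_cast
    linear_combination key / 2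

end FactorizationFormula
-- From the kernel to the explicit formula
section ClosedFormula

open Finset

variable {n : ℕ} {ν : Fin n → ℕ} {μ₁ μ₂ μ₃ : ℕ}

theorem cast_partSum (ν : Fin n → ℕ) (J : Finset (Fin n)) :
    (partSum ν J : ℚ) = ∑ j ∈ J, (ν j : ℚ) := by
  rw [partSum, Nat.cast_sum]

/-- The exponents in the formula can be -1; one factor of each of μ₁, μ₂, μ₃ makes all of them
natural numbers. -/
theorem mul_zpow_sub_one_eq {a : ℚ} (ha : a ≠ 0) {e : ℤ} {k : ℕ} (h : e = k - 1) :
    a * a ^ e = a ^ k := by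
  rw [h, zpow_sub_one₀ ha, zpow_natCast]
  field_simp

/-- On the plane x + y + z = 0 the sign of y decides which region can occur. The boundary y = 0 is
assigned to the first region, hence the non-strict inequalities against μ₂ in the formula. -/
theorem threePoleKernel_eq {a b c x y z : ℚ} (h : x + y + z = 0) :
    threePoleKernel a b c x y z =
      (if 0 < z ∧ 0 ≤ y then z * (y * a - x * b) else 0) +
        (if x < 0 ∧ y < 0 then (-x) * (z * b - y * c) else 0) := by
  unfold threePoleKernel
  rcases lt_trichotomy y 0 with hy | rfl | hy
  · by_cases hx : x < 0
    · have hz : 0 < z := by linarith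
      simp [hx, hy, hz, hy.not_gt, hy.not_ge]; ring
    · simp [hx, hy.not_gt, hy.not_ge]
  · by_cases hz : 0 < z
    · have hx : x < 0 := by linarith
      simp [hx, hz]; ring
    · simp [hz]
  · by_cases hz : 0 < z
    · have hx : x < 0 := by linarith
      simp [hx, hy, hz, hy.not_gt, hy.le]; ring
    · simp [hz, hy.not_gt]

theorem mul_closedFormula_eq (hμ₁ : 0 < μ₁) (hμ₂ : 0 < μ₂) (hμ₃ : 0 < μ₃)
    (hd : ∑ j, ν j = μ₁ + μ₂ + μ₃) :
    (μ₁ : ℚ) * μ₂ * μ₃ * (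
      (∑ J : Finset (Fin n) with partSum ν J ≤ μ₂,
        (μ₁ : ℚ) ^ ((n : ℤ) - J.card - 1) * (μ₂ : ℚ) ^ ((J.card : ℤ) - 1) *
          coeffA μ₁ μ₂ μ₃ ν J) +
      (∑ J : Finset (Fin n) with J.Nonempty ∧ partSum ν J < μ₃,
        ((μ₃ : ℚ) - partSum ν J) * (μ₃ : ℚ) ^ ((J.card : ℤ) - 1) *
          ∑ K ∈ Jᶜ.powerset with partSum ν K ≤ μ₂,
            (μ₁ : ℚ) ^ ((n : ℤ) - J.card - K.card - 1) * (μ₂ : ℚ) ^ ((K.card : ℤ) - 1) *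
              coeffB μ₁ μ₂ μ₃ ν J K) +
      (∑ J : Finset (Fin n) with μ₂ < partSum ν J ∧ partSum ν J < μ₂ + μ₃,
        ((μ₂ : ℚ) + μ₃ - partSum ν J) * (μ₁ : ℚ) ^ ((n : ℤ) - J.card - 1) *
          ∑ K ∈ J.powerset with μ₂ + partSum ν K < partSum ν J,
            (μ₂ : ℚ) ^ ((J.card : ℤ) - K.card - 1) * (μ₃ : ℚ) ^ ((K.card : ℤ) - 1) *
              coeffC μ₂ μ₃ ν J K)) =
      threePole (fun j => (ν j : ℚ)) univ μ₁ μ₂ μ₃ := by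
  have h1 : (μ₁ : ℚ) ≠ 0 := by positivity
  have h2 : (μ₂ : ℚ) ≠ 0 := by positivity
  have h3 : (μ₃ : ℚ) ≠ 0 := by positivity
  have hdq : ∑ j, (ν j : ℚ) = μ₁ + μ₂ + μ₃ := by exact_mod_cast hd
  let w : Finset (Fin n) → ℚ := fun J => ∑ j ∈ J, (ν j : ℚ)
  have hw : ∀ J, ∑ j ∈ J, (ν j : ℚ) = w J := fun J => rfl
  have hwc : ∀ {S D : Finset (Fin n)}, S ⊆ D → w (D \ S) = w D - w S := fun h => by
    rw [← hw, Finset.sum_sdiff_eq_sub h]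
  have hwu : ∀ C : Finset (Fin n), w Cᶜ = μ₁ + μ₂ + μ₃ - w C := fun C => by
    rw [Finset.compl_eq_univ_sdiff, hwc (subset_univ C)]
    congr 1
  -- The first region: C becomes J, B becomes K, and A is the rest.
  let F₁ : Finset (Fin n) → Finset (Fin n) → Finset (Fin n) → ℚ := fun A B C =>
    (μ₁ : ℚ) ^ #A * (μ₂ : ℚ) ^ #B * (μ₃ : ℚ) ^ #C * (if 0 < μ₃ - w C ∧ 0 ≤ μ₂ - w B then
      (μ₃ - w C) * ((μ₂ - w B) * μ₁ - (μ₁ - w A) * μ₂) else 0)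
  -- The second region: the complement of A becomes J, and C becomes K.
  let F₂ : Finset (Fin n) → Finset (Fin n) → Finset (Fin n) → ℚ := fun A B C =>
    (μ₁ : ℚ) ^ #A * (μ₂ : ℚ) ^ #B * (μ₃ : ℚ) ^ #C * (if μ₁ - w A < 0 ∧ μ₂ - w B < 0 then
      (-(μ₁ - w A)) * ((μ₃ - w C) * μ₂ - (μ₂ - w B) * μ₃) else 0)
  have hsplit : threePole (fun j => (ν j : ℚ)) univ μ₁ μ₂ μ₃
      = sumTri univ F₁ + sumTri univ F₂ := by
    rw [threePole, ← sumTri_add]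
    refine sumTri_congr _ fun A B C hU hAB hABC => ?_
    rw [threePoleKernel_eq, mul_add]
    rw [← hU, sum_union hABC, sum_union hAB] at hdq
    linarith
  have hF₁ : sumTri univ F₁ = ∑ C, ∑ B ∈ Cᶜ.powerset, F₁ (Cᶜ \ B) B C := by
    rw [← sumTri_swap_left, sumTri_eq_right, Finset.powerset_univ]
    simp only [Finset.compl_eq_univ_sdiff]
  have hF₂ : sumTri univ F₂ = ∑ J, ∑ K ∈ J.powerset, F₂ Jᶜ (J \ K) K := by
    rw [sumTri, Finset.powerset_univ]
    refine (Fintype.sum_equiv (compl_involutive (α := Finset (Fin n))).toPerm _ _ fun J => ?_).symm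
    rw [Function.Involutive.coe_toPerm, ← Finset.compl_eq_univ_sdiff, compl_compl,
      sum_powerset_sdiff_self J (fun B C => F₂ Jᶜ B C)]
  -- The summand of the second sum, now with J = ∅ allowed: there μ₃ cancels against its power -1
  -- and the inner sum becomes the first sum of the formula.
  let G : Finset (Fin n) → ℚ := fun J => if partSum ν J < μ₃ then
    ((μ₃ : ℚ) - partSum ν J) * (μ₃ : ℚ) ^ ((J.card : ℤ) - 1) *
      ∑ K ∈ Jᶜ.powerset with partSum ν K ≤ μ₂,
        (μ₁ : ℚ) ^ ((n : ℤ) - J.card - K.card - 1) * (μ₂ : ℚ) ^ ((K.card : ℤ) - 1) *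
          coeffB μ₁ μ₂ μ₃ ν J K else 0
  have hempty : G ∅ = ∑ J : Finset (Fin n) with partSum ν J ≤ μ₂,
        (μ₁ : ℚ) ^ ((n : ℤ) - J.card - 1) * (μ₂ : ℚ) ^ ((J.card : ℤ) - 1) *
          coeffA μ₁ μ₂ μ₃ ν J := by
    have : partSum ν ∅ = 0 := rfl
    simp only [G, this, hμ₃, if_true, coeffA, coeffB]
    rw [Finset.compl_empty, Finset.powerset_univ]
    simp [h3]
  have hG : (∑ J : Finset (Fin n) with partSum ν J ≤ μ₂,
        (μ₁ : ℚ) ^ ((n : ℤ) - J.card - 1) * (μ₂ : ℚ) ^ ((J.card : ℤ) - 1) *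
          coeffA μ₁ μ₂ μ₃ ν J) +
      (∑ J : Finset (Fin n) with J.Nonempty ∧ partSum ν J < μ₃,
        ((μ₃ : ℚ) - partSum ν J) * (μ₃ : ℚ) ^ ((J.card : ℤ) - 1) *
          ∑ K ∈ Jᶜ.powerset with partSum ν K ≤ μ₂,
            (μ₁ : ℚ) ^ ((n : ℤ) - J.card - K.card - 1) * (μ₂ : ℚ) ^ ((K.card : ℤ) - 1) *
              coeffB μ₁ μ₂ μ₃ ν J K) = ∑ J, G J := by
    rw [← hempty, ← Finset.add_sum_erase univ G (mem_univ ∅), ← Finset.filter_filter,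
      Finset.sum_filter]
    congr 2
    ext J
    simp [Finset.nonempty_iff_ne_empty]
  have hcard : ∀ C : Finset (Fin n), (#Cᶜ : ℤ) = n - #C := fun C => by
    have := Finset.card_add_card_compl C
    rw [Fintype.card_fin] at this
    omega
  have hcard' : ∀ {S D : Finset (Fin n)}, S ⊆ D → (#(D \ S) : ℤ) = #D - #S := fun {S D} h => by
    have := Finset.card_sdiff_add_card_eq_card h
    omega
  rw [hG, hsplit, hF₁, hF₂, mul_add, Finset.mul_sum, Finset.mul_sum, Finset.sum_filter]
  congr 1
  · refine Finset.sum_congr rfl fun C _ => ?_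
    have hcC : partSum ν C < μ₃ ↔ 0 < μ₃ - w C := by
      rw [sub_pos, ← hw, ← cast_partSum, Nat.cast_lt]
    by_cases hC : partSum ν C < μ₃
    swap
    · rw [hcC] at hC
      rw [Finset.sum_eq_zero fun B _ => ?_]
      · simp only [G, hcC, hC, if_false, mul_zero]
      · simp only [F₁, hC, false_and, if_false, mul_zero]
    simp only [G, hC, if_true]
    rw [Finset.mul_sum, Finset.mul_sum, Finset.sum_filter]
    refine Finset.sum_congr rfl fun B hB => ?_
    rw [mem_powerset] at hB
    have hcB : partSum ν B ≤ μ₂ ↔ 0 ≤ μ₂ - w B := by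
      rw [sub_nonneg, ← hw, ← cast_partSum, Nat.cast_le]
    simp only [F₁, ← hcC, hC, ← hcB, true_and]
    split_ifs with hb
    swap
    · simp
    have e1 := mul_zpow_sub_one_eq h1 (e := (n : ℤ) - #C - #B - 1) (k := #(Cᶜ \ B))
      (by rw [hcard' hB, hcard])
    have e2 := mul_zpow_sub_one_eq h2 (e := (#B : ℤ) - 1) rfl
    have e3 := mul_zpow_sub_one_eq h3 (e := (#C : ℤ) - 1) rfl
    rw [← e1, ← e2, ← e3, hwc hB, hwu, coeffB, cast_partSum, cast_partSum, hw, hw]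
    ring
  · refine Finset.sum_congr rfl fun J _ => ?_
    have hcJ : partSum ν J < μ₂ + μ₃ ↔ (μ₁ : ℚ) - w Jᶜ < 0 := by
      have : (partSum ν J : ℚ) < ((μ₂ + μ₃ : ℕ) : ℚ) ↔ _ := Nat.cast_lt
      rw [← this, cast_partSum, hw, hwu, Nat.cast_add]
      constructor <;> intro h <;> linarith
    by_cases hJ : partSum ν J < μ₂ + μ₃
    swap
    · rw [if_neg fun h => hJ h.2]
      rw [hcJ] at hJ
      refine (Finset.sum_eq_zero fun B _ => ?_).symm
      simp only [F₂, hJ, false_and, if_false, mul_zero]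
    have hcK : ∀ K ⊆ J, (μ₂ + partSum ν K < partSum ν J ↔ (μ₂ : ℚ) - w (J \ K) < 0) := by
      intro K hK
      have : ((μ₂ + partSum ν K : ℕ) : ℚ) < (partSum ν J : ℚ) ↔ _ := Nat.cast_lt
      rw [← this, Nat.cast_add, cast_partSum, cast_partSum, hw, hw, hwc hK]
      constructor <;> intro h <;> linarith
    -- This bound on J is redundant: without it no K satisfies the inner condition.
    by_cases hJ' : μ₂ < partSum ν J
    swap
    · rw [if_neg fun h => hJ' h.1]
      refine (Finset.sum_eq_zero fun K hK => ?_).symm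
      rw [mem_powerset] at hK
      have : ¬ (μ₂ : ℚ) - w (J \ K) < 0 := by
        rw [← hcK K hK]
        omega
      simp only [F₂, this, and_false, if_false, mul_zero]
    rw [if_pos ⟨hJ', hJ⟩, Finset.mul_sum, Finset.mul_sum, Finset.sum_filter]
    refine Finset.sum_congr rfl fun K hK => ?_
    rw [mem_powerset] at hK
    simp only [F₂, ← hcJ, hJ, ← hcK K hK, true_and]
    split_ifs
    swap
    · simp
    have e1 := mul_zpow_sub_one_eq h1 (e := (n : ℤ) - #J - 1) (k := #Jᶜ) (by rw [hcard])
    have e2 := mul_zpow_sub_one_eq h2 (e := (#J : ℤ) - #K - 1) (k := #(J \ K))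
      (by rw [hcard' hK])
    have e3 := mul_zpow_sub_one_eq h3 (e := (#K : ℤ) - 1) rfl
    rw [← e1, ← e2, ← e3, hwc hK, hwu, coeffC, cast_partSum, cast_partSum, hw, hw]
    ring

end ClosedFormula
-- Counting permutations with labelled cycles
section CycleLabelling

open Finset Equiv Equiv.Perm

variable {X I : Type*} [Fintype X] [DecidableEq X] [Fintype I] [DecidableEq I]
  {σ : Perm X} {p : X → I} {μ : I → ℕ}

/-- `p` labels the cycles of `σ`, and the cycle with label `i` has length `μ i`. -/
structure IsCycleLabelling (μ : I → ℕ) (σ : Perm X) (p : X → I) : Prop where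
  eq_iff : ∀ x y, p x = p y ↔ σ.SameCycle x y
  mult : ∀ i, #(labelSet p i) = μ i

theorem val_finRotate_of_lt {k m : ℕ} (h : k + 1 < m) :
    finRotate m ⟨k, by omega⟩ = ⟨k + 1, h⟩ := by
  obtain ⟨m, rfl⟩ : ∃ m', m = m' + 1 := ⟨m - 1, by omega⟩
  exact finRotate_of_lt (by omega)

theorem val_finRotate_of_eq {k m : ℕ} (h : k + 1 = m) :
    finRotate m ⟨k, by omega⟩ = ⟨0, by omega⟩ := by
  subst h
  exact finRotate_last'

/-- The permutation whose cycles are numbered by `e`. -/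
def sigmaRotation (e : (Σ i, Fin (μ i)) ≃ X) : Perm X :=
  e.permCongr (Equiv.sigmaCongrRight fun i => finRotate (μ i))

omit [Fintype X] [DecidableEq X] [Fintype I] [DecidableEq I] in
theorem sigmaRotation_apply (e : (Σ i, Fin (μ i)) ≃ X) (i : I) (k : Fin (μ i)) :
    sigmaRotation e (e ⟨i, k⟩) = e ⟨i, finRotate _ k⟩ := by
  simp [sigmaRotation, Equiv.permCongr_apply]

omit [Fintype X] [DecidableEq X] [Fintype I] [DecidableEq I] in
theorem sigmaRotation_pow_apply (e : (Σ i, Fin (μ i)) ≃ X) (i : I) {k : ℕ} (hk : k < μ i) :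
    (sigmaRotation e ^ k) (e ⟨i, ⟨0, by omega⟩⟩) = e ⟨i, ⟨k, hk⟩⟩ := by
  induction k with
  | zero => rfl
  | succ k ih =>
    rw [pow_succ', Perm.mul_apply, ih (by omega), sigmaRotation_apply, val_finRotate_of_lt hk]

omit [DecidableEq X] [Fintype I] in
theorem isCycleLabelling_sigmaRotation (e : (Σ i, Fin (μ i)) ≃ X) :
    IsCycleLabelling μ (sigmaRotation e) fun x => (e.symm x).1 := by
  have hinv : ∀ x, (e.symm (sigmaRotation e x)).1 = (e.symm x).1 := fun x => by
    obtain ⟨⟨i, k⟩, rfl⟩ := e.surjective x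
    rw [sigmaRotation_apply, e.symm_apply_apply, e.symm_apply_apply]
  constructor
  · intro x y
    constructor
    · obtain ⟨⟨i, k, hk⟩, rfl⟩ := e.surjective x
      obtain ⟨⟨j, l, hl⟩, rfl⟩ := e.surjective y
      intro h
      rw [e.symm_apply_apply, e.symm_apply_apply] at h
      obtain rfl : i = j := h
      rw [← sigmaRotation_pow_apply e i hk, ← sigmaRotation_pow_apply e i hl, sameCycle_pow_left,
        sameCycle_pow_right]
    · intro h
      have := (isCycleUnion_labelSet (β := fun x => (e.symm x).1) hinv (e.symm x).1).mem_iff h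
      rw [mem_labelSet, mem_labelSet] at this
      exact (this.1 rfl).symm
  · intro i
    rw [← Fintype.card_fin (μ i), ← Finset.card_univ, eq_comm]
    refine Finset.card_nbij (fun k => e ⟨i, k⟩) (fun k _ => by simp) ?_ ?_
    · intro k _ l _ h
      simpa using h
    · intro x hx
      obtain ⟨⟨j, k⟩, rfl⟩ := e.surjective x
      have : j = i := by simpa using hx
      subst this
      exact ⟨k, by simp, rfl⟩

/-- A base point in every cycle numbers the whole cycle, by applying powers of σ to it. -/
theorem IsCycleLabelling.exists_sigmaRotation (h : IsCycleLabelling μ σ p)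
    (hX : Fintype.card X = ∑ i, μ i) {b : I → X} (hb : ∀ i, p (b i) = i) :
    ∃ e : (Σ i, Fin (μ i)) ≃ X, sigmaRotation e = σ ∧ (∀ x, (e.symm x).1 = p x) ∧
      ∀ i (k : Fin (μ i)), (k : ℕ) = 0 → e ⟨i, k⟩ = b i := by
  have hcyc : ∀ i, cycleSet σ (b i) = labelSet p i := fun i => by
    ext y
    rw [mem_cycleSet, mem_labelSet, ← h.eq_iff, hb, eq_comm]
  have hon : ∀ i, σ.IsCycleOn (cycleSet σ (b i) : Set X) := fun i => isCycleOn_cycleSet _ _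
  have hlen : ∀ i, #(cycleSet σ (b i)) = μ i := fun i => by rw [hcyc, h.mult]
  let g : (Σ i, Fin (μ i)) → X := fun q => (σ ^ (q.2 : ℕ)) (b q.1)
  have hpg : ∀ q, p (g q) = q.1 := fun q => by
    refine Eq.trans ((h.eq_iff _ _).2 ?_) (hb q.1)
    rw [sameCycle_pow_left]
  have hg : Function.Bijective g := by
    rw [Fintype.bijective_iff_injective_and_card]
    constructor
    · rintro ⟨i, k⟩ ⟨j, l⟩ hq
      obtain rfl : i = j := (hpg ⟨i, k⟩).symm.trans ((congrArg p hq).trans (hpg ⟨j, l⟩))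
      have := ((hon i).pow_apply_eq_pow_apply self_mem_cycleSet).1 hq
      rw [hlen] at this
      have hkl : k = l := Fin.ext (Nat.ModEq.eq_of_lt_of_lt this k.2 l.2)
      rw [hkl]
    · rw [hX, Fintype.card_sigma]; simp
  refine ⟨Equiv.ofBijective g hg, ?_, fun x => ?_, fun i k hk => ?_⟩
  · ext x
    obtain ⟨⟨i, k, hk⟩, rfl⟩ := (Equiv.ofBijective g hg).surjective x
    rw [sigmaRotation_apply]
    rcases Nat.lt_or_ge (k + 1) (μ i) with hlt | hge
    · rw [val_finRotate_of_lt hlt]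
      simp only [Equiv.ofBijective_apply, g]
      rw [pow_succ', Perm.mul_apply]
    · rw [val_finRotate_of_eq (by omega)]
      simp only [Equiv.ofBijective_apply, g]
      rw [← Perm.mul_apply, ← pow_succ', show k + 1 = #(cycleSet σ (b i)) by rw [hlen]; omega,
        (hon i).pow_card_apply self_mem_cycleSet]
      rfl
  · obtain ⟨q, rfl⟩ := (Equiv.ofBijective g hg).surjective x
    rw [Equiv.symm_apply_apply, Equiv.ofBijective_apply, hpg]
  · change (σ ^ (k : ℕ)) (b i) = b i
    rw [hk]
    rfl

open Classical in
/-- The number of permutations with labelled cycles of given lengths. -/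
theorem sum_isCycleLabelling_mul (hX : Fintype.card X = ∑ i, μ i) (hμ : ∀ i, 0 < μ i) :
    (∑ σ : Perm X, ∑ p : X → I, if IsCycleLabelling μ σ p then 1 else 0) * ∏ i, μ i
      = (Fintype.card X)! := by
  have hE : Fintype.card ((Σ i, Fin (μ i)) ≃ X) = (Fintype.card X)! := by
    have e : X ≃ Σ i, Fin (μ i) := Fintype.equivOfCardEq (by rw [hX, Fintype.card_sigma]; simp)
    rw [Fintype.card_equiv e.symm, Fintype.card_congr e.symm]
  -- The factor ∏ μ i counts the choices of a base point in each cycle; a labelled permutation with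
  -- base points is the same as a bijection from Σ i, Fin (μ i) to X, and there are d! of these for
  -- d = `Fintype.card X`.
  have hsum : (∑ σ : Perm X, ∑ p : X → I, if IsCycleLabelling μ σ p then 1 else 0) * ∏ i, μ i
      = #{t : Perm X × (X → I) × (I → X) | IsCycleLabelling μ t.1 t.2.1 ∧
        ∀ i, t.2.1 (t.2.2 i) = i} := by
    rw [Finset.card_filter, Fintype.sum_prod_type, Finset.sum_mul]
    refine Finset.sum_congr rfl fun σ _ => ?_
    rw [Fintype.sum_prod_type, Finset.sum_mul]
    refine Finset.sum_congr rfl fun p _ => ?_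
    by_cases h : IsCycleLabelling μ σ p
    · simp only [h, if_true, true_and, one_mul]
      rw [← Finset.prod_congr rfl fun i _ => h.mult i, ← Fintype.card_piFinset,
        ← Finset.card_filter]
      congr 1
      ext b
      simp
    · simp [h]
  rw [hsum, ← hE, ← Finset.card_univ, eq_comm]
  refine Finset.card_nbij
    (fun e => (sigmaRotation e, (fun x => (e.symm x).1), fun i => e ⟨i, ⟨0, hμ i⟩⟩)) ?_ ?_ ?_
  · intro e _
    simpa using isCycleLabelling_sigmaRotation e
  · intro e _ e' _ h
    simp only [Prod.mk.injEq] at h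
    obtain ⟨h1, -, h3⟩ := h
    ext ⟨i, k, hk⟩
    rw [← sigmaRotation_pow_apply e i hk, ← sigmaRotation_pow_apply e' i hk, h1]
    exact congrArg _ (congrFun h3 i)
  · rintro ⟨σ, p, b⟩ ht
    simp only [coe_filter, mem_univ, true_and, Set.mem_ofPred_eq] at ht
    obtain ⟨e, h1, h2, h3⟩ := ht.1.exists_sigmaRotation hX ht.2
    refine ⟨e, by simp, ?_⟩
    simp only [h1, h2, Prod.mk.injEq, true_and]
    funext i
    exact h3 i _ rfl

end CycleLabelling

/-! ### Renumbering of sheets and orbit–stabilizer -/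

namespace LabelledCover

open Finset Equiv Equiv.Perm

variable {m n d r : ℕ} {μ : Fin m → ℕ} {ν : Fin n → ℕ}

/-- The cover obtained by renumbering the sheets. -/
def transport (π : Perm (Fin d)) (c : LabelledCover d r μ ν) : LabelledCover d r μ ν where
  monoInfty := π * c.monoInfty * π⁻¹
  mono k := π * c.mono k * π⁻¹
  monoZero := π * c.monoZero * π⁻¹
  prod_eq_one := by
    have : (List.ofFn fun k => π * c.mono k * π⁻¹).prod = π * (List.ofFn c.mono).prod * π⁻¹ := by
      have := map_list_prod (MulAut.conj π) (List.ofFn c.mono)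
      rw [List.map_ofFn, MulAut.conj_apply] at this
      exact this.symm
    rw [this]
    calc _ = π * (c.monoInfty * (List.ofFn c.mono).prod * c.monoZero) * π⁻¹ := by group
      _ = 1 := by rw [c.prod_eq_one]; group
  simple k := by
    obtain ⟨x, y, hxy, h⟩ := c.simple k
    exact ⟨π x, π y, fun e => hxy (π.injective e), by rw [h, Equiv.swap_apply_apply]⟩
  connected x y := by
    obtain ⟨g, hg, h⟩ := c.connected (π⁻¹ x) (π⁻¹ y)
    refine ⟨π * g * π⁻¹, ?_, by rw [Perm.mul_apply, Perm.mul_apply, h, ← Perm.mul_apply, mul_inv_cancel,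
      Perm.one_apply]⟩
    have := Subgroup.mem_map_of_mem (MulAut.conj π).toMonoidHom hg
    rw [MonoidHom.map_closure, Set.image_insert_eq, Set.image_insert_eq, ← Set.range_comp] at this
    exact this
  pole x := c.pole (π⁻¹ x)
  pole_eq_iff x y := by rw [c.pole_eq_iff, sameCycle_conj]
  pole_mult i := by
    rw [← c.pole_mult i]
    exact Nat.card_congr (π⁻¹.subtypeEquiv fun _ => Iff.rfl)
  zero x := c.zero (π⁻¹ x)
  zero_eq_iff x y := by rw [c.zero_eq_iff, sameCycle_conj]
  zero_mult i := by
    rw [← c.zero_mult i]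
    exact Nat.card_congr (π⁻¹.subtypeEquiv fun _ => Iff.rfl)

theorem isIso_iff_transport_eq {π : Perm (Fin d)} {c c' : LabelledCover d r μ ν} :
    IsIso π c c' ↔ transport π c = c' := by
  constructor
  · intro h
    obtain ⟨s', f', t', _, _, _, p', _, _, q', _, _⟩ := c'
    have h1 := h.monoInfty
    have h2 := h.mono
    have h3 := h.monoZero
    have h4 := h.pole
    have h5 := h.zero
    simp only at h1 h2 h3 h4 h5
    obtain rfl : π * c.monoInfty * π⁻¹ = s' := by ext x; simp [h1]
    obtain rfl : (fun k => π * c.mono k * π⁻¹) = f' := by funext k; ext x; simp [h2]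
    obtain rfl : π * c.monoZero * π⁻¹ = t' := by ext x; simp [h3]
    obtain rfl : (fun x => c.pole (π⁻¹ x)) = p' := by funext x; simp [← h4]
    obtain rfl : (fun x => c.zero (π⁻¹ x)) = q' := by funext x; simp [← h5]
    rfl
  · rintro rfl
    constructor <;> simp [transport]

theorem IsIso.trans {π ρ : Perm (Fin d)} {c c' c'' : LabelledCover d r μ ν} (h : IsIso π c c')
    (k : IsIso ρ c' c'') : IsIso (ρ * π) c c'' where
  monoInfty x := by simp [h.monoInfty, k.monoInfty]
  mono i x := by simp [h.mono, k.mono]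
  monoZero x := by simp [h.monoZero, k.monoZero]
  pole x := by simp [h.pole, k.pole]
  zero x := by simp [h.zero, k.zero]

theorem IsIso.symm {π : Perm (Fin d)} {c c' : LabelledCover d r μ ν} (h : IsIso π c c') :
    IsIso π⁻¹ c' c where
  monoInfty x := by apply π.injective; simp [h.monoInfty]
  mono i x := by apply π.injective; simp [h.mono]
  monoZero x := by apply π.injective; simp [h.monoZero]
  pole x := by rw [← h.pole]; simp
  zero x := by rw [← h.zero]; simp

/-- The orbit-stabilizer theorem for the renumberings of the sheets of a cover. -/
theorem card_class_mul_autCard (c : LabelledCover d r μ ν) :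
    Nat.card {c' // ∃ π, IsIso π c c'} * c.autCard = d ! := by
  -- With one isomorphism ρ chosen from c to each cover of its class, every renumbering is uniquely
  -- some ρ composed with an automorphism of c.
  choose ρ hρ using fun q : {c' // ∃ π, IsIso π c c'} => q.2
  have hf : Function.Bijective fun q : {c' // ∃ π, IsIso π c c'} ×
      {π : Perm (Fin d) // IsIso π c c} => ρ q.1 * q.2.1 := by
    constructor
    · rintro ⟨q, a⟩ ⟨q', a'⟩ h
      have key : ∀ (q : {c' // ∃ π, IsIso π c c'}) (a : {π : Perm (Fin d) // IsIso π c c}),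
          transport (ρ q * a.1) c = q.1 := fun q a => isIso_iff_transport_eq.1 (a.2.trans (hρ q))
      simp only at h
      obtain rfl : q = q' := Subtype.ext (by rw [← key q a, h, key])
      rw [Subtype.ext (mul_left_cancel h)]
    · intro π
      have hπ : IsIso π c (transport π c) := isIso_iff_transport_eq.2 rfl
      exact ⟨(⟨_, π, hπ⟩, ⟨(ρ ⟨_, π, hπ⟩)⁻¹ * π, hπ.trans (hρ ⟨_, π, hπ⟩).symm⟩),
        mul_inv_cancel_left _ _⟩
  rw [autCard, ← Nat.card_prod, Nat.card_congr (Equiv.ofBijective _ hf), Nat.card_perm,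
    Nat.card_fin]

end LabelledCover
-- From covers to factorizations
namespace LabelledCover

open Finset Equiv Equiv.Perm

variable {m n d r : ℕ} {μ : Fin m → ℕ} {ν : Fin n → ℕ}

/-- The weighted number of classes of covers is the number of covers divided by `d!`. -/
theorem finsum_one_div_autCard (d r : ℕ) (μ : Fin m → ℕ) (ν : Fin n → ℕ) :
    ∑ᶠ q : Quotient (LabelledCover.setoid d r μ ν), (1 : ℚ) / (Quotient.out q).autCard
      = (Nat.card (LabelledCover d r μ ν) : ℚ) / d ! := by
  classical
  have : Fintype (LabelledCover d r μ ν) := Fintype.ofFinite _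
  rw [finsum_eq_sum_of_fintype, eq_div_iff (by positivity), Finset.sum_mul]
  have key : ∀ q : Quotient (LabelledCover.setoid d r μ ν),
      (1 : ℚ) / (Quotient.out q).autCard * d ! =
        (Nat.card {c : LabelledCover d r μ ν // Quotient.mk _ c = q} : ℕ) := by
    intro q
    have h := card_class_mul_autCard (Quotient.out q)
    have h0 : ((Quotient.out q).autCard : ℚ) ≠ 0 := by
      rw [Nat.cast_ne_zero]
      rintro h'
      rw [h', mul_zero] at h
      exact d.factorial_ne_zero h.symm
    have hc : Nat.card {c : LabelledCover d r μ ν // Quotient.mk _ c = q}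
        = Nat.card {c' // ∃ π, IsIso π (Quotient.out q) c'} := by
      refine Nat.card_congr (Equiv.subtypeEquivRight fun c => ?_)
      rw [eq_comm]
      exact Quotient.eq_mk_iff_out
    rw [hc, ← h]
    push_cast
    field_simp
  rw [Finset.sum_congr rfl fun q _ => key q, ← Nat.cast_sum, ← Nat.card_sigma,
    Nat.card_congr (Equiv.sigmaFiberEquiv _)]

/-- The factorization data of a cover. -/
def data (c : LabelledCover d r μ ν) :
    (Perm (Fin d) × (Fin d → Fin m)) × (Fin r → Perm (Fin d)) × (Fin d → Fin n) :=
  ((c.monoInfty, c.pole), c.mono, c.zero)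

theorem card_labelSet_eq (p : Fin d → Fin m) (i : Fin m) :
    #(labelSet p i) = Nat.card {x // p x = i} := by
  rw [Nat.card_eq_fintype_card, Fintype.card_subtype]; rfl

theorem monoZero_eq (c : LabelledCover d r μ ν) :
    c.monoZero = (c.monoInfty * (List.ofFn c.mono).prod)⁻¹ :=
  eq_inv_of_mul_eq_one_right c.prod_eq_one

theorem mul_prod_mem_closure (σ : Perm (Fin d)) (f : Fin r → Perm (Fin d)) :
    σ * (List.ofFn f).prod ∈ Subgroup.closure (insert σ (Set.range f)) := by
  refine mul_mem (Subgroup.subset_closure (Set.mem_insert _ _))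
    (list_prod_mem fun g hg => Subgroup.subset_closure (Set.mem_insert_of_mem _ ?_))
  rwa [List.mem_ofFn'] at hg

/-- The monodromy at 0 is the inverse of the product of the others: it is redundant both as datum
and as generator, and has the same cycles as that product. Connectedness means a single block, hence
the constant labels. -/
theorem data_bijOn : Set.BijOn (data (μ := μ) (ν := ν)) Set.univ
    {t : (Perm (Fin d) × (Fin d → Fin m)) × (Fin r → Perm (Fin d)) × (Fin d → Fin n) |
      IsCycleLabelling μ t.1.1 t.1.2 ∧
      IsFactorization ν t.1.1 (fun _ => ()) (fun _ => ()) t.2.1 t.2.2} := by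
  refine ⟨fun c _ => ⟨⟨c.pole_eq_iff, fun i => ?_⟩, c.simple, fun x y => ?_, fun j => ?_,
    fun x y => ?_, fun _ => rfl⟩, fun c _ c' _ h => ?_, ?_⟩
  · exact (card_labelSet_eq _ _).trans (c.pole_mult i)
  · rw [← sameCycle_inv]
    exact (c.zero_eq_iff x y).trans (by rw [monoZero_eq]; rfl)
  · exact (card_labelSet_eq _ _).trans (c.zero_mult j)
  · simp only [iff_true]
    obtain ⟨g, hg, hgx⟩ := c.connected x y
    refine ⟨g, ?_, hgx⟩
    refine (Subgroup.closure_le _).2 ?_ hg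
    rintro g (rfl | rfl | hg)
    · exact Subgroup.subset_closure (Set.mem_insert _ _)
    · rw [monoZero_eq]
      exact inv_mem (mul_prod_mem_closure _ _)
    · exact Subgroup.subset_closure (Set.mem_insert_of_mem _ hg)
  · have h1 := monoZero_eq c
    have h2 := monoZero_eq c'
    obtain ⟨s, f, t, _, _, _, p, _, _, q, _, _⟩ := c
    obtain ⟨s', f', t', _, _, _, p', _, _, q', _, _⟩ := c'
    simp only [data, Prod.mk.injEq] at h h1 h2
    obtain ⟨⟨rfl, rfl⟩, rfl, rfl⟩ := h
    obtain rfl := h1.trans h2.symm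
    rfl
  · rintro ⟨⟨s, p⟩, f, q⟩ ⟨h1, h2⟩
    refine ⟨⟨s, f, (s * (List.ofFn f).prod)⁻¹, mul_inv_cancel _, h2.isSwap, fun x y => ?_, p,
      h1.eq_iff, fun i => ?_, q, fun x y => ?_, fun j => ?_⟩, Set.mem_univ _, rfl⟩
    · obtain ⟨g, hg, hgx⟩ := (h2.orbit_iff x y).2 rfl
      exact ⟨g, Subgroup.closure_mono (Set.insert_subset_insert (Set.subset_insert _ _)) hg, hgx⟩
    · exact (card_labelSet_eq _ _).symm.trans (h1.mult i)
    · rw [sameCycle_inv]; exact h2.zero_eq_iff x y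
    · exact (card_labelSet_eq _ _).symm.trans (h2.zero_mult j)

open Classical in
theorem card_eq_sum_factCount (d r : ℕ) (μ : Fin m → ℕ) (ν : Fin n → ℕ) :
    (Nat.card (LabelledCover d r μ ν) : ℚ) = ∑ σ : Perm (Fin d), ∑ p : Fin d → Fin m,
      if IsCycleLabelling μ σ p then factCount r ν σ (fun _ => ()) (fun _ => ()) else 0 := by
  rw [← Nat.card_univ, Nat.card_congr (data_bijOn (d := d) (r := r) (μ := μ) (ν := ν)).equiv,
    Set.coe_ofPred, Nat.card_eq_fintype_card, Fintype.card_subtype, Finset.card_filter,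
    Fintype.sum_prod_type, Fintype.sum_prod_type]
  push_cast
  refine Finset.sum_congr rfl fun σ _ => Finset.sum_congr rfl fun p _ => ?_
  rw [Fintype.sum_prod_type]
  by_cases h : IsCycleLabelling μ σ p
  · simp only [h, true_and, if_true, factCount]
  · simp [h]

end LabelledCover

/-! ### Connected covers with three poles -/

open Finset Equiv Equiv.Perm in
theorem factCount_of_isCycleLabelling {n d μ₁ μ₂ μ₃ : ℕ} {ν : Fin n → ℕ}
    (hμ₁ : 0 < μ₁) (hμ₂ : 0 < μ₂) (hμ₃ : 0 < μ₃) (hν : ∀ j, 0 < ν j)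
    (hd : ∑ j, ν j = μ₁ + μ₂ + μ₃) (hdd : d = μ₁ + μ₂ + μ₃) {σ : Perm (Fin d)}
    {p : Fin d → Fin 3} (h : IsCycleLabelling ![μ₁, μ₂, μ₃] σ p) :
    factCount (n + 1) ν σ (fun _ => ()) (fun _ => ()) =
      (n + 1)! * threePole (fun j => (ν j : ℚ)) univ μ₁ μ₂ μ₃ := by
  have : NeZero d := ⟨by omega⟩
  have hn : Nonempty (Fin n) := by
    rw [← Finset.univ_nonempty_iff, ← sum_pos_iff_nonempty hν, hd]
    omega
  have hp : Function.Surjective p := fun i => by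
    have : (labelSet p i).Nonempty := by
      rw [← Finset.card_pos, h.mult]
      fin_cases i <;> simpa
    obtain ⟨x, hx⟩ := this
    exact ⟨x, mem_labelSet.1 hx⟩
  have hβ : ∀ {α : Type} [Fintype α], labelSet (fun _ : α => ()) () = univ := by
    intro α _; ext; simp
  have hcard := card_cyclesIn_univ_eq h.eq_iff hp
  have hsurj : ∀ {α : Type} [Nonempty α], Function.Surjective (fun _ : α => ()) :=
    fun {α} _ _ => ⟨Classical.arbitrary α, rfl⟩
  rw [factCount_eq hν (fun _ => rfl) hsurj hsurj]
  · rw [totalWeight, Fintype.prod_unique]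
    change _ * blockWeight ν (labelSet _ ()) (cycleLengths (cyclesIn σ (labelSet _ ()))) = _
    rw [hβ, hβ, cycleLengths_univ_eq h.eq_iff hp]
    simp only [h.mult]
    rw [show (univ : Finset (Fin 3)).val.map ![μ₁, μ₂, μ₃] = μ₁ ::ₘ μ₂ ::ₘ {μ₃} from rfl,
      blockWeight_three hμ₁ hμ₂ hμ₃, if_pos hd.symm]
  · rw [hcard]; simp; omega
  · intro b
    rw [show b = () from rfl, hβ, hcard]; simp

/-- Each of the N labelled permutations at infinity admits (n + 1)! times `threePole`
factorizations. Since N μ₁ μ₂ μ₃ = d!, dividing by d! cancels N. -/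
theorem doubleHurwitz_three (n μ₁ μ₂ μ₃ : ℕ) (ν : Fin n → ℕ)
    (hμ₁ : 0 < μ₁) (hμ₂ : 0 < μ₂) (hμ₃ : 0 < μ₃) (hν : ∀ j, 0 < ν j)
    (hd : ∑ j, ν j = μ₁ + μ₂ + μ₃) :
    (μ₁ : ℚ) * μ₂ * μ₃ * (doubleHurwitz 0 ![μ₁, μ₂, μ₃] ν / ((n + 1)! : ℚ)) =
      threePole (fun j => (ν j : ℚ)) Finset.univ μ₁ μ₂ μ₃ := by
  classical
  have hμ : ∑ i, ![μ₁, μ₂, μ₃] i = μ₁ + μ₂ + μ₃ := Fin.sum_univ_three _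
  have hcount := sum_isCycleLabelling_mul (X := Fin (∑ i, ![μ₁, μ₂, μ₃] i))
    (μ := ![μ₁, μ₂, μ₃]) (Fintype.card_fin _) (fun i => by fin_cases i <;> simpa)
  rw [Fin.prod_univ_three, Fintype.card_fin] at hcount
  have hcard := LabelledCover.card_eq_sum_factCount (∑ i, ![μ₁, μ₂, μ₃] i) (n + 1)
    ![μ₁, μ₂, μ₃] ν
  rw [doubleHurwitz, LabelledCover.finsum_one_div_autCard,
    show 3 + n + 2 * 0 - 2 = n + 1 by omega, hcard, ← hcount]
  have hsum : (∑ σ : Equiv.Perm (Fin (∑ i, ![μ₁, μ₂, μ₃] i)),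
      ∑ p : Fin (∑ i, ![μ₁, μ₂, μ₃] i) → Fin 3,
        if IsCycleLabelling ![μ₁, μ₂, μ₃] σ p then
          factCount (n + 1) ν σ (fun _ => ()) (fun _ => ()) else 0) =
      (∑ σ : Equiv.Perm (Fin (∑ i, ![μ₁, μ₂, μ₃] i)),
        ∑ p : Fin (∑ i, ![μ₁, μ₂, μ₃] i) → Fin 3,
          if IsCycleLabelling ![μ₁, μ₂, μ₃] σ p then 1 else 0 : ℕ) *
        ((n + 1)! * threePole (fun j => (ν j : ℚ)) Finset.univ μ₁ μ₂ μ₃) := by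
    push_cast
    rw [Finset.sum_mul]
    refine Finset.sum_congr rfl fun σ _ => ?_
    rw [Finset.sum_mul]
    refine Finset.sum_congr rfl fun p _ => ?_
    split_ifs with h
    · rw [one_mul, factCount_of_isCycleLabelling hμ₁ hμ₂ hμ₃ hν hd hμ h]
    · rw [zero_mul]
  rw [hsum]
  have hne : ((∑ σ : Equiv.Perm (Fin (∑ i, ![μ₁, μ₂, μ₃] i)),
        ∑ p : Fin (∑ i, ![μ₁, μ₂, μ₃] i) → Fin 3,
          if IsCycleLabelling ![μ₁, μ₂, μ₃] σ p then 1 else 0 : ℕ) : ℚ) ≠ 0 := by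
    rw [Nat.cast_ne_zero]
    intro h0
    rw [h0, zero_mul] at hcount
    exact (Nat.factorial_ne_zero _) hcount.symm
  have h1 : (μ₁ : ℚ) ≠ 0 := by positivity
  have h2 : (μ₂ : ℚ) ≠ 0 := by positivity
  have h3 : (μ₃ : ℚ) ≠ 0 := by positivity
  have h4 : ((n + 1)! : ℚ) ≠ 0 := by positivity
  generalize (∑ σ : Equiv.Perm (Fin (∑ i, ![μ₁, μ₂, μ₃] i)),
        ∑ p : Fin (∑ i, ![μ₁, μ₂, μ₃] i) → Fin 3,
          if IsCycleLabelling ![μ₁, μ₂, μ₃] σ p then 1 else 0 : ℕ) = N at hne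
  rw [Nat.cast_mul, Nat.cast_mul, Nat.cast_mul]
  change (μ₁ : ℚ) * μ₂ * μ₃ * (N * _ / (N * (μ₁ * μ₂ * μ₃)) / _) = _
  field_simp

theorem corollary2p3 (n μ₁ μ₂ μ₃ : ℕ) (ν : Fin n → ℕ)
    (hμ₁ : 0 < μ₁) (hμ₂ : 0 < μ₂) (hμ₃ : 0 < μ₃) (hν : ∀ j, 0 < ν j)
    (hd : ∑ j, ν j = μ₁ + μ₂ + μ₃) :
    doubleHurwitz 0 ![μ₁, μ₂, μ₃] ν / ((n + 1)! : ℚ) =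
      (∑ J : Finset (Fin n) with partSum ν J ≤ μ₂,
        (μ₁ : ℚ) ^ ((n : ℤ) - J.card - 1) * (μ₂ : ℚ) ^ ((J.card : ℤ) - 1) *
          coeffA μ₁ μ₂ μ₃ ν J) +
      (∑ J : Finset (Fin n) with J.Nonempty ∧ partSum ν J < μ₃,
        ((μ₃ : ℚ) - partSum ν J) * (μ₃ : ℚ) ^ ((J.card : ℤ) - 1) *
          ∑ K ∈ Jᶜ.powerset with partSum ν K ≤ μ₂,
            (μ₁ : ℚ) ^ ((n : ℤ) - J.card - K.card - 1) * (μ₂ : ℚ) ^ ((K.card : ℤ) - 1) *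
              coeffB μ₁ μ₂ μ₃ ν J K) +
      (∑ J : Finset (Fin n) with μ₂ < partSum ν J ∧ partSum ν J < μ₂ + μ₃,
        ((μ₂ : ℚ) + μ₃ - partSum ν J) * (μ₁ : ℚ) ^ ((n : ℤ) - J.card - 1) *
          ∑ K ∈ J.powerset with μ₂ + partSum ν K < partSum ν J,
            (μ₂ : ℚ) ^ ((J.card : ℤ) - K.card - 1) * (μ₃ : ℚ) ^ ((K.card : ℤ) - 1) *
              coeffC μ₂ μ₃ ν J K) := by
  have h1 : (μ₁ : ℚ) ≠ 0 := by positivity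
  have h2 : (μ₂ : ℚ) ≠ 0 := by positivity
  have h3 : (μ₃ : ℚ) ≠ 0 := by positivity
  refine mul_left_cancel₀ (mul_ne_zero (mul_ne_zero h1 h2) h3) ?_
  rw [mul_closedFormula_eq hμ₁ hμ₂ hμ₃ hd, doubleHurwitz_three n μ₁ μ₂ μ₃ ν hμ₁ hμ₂ hμ₃ hν hd]
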